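/- Let $p,q\in\mathbb C$ with $0<|p|,|q|<1$. Put $(z;q)_\infty=\prod_{j\ge0}(1-zq^j)$, $(z;p,q)_\infty=\prod_{j,k\ge0}(1-zp^jq^k)$, $\theta(z;p)=(z;p)_\infty(pz^{-1};p)_\infty$, $\Gamma(z;p,q)=(pqz^{-1};p,q)_\infty/(z;p,q)_\infty$, $\kappa=(p;p)_\infty(q;q)_\infty/4\pi i$. A product over several arguments is abbreviated as $\theta(a,b;p)=\theta(a;p)\theta(b;p)$, $\theta(at^{\pm1};p)=\theta(at;p)\theta(at^{-1};p)$, and similarly for $\Gamma$. For $t=(t_1,\dots,t_8)\in(\mathbb C^*)^8$ with $\prod_{j=1}^8t_j=p^2q^2$ which is unpinched, i.e. $t_jt_kp^aq^b\neq1$ for all $j,k\in\{1,\dots,8\}$ and all integers $a,b\ge0$, let $$V(t)=V(t_1,\dots,t_8;p,q)=\kappa\int_C\frac{\prod_{j=1}^8\Gamma(t_jz^{\pm1};p,q)}{\Gamma(z^{\pm2};p,q)}\frac{dz}{z},$$ where $C$ is a contour (cycle) having $0$ and all the points $t_jp^aq^b$ ($a,b\ge0$) inside and all their reciprocals outside;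 $C$ may be taken to be the positively oriented unit circle if all $|t_j|<1$, and in general $V$ is the analytic continuation in $t$ from that case. Write $V(qt_j,q^{-1}t_k)$ for $V$ with $t_j,t_k$ replaced by $qt_j,q^{-1}t_k$. (1) Contiguous relation. If $\prod_{j=1}^8t_j=p^2q^2$ and the parameters of the three $V$-functions below are unpinched, then $$t_7\,\theta(t_8t_7^{\pm1}/q;p)\,V(qt_6,q^{-1}t_8)-t_6\,\theta(t_8t_6^{\pm1}/q;p)\,V(qt_7,q^{-1}t_8)=t_7\,\theta(t_6t_7^{\pm1};p)\,V(t).$$ (2) Elliptic hypergeometric equation. Let $\varepsilon_1,\dots,\varepsilon_8\in\mathbb C$ satisfy $\prod_{k=1}^8\varepsilon_k=p^2q^2$ and $\varepsilon_7=\varepsilon_8/q$, let $c$ be either square root of $\varepsilon_6\varepsilon_8/p^4$, and put $$f_1(x)=\frac{V(q/c\varepsilon_1,\dots,q/c\varepsilon_5,cx,c/x,c/\varepsilon_8;p,q)}{\Gamma(c^2x^{\pm1}/\varepsilon_8,\,x^{\pm1}\varepsilon_8;p,q)}.$$ Then $f=f_1$ satisfies $$A(x)\bigl(f(qx)-f(x)\bigr)+A(x^{-1})\bigl(f(q^{-1}x)-f(x)\bigr)+\nu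 f(x)=0,$$ $$A(x)=\frac{\prod_{k=1}^8\theta(\varepsilon_kx;p)}{\theta(x^2,qx^2;p)},\qquad \nu=\prod_{k=1}^6\theta\Bigl(\frac{\varepsilon_k\varepsilon_8}{q};p\Bigr),$$ at every $x\in\mathbb C^*$ at which all terms are regular, i.e. such that $x^2,\ qx^2,\ qx^{-2}\notin p^{\mathbb Z}$ and, for each $y\in\{x,qx,q^{-1}x\}$, the parameters of the $V$-function in $f_1(y)$ are unpinched and none of the four numbers $c^2y^{\pm1}/\varepsilon_8,\ y^{\pm1}\varepsilon_8$ (arguments of the $\Gamma$-functions in the denominator) is of the form $p^{a+1}q^{b+1}$ with integers $a,b\ge0$ (a zero of $\Gamma$). -/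

import Mathlib

open Filter Topology

noncomputable section

namespace EllHyp

/-- `(z; q)_∞ = ∏_{j ≥ 0} (1 - z q^j)`. -/
def qPoch (q z : ℂ) : ℂ := ∏' j : ℕ, (1 - z * q ^ j)

/-- `(z; p, q)_∞ = ∏_{j,k ≥ 0} (1 - z p^j q^k)`. -/
def pqPoch (p q z : ℂ) : ℂ := ∏' jk : ℕ × ℕ, (1 - z * p ^ jk.1 * q ^ jk.2)

/-- The modified theta function `θ(z; p) = (z; p)_∞ (p z⁻¹; p)_∞`. -/
def theta (p z : ℂ) : ℂ := qPoch p z * qPoch p (p / z)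

/-- The elliptic gamma function `Γ(z; p, q) = (p q z⁻¹; p, q)_∞ / (z; p, q)_∞`. -/
def ellGamma (p q z : ℂ) : ℂ := pqPoch p q (p * q / z) / pqPoch p q z

/-- The kernel `Δ(z, t) = ∏_{j=1}^8 Γ(t_j z^{±1}; p, q) / Γ(z^{±2}; p, q)`. -/
def kernel (p q : ℂ) (t : Fin 8 → ℂ) (z : ℂ) : ℂ :=
  (∏ j, ellGamma p q (t j * z) * ellGamma p q (t j * z⁻¹)) /
    (ellGamma p q (z ^ 2) * ellGamma p q (z⁻¹ ^ 2))

/-- `κ = (p; p)_∞ (q; q)_∞ / (4 π i)`. -/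
def kappa (p q : ℂ) : ℂ := qPoch p p * qPoch q q / (4 * Real.pi * Complex.I)

/-- The points `t_j p^a q^b`, `a, b ≥ 0`: the sequences of poles of the kernel
which converge to zero. -/
def innerPoles (p q : ℂ) (t : Fin 8 → ℂ) : Set ℂ :=
  {w | ∃ (j : Fin 8) (a b : ℕ), w = t j * p ^ a * q ^ b}

/-- The reciprocals `t_j⁻¹ p^{-a} q^{-b}`: the sequences of poles which go to infinity. -/
def outerPoles (p q : ℂ) (t : Fin 8 → ℂ) : Set ℂ :=
  {w | ∃ (j : Fin 8) (a b : ℕ), w = (t j * p ^ a * q ^ b)⁻¹}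

/-- The contour of integration is not pinched: no point of the sequences of poles converging
to zero coincides with a point of the sequences going to infinity, that is,
`t_j t_k ≠ p^{-a} q^{-b}` for all `j, k` and all `a, b ≥ 0`. -/
def Unpinched (p q : ℂ) (t : Fin 8 → ℂ) : Prop :=
  ∀ (j k : Fin 8) (a b : ℕ), t j * t k * p ^ a * q ^ b ≠ 1

/-- The circle of radius `r` about the origin does not meet the two families of poles. -/
def AdmissibleRadius (p q : ℂ) (t : Fin 8 → ℂ) (r : ℝ) : Prop :=
  0 < r ∧ ∀ w ∈ innerPoles p q t ∪ outerPoles p q t, ‖w‖ ≠ r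

theorem exists_admissibleRadius (p q : ℂ) (t : Fin 8 → ℂ) :
    ∃ r : ℝ, AdmissibleRadius p q t r := by
  have h1 : (innerPoles p q t).Countable := by
    have : innerPoles p q t =
        Set.range (fun x : Fin 8 × ℕ × ℕ => t x.1 * p ^ x.2.1 * q ^ x.2.2) := by
      ext w; simp [innerPoles, eq_comm]
    rw [this]; exact Set.countable_range _
  have h2 : (outerPoles p q t).Countable := by
    have : outerPoles p q t =
        Set.range (fun x : Fin 8 × ℕ × ℕ => (t x.1 * p ^ x.2.1 * q ^ x.2.2)⁻¹) := by
      ext w; simp only [outerPoles, Set.mem_ofPred_eq, Set.mem_range, Prod.exists, eq_comm]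
    rw [this]; exact Set.countable_range _
  have h3 : ((fun w : ℂ => ‖w‖) '' (innerPoles p q t ∪ outerPoles p q t)).Countable :=
    (h1.union h2).image _
  have hd := h3.dense_compl ℝ
  obtain ⟨r, hr, hr0⟩ := hd.exists_gt 0
  exact ⟨r, hr0, fun w hw h => hr ⟨w, hw, h⟩⟩

open Classical in
/-- The radius of the reference circle: the unit circle whenever no pole lies on it, and some
circle free of poles otherwise. -/
def contourRadius (p q : ℂ) (t : Fin 8 → ℂ) : ℝ :=
  if AdmissibleRadius p q t 1 then 1 else (exists_admissibleRadius p q t).choose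

/-- The residue of `f` at an isolated singularity `w`: the value of `(2πi)⁻¹ ∮ f(z) dz` over
all sufficiently small circles about `w`. -/
def residue (f : ℂ → ℂ) (w : ℂ) : ℂ :=
  limUnder (𝓝[>] (0 : ℝ)) fun δ => (2 * Real.pi * Complex.I)⁻¹ * ∮ z in C(w, δ), f z

/-- The elliptic hypergeometric function `V(t; p, q)`, analytically continued in the
parameters: the integral `κ ∮ Δ(z, t) dz/z` over a contour which has all the points
`t_j p^a q^b` inside and all their reciprocals outside. Such a contour is a circle about the
origin, corrected by the residues of those poles which lie on the wrong side of it.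
For unpinched `t` the value does not depend on the circle (residue theorem). -/
def V (p q : ℂ) (t : Fin 8 → ℂ) : ℂ :=
  kappa p q *
    ((∮ z in C(0, contourRadius p q t), kernel p q t z / z) +
      2 * Real.pi * Complex.I *
        ((∑ᶠ w ∈ {w | w ∈ innerPoles p q t ∧ contourRadius p q t < ‖w‖},
            residue (fun z => kernel p q t z / z) w) -
          ∑ᶠ w ∈ {w | w ∈ outerPoles p q t ∧ ‖w‖ < contourRadius p q t},
            residue (fun z => kernel p q t z / z) w))

/-- If all `|t_j| < 1`, then `V` is the integral over the unit circle. -/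
theorem V_eq_integral (p q : ℂ) (hp0 : p ≠ 0) (hq0 : q ≠ 0) (hp : ‖p‖ < 1) (hq : ‖q‖ < 1)
    (t : Fin 8 → ℂ) (ht0 : ∀ j, t j ≠ 0) (ht : ∀ j, ‖t j‖ < 1) :
    V p q t = kappa p q * ∮ z in C(0, 1), kernel p q t z / z := by
  have key : ∀ (j : Fin 8) (a b : ℕ), ‖t j * p ^ a * q ^ b‖ < 1 := by
    intro j a b
    rw [norm_mul, norm_mul, norm_pow, norm_pow]
    have h1 : ‖p‖ ^ a ≤ 1 := pow_le_one₀ (norm_nonneg _) hp.le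
    have h2 : ‖q‖ ^ b ≤ 1 := pow_le_one₀ (norm_nonneg _) hq.le
    calc ‖t j‖ * ‖p‖ ^ a * ‖q‖ ^ b ≤ ‖t j‖ * 1 * 1 := by gcongr
      _ < 1 := by simpa using ht j
  have hin : ∀ w ∈ innerPoles p q t, ‖w‖ < 1 := by
    rintro w ⟨j, a, b, rfl⟩; exact key j a b
  have hout : ∀ w ∈ outerPoles p q t, 1 < ‖w‖ := by
    rintro w ⟨j, a, b, rfl⟩
    rw [norm_inv]
    exact (one_lt_inv₀ (by
      rw [norm_pos_iff]
      exact mul_ne_zero (mul_ne_zero (ht0 j) (pow_ne_zero _ hp0)) (pow_ne_zero _ hq0))).2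
      (key j a b)
  have hadm : AdmissibleRadius p q t 1 := by
    refine ⟨one_pos, ?_⟩
    rintro w (hw | hw)
    · exact (hin w hw).ne
    · exact (hout w hw).ne'
  have hr : contourRadius p q t = 1 := by simp [contourRadius, hadm]
  have e1 : {w | w ∈ innerPoles p q t ∧ contourRadius p q t < ‖w‖} = ∅ := by
    ext w; simp only [hr, Set.mem_ofPred_eq, Set.mem_empty_iff_false, iff_false, not_and, not_lt]
    exact fun hw => (hin w hw).le
  have e2 : {w | w ∈ outerPoles p q t ∧ ‖w‖ < contourRadius p q t} = ∅ := by
    ext w; simp only [hr, Set.mem_ofPred_eq, Set.mem_empty_iff_false, iff_false, not_and, not_lt]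
    exact fun hw => (hout w hw).le
  rw [V, e1, e2, hr]
  simp

/-- The contiguous parameters: `t_j` and `t_k` replaced by `q t_j` and `q⁻¹ t_k` (`j ≠ k`). -/
def contiguous (q : ℂ) (t : Fin 8 → ℂ) (j k : Fin 8) : Fin 8 → ℂ :=
  Function.update (Function.update t j (q * t j)) k (q⁻¹ * t k)

/-- The potential `A(x) = ∏_{k=1}^8 θ(ε_k x; p) / θ(x², q x²; p)`. -/
def potential (p q : ℂ) (ε : Fin 8 → ℂ) (x : ℂ) : ℂ :=
  (∏ k, theta p (ε k * x)) / (theta p (x ^ 2) * theta p (q * x ^ 2))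

/-- `ν = ∏_{k=1}^6 θ(ε_k ε_8 / q; p)`. -/
def nu (p q : ℂ) (ε : Fin 8 → ℂ) : ℂ :=
  ∏ k : Fin 6, theta p (ε (k.castLE (by norm_num)) * ε 7 / q)

/-- The elliptic hypergeometric equation for the function `f` at the point `x`. -/
def EllHypEq (p q : ℂ) (ε : Fin 8 → ℂ) (f : ℂ → ℂ) (x : ℂ) : Prop :=
  potential p q ε x * (f (q * x) - f x) +
    potential p q ε x⁻¹ * (f (q⁻¹ * x) - f x) + nu p q ε * f x = 0

/-- The parameters `(q/(cε_1), …, q/(cε_5), c x, c/x, c/ε_8)` of the `V`-function. -/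
def solParams (q : ℂ) (ε : Fin 8 → ℂ) (c x : ℂ) : Fin 8 → ℂ :=
  ![q / (c * ε 0), q / (c * ε 1), q / (c * ε 2), q / (c * ε 3), q / (c * ε 4),
    c * x, c / x, c / ε 7]

/-- The arguments `c² x / ε_8, c² x⁻¹ / ε_8, x ε_8, x⁻¹ ε_8` of the elliptic gamma functions in
the denominator of the solution. -/
def solGammaArgs (ε : Fin 8 → ℂ) (c x : ℂ) : Fin 4 → ℂ :=
  ![c ^ 2 * x / ε 7, c ^ 2 * x⁻¹ / ε 7, x * ε 7, x⁻¹ * ε 7]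

/-- `f_1(x) = V(q/(cε_1), …, q/(cε_5), c x, c/x, c/ε_8) / Γ(c² x^{±1}/ε_8, x^{±1} ε_8; p, q)`. -/
def f₁ (p q : ℂ) (ε : Fin 8 → ℂ) (c x : ℂ) : ℂ :=
  V p q (solParams q ε c x) / ∏ i, ellGamma p q (solGammaArgs ε c x i)

/-- `x` is a regular point of the expression for `f_1`: the contour of the `V`-function is not
pinched and no elliptic gamma function in the denominator vanishes (the zeros of
`Γ(z; p, q)` are the points `p^{a+1} q^{b+1}`, `a, b ≥ 0`). -/
def RegularPoint (p q : ℂ) (ε : Fin 8 → ℂ) (c x : ℂ) : Prop :=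
  Unpinched p q (solParams q ε c x) ∧
    ∀ (i : Fin 4) (a b : ℕ), solGammaArgs ε c x i ≠ p ^ (a + 1) * q ^ (b + 1)

end EllHyp

end

/-!
The theorem is a statement about the integrand, carried over to all parameters by analytic
continuation.

*Inside the unit disc.* If all the parameters have modulus less than one, `V` is an integral over
the unit circle. Multiplying one parameter `t_j` by `q` multiplies the integrand by
`θ(t_j z^{±1}; p)`, so relations between contiguous functions are theta function identities. The
contiguous relation is the addition formula `theta_addition` under the integral sign
(`contiguous_of_norm_lt`). For the elliptic hypergeometric equation a second relation is needed.
Assume `∏ w_j = p²`. The function `h` called `antisymKernel` satisfies `h(z / q) = -h(1 / z)` and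
has no poles with `1 ≤ |z| ≤ 1 / |q|`, so `∮ h dz / z = 0`. Its symmetrization `h(z) + h(1 / z)` is
the integrand of `V(w)` times `(z⁻¹ ∏ θ(w_j z; p) - z³ ∏ θ(w_j / z; p)) / θ(z²; p)`, and for generic
`w_j` this factor is a linear combination of products of two of the `θ(w_j z^{±1}; p)`,
`j = 6, 7, 8`. The last claim, `interpolationDefect_eq_zero`, is an identity between theta functions
of degree eight, which need only be compared at nine points. The outcome is
`secondContiguous_of_norm_lt`.

*All parameters.* `V` is defined by a circle corrected by finitely many residues. Such a cycle can
be deformed without changing the integral (`cycleIntegral_eq`), and near given unpinched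
parameters one and the same cycle can be used; so `V` is analytic at unpinched parameters
(`analyticAt_V`). Parameters with a given product are joined to a point with eight equal
coordinates by a complex line in logarithmic coordinates (`expPath`). On it the pinched parameters
are the zeros of an entire function that does not vanish identically, so they form a countable set,
and the rest is connected. Hence a relation which holds near a torus inside the unit polydisc holds
for all unpinched parameters (`eq_zero_of_eq_zero_near_torus`).

*The equation.* Eliminating two of the five functions between the second relation and two contiguous
relations gives a relation between the three functions in the equation (`threeTerm_shift`). Rewriting
the potential, `ν` and the elliptic gamma factors turns it into the equation for `f₁`.
-/

open Filter Topology

noncomputable section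

namespace EllHyp

/-! ### Infinite products -/

theorem differentiable_tprod_one_sub {ι : Type*} {a : ι → ℂ} (ha : Summable fun i => ‖a i‖) :
    Differentiable ℂ fun z : ℂ => ∏' i, (1 - z * a i) := by
  have key : ∀ R : ℝ, DifferentiableOn ℂ (fun z : ℂ => ∏' i, (1 - z * a i)) (Metric.ball 0 R) := by
    intro R
    have h := Summable.hasProdLocallyUniformlyOn_one_add (f := fun i (z : ℂ) => -(z * a i))
      (K := Metric.ball (0 : ℂ) R) (u := fun i => R * ‖a i‖) Metric.isOpen_ball (ha.mul_left R)
      (Eventually.of_forall fun i z hz => by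
        rw [norm_neg, norm_mul]
        gcongr
        exact (mem_ball_zero_iff.1 hz).le) (fun i => by fun_prop)
    have h2 := (hasProdLocallyUniformlyOn_iff_tendstoLocallyUniformlyOn.1 h).differentiableOn
      (Eventually.of_forall fun s => by
        have : Differentiable ℂ (fun z : ℂ => ∏ i ∈ s, (1 + -(z * a i))) := by fun_prop
        exact this.differentiableOn) Metric.isOpen_ball
    simpa only [sub_eq_add_neg] using h2
  intro z
  exact (key (‖z‖ + 1)).differentiableAt (Metric.isOpen_ball.mem_nhds (by simp))

theorem multipliable_one_sub {ι : Type*} {a : ι → ℂ} (ha : Summable fun i => ‖a i‖) (z : ℂ) :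
    Multipliable fun i => (1 - z * a i) := by
  have : Summable fun i => ‖-(z * a i)‖ := by simpa using ha.mul_left ‖z‖
  simpa only [sub_eq_add_neg] using multipliable_one_add_of_summable this

theorem tprod_one_sub_eq_zero_iff {ι : Type*} {a : ι → ℂ} (ha : Summable fun i => ‖a i‖) (z : ℂ) :
    ∏' i, (1 - z * a i) = 0 ↔ ∃ i, z * a i = 1 := by
  constructor
  · intro h
    by_contra! hne
    have : Summable fun i => ‖-(z * a i)‖ := by simpa using ha.mul_left ‖z‖
    refine tprod_one_add_ne_zero_of_summable (f := fun i => -(z * a i)) (fun i hi => hne i ?_) this ?_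
    · linear_combination -hi
    · simpa only [sub_eq_add_neg] using h
  · rintro ⟨i, hi⟩
    exact tprod_of_exists_eq_zero ⟨i, by rw [hi, sub_self]⟩

theorem summable_norm_pow {q : ℂ} (hq : ‖q‖ < 1) : Summable fun j : ℕ => ‖q ^ j‖ := by
  simpa using summable_geometric_of_lt_one (norm_nonneg q) hq

theorem summable_norm_pow_mul_pow {p q : ℂ} (hp : ‖p‖ < 1) (hq : ‖q‖ < 1) :
    Summable fun jk : ℕ × ℕ => ‖p ^ jk.1 * q ^ jk.2‖ := by
  simpa using (summable_geometric_of_lt_one (norm_nonneg p) hp).mul_of_nonneg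
    (summable_geometric_of_lt_one (norm_nonneg q) hq) (fun _ => by positivity)
    (fun _ => by positivity)

theorem pqPoch_eq (p q z : ℂ) : pqPoch p q z = ∏' jk : ℕ × ℕ, (1 - z * (p ^ jk.1 * q ^ jk.2)) := by
  simp only [pqPoch, mul_assoc]

theorem differentiable_qPoch {q : ℂ} (hq : ‖q‖ < 1) : Differentiable ℂ (qPoch q) :=
  differentiable_tprod_one_sub (summable_norm_pow hq)

theorem differentiable_pqPoch {p q : ℂ} (hp : ‖p‖ < 1) (hq : ‖q‖ < 1) :
    Differentiable ℂ (pqPoch p q) := by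
  rw [funext (pqPoch_eq p q)]
  exact differentiable_tprod_one_sub (summable_norm_pow_mul_pow hp hq)

theorem qPoch_eq_zero_iff {q : ℂ} (hq : ‖q‖ < 1) {z : ℂ} :
    qPoch q z = 0 ↔ ∃ j : ℕ, z * q ^ j = 1 :=
  tprod_one_sub_eq_zero_iff (summable_norm_pow hq) z

theorem pqPoch_eq_zero_iff {p q : ℂ} (hp : ‖p‖ < 1) (hq : ‖q‖ < 1) {z : ℂ} :
    pqPoch p q z = 0 ↔ ∃ a b : ℕ, z * p ^ a * q ^ b = 1 := by
  rw [pqPoch_eq, tprod_one_sub_eq_zero_iff (summable_norm_pow_mul_pow hp hq) z, Prod.exists]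
  simp only [mul_assoc]

theorem qPoch_ne_zero_of_norm_lt {q z : ℂ} (hq : ‖q‖ < 1) (hz : ‖z‖ < 1) : qPoch q z ≠ 0 := by
  rw [Ne, qPoch_eq_zero_iff hq]
  rintro ⟨j, hj⟩
  have := congrArg norm hj
  rw [norm_mul, norm_pow, norm_one] at this
  have h1 : ‖q‖ ^ j ≤ 1 := pow_le_one₀ (norm_nonneg _) hq.le
  nlinarith [norm_nonneg z, pow_nonneg (norm_nonneg q) j]

theorem pqPoch_ne_zero_of_norm_lt {p q z : ℂ} (hp : ‖p‖ < 1) (hq : ‖q‖ < 1) (hz : ‖z‖ < 1) :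
    pqPoch p q z ≠ 0 := by
  rw [Ne, pqPoch_eq_zero_iff hp hq]
  rintro ⟨a, b, h⟩
  have := congrArg norm h
  rw [norm_mul, norm_mul, norm_pow, norm_pow, norm_one] at this
  have h1 : ‖q‖ ^ b ≤ 1 := pow_le_one₀ (norm_nonneg _) hq.le
  have h2 : ‖p‖ ^ a ≤ 1 := pow_le_one₀ (norm_nonneg _) hp.le
  have h3 : ‖z‖ * ‖p‖ ^ a * ‖q‖ ^ b ≤ ‖z‖ * 1 * 1 := by gcongr
  linarith

theorem qPoch_eq_mul {q : ℂ} (hq : ‖q‖ < 1) (z : ℂ) : qPoch q z = (1 - z) * qPoch q (q * z) := by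
  have h := tprod_eq_zero_mul' (f := fun j : ℕ => 1 - z * q ^ j) (by
    simpa only [pow_succ', mul_assoc, mul_comm, mul_left_comm] using
      multipliable_one_sub (summable_norm_pow hq) (q * z))
  rw [qPoch, h, qPoch]
  simp only [pow_succ', pow_zero, mul_one]
  congr 1
  exact tprod_congr fun j => by ring

theorem pqPoch_comm (p q z : ℂ) : pqPoch p q z = pqPoch q p z := by
  rw [pqPoch, pqPoch, ← (Equiv.prodComm ℕ ℕ).tprod_eq]
  exact tprod_congr fun jk => by simp; ring

theorem pqPoch_eq_tprod {p q : ℂ} (hp : ‖p‖ < 1) (hq : ‖q‖ < 1) (z : ℂ) :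
    pqPoch p q z = ∏' k : ℕ, qPoch p (z * q ^ k) := by
  rw [pqPoch_comm, pqPoch_eq]
  have hm := multipliable_one_sub (summable_norm_pow_mul_pow hq hp) z
  rw [hm.tprod_prod' fun k => ?_]
  · exact tprod_congr fun k => tprod_congr fun j => by ring
  · simpa only [mul_assoc] using multipliable_one_sub (summable_norm_pow hp) (z * q ^ k)

theorem multipliable_qPoch {p q : ℂ} (hp : ‖p‖ < 1) (hq : ‖q‖ < 1) (z : ℂ) :
    Multipliable fun k : ℕ => qPoch p (z * q ^ k) := by
  have hm := multipliable_one_sub (summable_norm_pow_mul_pow hq hp) z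
  have h2 := (hm.hasProd.prod_fiberwise (g := fun k => qPoch p (z * q ^ k)) fun k => ?_)
  · exact h2.multipliable
  · have := (multipliable_one_sub (summable_norm_pow hp) (z * q ^ k)).hasProd
    simpa only [mul_assoc, qPoch] using this

theorem pqPoch_eq_mul {p q : ℂ} (hp : ‖p‖ < 1) (hq : ‖q‖ < 1) (z : ℂ) :
    pqPoch p q z = qPoch p z * pqPoch p q (q * z) := by
  rw [pqPoch_eq_tprod hp hq, pqPoch_eq_tprod hp hq,
    tprod_eq_zero_mul' (f := fun k : ℕ => qPoch p (z * q ^ k)) ?_]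
  · simp only [pow_zero, mul_one]
    congr 1
    exact tprod_congr fun j => by congr 1; ring
  · convert multipliable_qPoch hp hq (q * z) using 3; ring

theorem pqPoch_eq_mul' {p q : ℂ} (hp : ‖p‖ < 1) (hq : ‖q‖ < 1) (z : ℂ) :
    pqPoch p q z = qPoch q z * pqPoch p q (p * z) := by
  rw [pqPoch_comm, pqPoch_eq_mul hq hp, pqPoch_comm]

/-! ### The theta function -/

theorem differentiableAt_theta {p z : ℂ} (hp : ‖p‖ < 1) (hz : z ≠ 0) :
    DifferentiableAt ℂ (theta p) z := by
  have h := differentiable_qPoch hp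
  unfold theta
  exact (h z).mul ((h (p / z)).comp z (by fun_prop (disch := assumption)))

theorem theta_p_div (p z : ℂ) (hp0 : p ≠ 0) : theta p (p / z) = theta p z := by
  rw [theta, theta, div_div_cancel₀ hp0, mul_comm]

theorem theta_inv {p z : ℂ} (hp : ‖p‖ < 1) (hz : z ≠ 0) : theta p z⁻¹ = -z⁻¹ * theta p z := by
  rw [theta, theta, div_inv_eq_mul, qPoch_eq_mul hp z, qPoch_eq_mul hp z⁻¹, ← div_eq_mul_inv p z]
  field_simp
  ring

theorem theta_mul_p {p z : ℂ} (hp0 : p ≠ 0) (hp : ‖p‖ < 1) (hz : z ≠ 0) :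
    theta p (p * z) = -z⁻¹ * theta p z := by
  rw [← theta_inv hp hz, ← theta_p_div _ _ hp0, div_mul_cancel_left₀ hp0]

theorem theta_one {p : ℂ} (hp : ‖p‖ < 1) : theta p 1 = 0 := by
  rw [theta, qPoch_eq_mul hp 1]; simp

theorem theta_eq_zero_iff {p z : ℂ} (hp0 : p ≠ 0) (hp : ‖p‖ < 1) (hz : z ≠ 0) :
    theta p z = 0 ↔ ∃ n : ℤ, z = p ^ n := by
  rw [theta, mul_eq_zero, qPoch_eq_zero_iff hp, qPoch_eq_zero_iff hp]
  constructor
  · rintro (⟨j, hj⟩ | ⟨j, hj⟩)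
    · exact ⟨-j, by rw [zpow_neg, zpow_natCast]; exact eq_inv_of_mul_eq_one_left hj⟩
    · refine ⟨j + 1, ?_⟩
      rw [zpow_add₀ hp0, zpow_natCast, zpow_one]
      field_simp at hj
      linear_combination -hj
  · rintro ⟨n, rfl⟩
    rcases le_or_gt n 0 with hn | hn
    · obtain ⟨m, rfl⟩ := Int.exists_eq_neg_ofNat hn
      left; exact ⟨m, by rw [← zpow_natCast, ← zpow_add₀ hp0]; simp⟩
    · right
      obtain ⟨m, rfl⟩ := Int.eq_succ_of_zero_lt hn
      refine ⟨m, ?_⟩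
      rw [zpow_add₀ hp0, zpow_natCast, zpow_one]
      field_simp

/-! ### The elliptic gamma function -/

theorem ellGamma_mul_q {p q z : ℂ} (hp : ‖p‖ < 1) (hq0 : q ≠ 0) (hq : ‖q‖ < 1)
    (h : qPoch p z ≠ 0) : ellGamma p q (q * z) = theta p z * ellGamma p q z := by
  have e1 : p * q / (q * z) = p / z := by rw [mul_comm p q, mul_div_mul_left _ _ hq0]
  have e2 : q * (p / z) = p * q / z := by ring
  rw [ellGamma, ellGamma, e1, pqPoch_eq_mul hp hq z, pqPoch_eq_mul hp hq (p / z), e2, theta]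
  rcases eq_or_ne (pqPoch p q (q * z)) 0 with h0 | h0
  · simp [h0]
  · field_simp

/-- The reciprocal of the elliptic gamma function satisfies the same functional equation
away from the poles of `1 / Γ`. -/
theorem inv_ellGamma_eq {p q z : ℂ} (hp : ‖p‖ < 1) (hq0 : q ≠ 0) (hq : ‖q‖ < 1)
    (h : qPoch p (p / z) ≠ 0) :
    (ellGamma p q z)⁻¹ = theta p z * (ellGamma p q (q * z))⁻¹ := by
  have e1 : p * q / (q * z) = p / z := by rw [mul_comm p q, mul_div_mul_left _ _ hq0]
  have e2 : q * (p / z) = p * q / z := by ring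
  rw [ellGamma, ellGamma, e1, pqPoch_eq_mul hp hq z, pqPoch_eq_mul hp hq (p / z), e2, theta,
    inv_div, inv_div]
  rcases eq_or_ne (pqPoch p q (p * q / z)) 0 with h0 | h0
  · simp [h0]
  · field_simp

/-- The reflection formula: `1 / Γ(z, z⁻¹; p, q) = θ(z; p) θ(z⁻¹; q)`. -/
theorem inv_ellGamma_mul_ellGamma_inv {p q z : ℂ} (hp : ‖p‖ < 1) (hq : ‖q‖ < 1)
    (h1 : pqPoch p q (p * q * z) ≠ 0) (h2 : pqPoch p q (p * q / z) ≠ 0) :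
    (ellGamma p q z * ellGamma p q z⁻¹)⁻¹ = theta p z * theta q z⁻¹ := by
  have e1 : pqPoch p q z = qPoch p z * (qPoch q (q * z) * pqPoch p q (p * q * z)) := by
    rw [pqPoch_eq_mul hp hq z, pqPoch_eq_mul' hp hq (q * z), mul_assoc p q z]
  have e2 : pqPoch p q z⁻¹ = qPoch q z⁻¹ * (qPoch p (p / z) * pqPoch p q (p * q / z)) := by
    rw [pqPoch_eq_mul' hp hq z⁻¹, pqPoch_eq_mul hp hq (p * z⁻¹)]
    congr 3
    ring
  rw [mul_inv, ellGamma, ellGamma, inv_div, inv_div, div_inv_eq_mul, e1, e2, theta, theta,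
    div_inv_eq_mul]
  generalize pqPoch p q (p * q * z) = a at *
  generalize pqPoch p q (p * q / z) = b at *
  field_simp

/-! ### Residues and the deformation of cycles -/

/-- Local principal part: a quotient `g / (z - w)^n` is, near `w`, the sum of an analytic function,
a simple pole, and the derivative of a function defined off `w`. -/
theorem exists_principalPart_at (w : ℂ) (n : ℕ) : ∀ g : ℂ → ℂ, AnalyticAt ℂ g w →
    ∃ (a : ℂ) (h R R' : ℂ → ℂ), AnalyticAt ℂ h w ∧ (∀ z ≠ w, HasDerivAt R (R' z) z) ∧
      ∀ᶠ z in 𝓝[≠] w, g z / (z - w) ^ n = h z + a / (z - w) + R' z := by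
  induction n with
  | zero =>
    intro g hg
    exact ⟨0, g, 0, 0, hg, fun z _ => hasDerivAt_const z 0, by simp⟩
  | succ n ih =>
    intro g hg
    have hg1 : AnalyticAt ℂ (dslope g w) w := by
      obtain ⟨s, hs, hd⟩ := hg.eventually_analyticAt.exists_mem
      refine DifferentiableOn.analyticAt (s := s) ?_ hs
      rw [Complex.differentiableOn_dslope hs]
      exact fun z hz => (hd z hz).differentiableAt.differentiableWithinAt
    obtain ⟨a, h, R, R', hh, hR, he⟩ := ih (dslope g w) hg1
    have hsplit : ∀ᶠ z in 𝓝[≠] w, g z / (z - w) ^ (n + 1) =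
        g w / (z - w) ^ (n + 1) + dslope g w z / (z - w) ^ n := by
      filter_upwards [self_mem_nhdsWithin] with z hz
      have hz' : z - w ≠ 0 := sub_ne_zero.2 hz
      rw [dslope_of_ne _ hz, slope_def_field]
      field_simp
      ring
    rcases Nat.eq_zero_or_pos n with rfl | hn
    · refine ⟨a + g w, h, R, R', hh, hR, ?_⟩
      filter_upwards [hsplit, he] with z h1 h2
      rw [h1, h2, zero_add, pow_one]
      ring
    · refine ⟨a, h, fun z => R z + -(g w / n) / (z - w) ^ n,
        fun z => R' z + g w / (z - w) ^ (n + 1), hh, fun z hz => ?_, ?_⟩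
      · have hz' : z - w ≠ 0 := sub_ne_zero.2 hz
        refine (hR z hz).add ?_
        have h1 : HasDerivAt (fun z : ℂ => (z - w) ^ n) (n * (z - w) ^ (n - 1) * 1) z :=
          ((hasDerivAt_id z).sub_const w).pow n
        have h2 := (hasDerivAt_const z (-(g w / n))).div h1 (pow_ne_zero n hz')
        refine h2.congr_deriv ?_
        obtain ⟨m, rfl⟩ : ∃ m, n = m + 1 := ⟨n - 1, by omega⟩
        have hm : ((m + 1 : ℕ) : ℂ) ≠ 0 := Nat.cast_ne_zero.2 (by omega)
        rw [Nat.add_sub_cancel]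
        field_simp
        ring
      · filter_upwards [hsplit, he] with z h1 h2
        rw [h1, h2]
        ring

/-- Global principal parts: a function which is meromorphic on `U` with poles in the finite set `S`
is the sum of a function analytic on `U`, simple poles, and a derivative. -/
theorem exists_principalParts {U : Set ℂ} (S : Finset ℂ) : ∀ F : ℂ → ℂ,
    (S : Set ℂ) ⊆ U → (∀ z ∈ U, z ∉ S → AnalyticAt ℂ F z) → (∀ z ∈ S, MeromorphicAt F z) →
    ∃ (a H R R' : ℂ → ℂ), (∀ z ∈ U, AnalyticAt ℂ H z) ∧ (∀ z ∉ S, HasDerivAt R (R' z) z) ∧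
      ∀ z ∈ U, z ∉ S → F z = H z + ∑ w ∈ S, a w / (z - w) + R' z := by
  classical
  induction S using Finset.induction_on with
  | empty =>
    intro F _ hF _
    exact ⟨0, F, 0, 0, fun z hz => hF z hz (by simp), fun z _ => hasDerivAt_const z 0, by simp⟩
  | insert w S hwS ih =>
    intro F hSU hF hM
    have hwU : w ∈ U := hSU (by simp)
    obtain ⟨n, hn⟩ := hM w (by simp)
    obtain ⟨a, h, R, R', hh, hR, he⟩ := exists_principalPart_at w n _ hn
    have he' : ∀ᶠ z in 𝓝[≠] w, F z - a / (z - w) - R' z = h z := by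
      filter_upwards [he, self_mem_nhdsWithin] with z h1 h2
      have hz' : z - w ≠ 0 := sub_ne_zero.2 h2
      rw [smul_eq_mul, mul_div_cancel_left₀ _ (pow_ne_zero n hz')] at h1
      rw [h1]
      ring
    have hRan : ∀ z ≠ w, AnalyticAt ℂ R' z := by
      intro z hz
      have hd : DifferentiableOn ℂ R {w}ᶜ := fun y hy =>
        (hR y hy).differentiableAt.differentiableWithinAt
      have hnh : ({w}ᶜ : Set ℂ) ∈ 𝓝 z := isOpen_compl_singleton.mem_nhds hz
      refine (hd.analyticAt hnh).deriv.congr ?_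
      filter_upwards [hnh] with y hy using (hR y hy).deriv
    have hsub : ∀ z ≠ w, AnalyticAt ℂ (fun z => a / (z - w)) z := fun z hz =>
      analyticAt_const.div (analyticAt_id.sub analyticAt_const) (sub_ne_zero.2 hz)
    set F1 : ℂ → ℂ := Function.update (fun z => F z - a / (z - w) - R' z) w (h w) with hF1
    have hF1ne : ∀ z ≠ w, F1 =ᶠ[𝓝 z] fun z => F z - a / (z - w) - R' z := by
      intro z hz
      filter_upwards [isOpen_compl_singleton.mem_nhds hz] with y hy
      exact Function.update_of_ne hy _ _
    have hF1w : F1 =ᶠ[𝓝 w] h := by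
      rw [eventually_nhdsWithin_iff] at he'
      filter_upwards [he'] with z hz
      rcases eq_or_ne z w with rfl | hzw
      · simp [hF1]
      · rw [hF1, Function.update_of_ne hzw]
        exact hz hzw
    obtain ⟨b, H, R1, R1', hH, hR1, hdec⟩ := ih F1 (fun z hz => hSU (by simp [Finset.mem_coe.1 hz]))
      (fun z hzU hzS => by
        rcases eq_or_ne z w with rfl | hzw
        · exact hh.congr hF1w.symm
        · exact (((hF z hzU (by simp [hzw, hzS])).sub (hsub z hzw)).sub (hRan z hzw)).congr
            (hF1ne z hzw).symm)
      (fun z hzS => by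
        have hzw : z ≠ w := fun h => hwS (h ▸ hzS)
        exact (((hM z (by simp [hzS])).sub (hsub z hzw).meromorphicAt).sub
          (hRan z hzw).meromorphicAt).congr
            ((hF1ne z hzw).symm.filter_mono nhdsWithin_le_nhds))
    refine ⟨Function.update b w a, H, fun z => R1 z + R z, fun z => R1' z + R' z, hH,
      fun z hz => ?_, fun z hzU hz => ?_⟩
    · simp only [Finset.mem_insert, not_or] at hz
      exact (hR1 z hz.2).add (hR z hz.1)
    · simp only [Finset.mem_insert, not_or] at hz
      have h1 := hdec z hzU hz.2
      rw [(hF1ne z hz.1).eq_of_nhds] at h1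
      rw [Finset.sum_insert hwS, Function.update_self, Finset.sum_congr rfl (g := fun y => b y / (z - y))]
      · linear_combination h1
      · intro y hy
        rw [Function.update_of_ne]
        rintro rfl
        exact hwS hy

theorem circleIntegral_sub_inv_of_notMem {c w : ℂ} {ρ : ℝ} (hρ : 0 ≤ ρ)
    (hw : w ∉ Metric.closedBall c ρ) : (∮ z in C(c, ρ), (z - w)⁻¹) = 0 := by
  have hne : ∀ z ∈ Metric.closedBall c ρ, z - w ≠ 0 := fun z hz h =>
    hw (sub_eq_zero.1 h ▸ hz)
  refine Complex.circleIntegral_eq_zero_of_differentiable_on_off_countable hρ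
    Set.countable_empty ?_ ?_
  · exact ContinuousOn.inv₀ (by fun_prop) hne
  · intro z hz
    exact DifferentiableAt.inv (by fun_prop) (hne z (Metric.ball_subset_closedBall hz.1))

/-- The circle integral of a function given by its principal parts. -/
theorem circleIntegral_of_principalParts {F a H R R' : ℂ → ℂ} {S : Finset ℂ} {c : ℂ} {ρ : ℝ}
    (hρ : 0 < ρ) (hH : ∀ z ∈ Metric.sphere c ρ, ContinuousAt H z)
    (hR : ∀ z ∉ S, HasDerivAt R (R' z) z)
    (hS : ∀ z ∈ Metric.sphere c ρ, z ∉ S)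
    (hF : ∀ z ∈ Metric.sphere c ρ, F z = H z + ∑ w ∈ S, a w / (z - w) + R' z) :
    (∮ z in C(c, ρ), F z) = (∮ z in C(c, ρ), H z) +
      2 * Real.pi * Complex.I * ∑ w ∈ S, (open Classical in if w ∈ Metric.ball c ρ then a w else 0) := by
  classical
  have hHi : CircleIntegrable H c ρ :=
    ContinuousOn.circleIntegrable hρ.le fun z hz => (hH z hz).continuousWithinAt
  have hsi : ∀ w ∈ S, CircleIntegrable (fun z => a w / (z - w)) c ρ := fun w hw =>
    ContinuousOn.circleIntegrable hρ.le (ContinuousOn.div continuousOn_const (by fun_prop)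
      fun z hz h => hS z hz (sub_eq_zero.1 h ▸ hw))
  have hR'c : ContinuousOn R' (Metric.sphere c ρ) := by
    intro z hz
    have hd : DifferentiableOn ℂ R (S : Set ℂ)ᶜ := fun y hy =>
      (hR y hy).differentiableAt.differentiableWithinAt
    have hnh : ((S : Set ℂ)ᶜ : Set ℂ) ∈ 𝓝 z :=
      S.finite_toSet.isClosed.isOpen_compl.mem_nhds (hS z hz)
    have : AnalyticAt ℂ R' z := by
      refine (hd.analyticAt hnh).deriv.congr ?_
      filter_upwards [hnh] with y hy using (hR y hy).deriv
    exact this.continuousAt.continuousWithinAt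
  have hR'i : CircleIntegrable R' c ρ := hR'c.circleIntegrable hρ.le
  have hsum : CircleIntegrable (fun z => ∑ w ∈ S, a w / (z - w)) c ρ := by
    convert CircleIntegrable.sum S hsi using 1
    ext z; simp
  have hHs : CircleIntegrable (fun z => H z + ∑ w ∈ S, a w / (z - w)) c ρ := hHi.add hsum
  rw [circleIntegral.integral_congr hρ.le hF, circleIntegral.integral_add hHs hR'i,
    circleIntegral.integral_add hHi hsum, circleIntegral.integral_fun_sum hsi,
    circleIntegral.integral_eq_zero_of_hasDerivWithinAt hρ.le
      (fun z hz => (hR z (hS z hz)).hasDerivWithinAt), add_zero, Finset.mul_sum]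
  congr 1
  refine Finset.sum_congr rfl fun w hw => ?_
  simp only [div_eq_mul_inv]
  rw [circleIntegral.integral_const_mul]
  split_ifs with hb
  · rw [circleIntegral.integral_sub_inv_of_mem_ball hb]
    ring
  · rw [circleIntegral_sub_inv_of_notMem hρ.le, mul_zero, mul_zero]
    intro hcb
    rcases (Metric.mem_closedBall.1 hcb).lt_or_eq with h | h
    · exact hb h
    · exact hS w h hw

theorem residue_of_principalParts {U : Set ℂ} (hU : IsOpen U) {F a H R R' : ℂ → ℂ} {S : Finset ℂ}
    (hSU : (S : Set ℂ) ⊆ U) (hH : ∀ z ∈ U, AnalyticAt ℂ H z)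
    (hR : ∀ z ∉ S, HasDerivAt R (R' z) z)
    (hF : ∀ z ∈ U, z ∉ S → F z = H z + ∑ w ∈ S, a w / (z - w) + R' z) {w : ℂ} (hw : w ∈ S) :
    residue F w = a w := by
  classical
  have hnh : U ∩ ((S.erase w : Finset ℂ) : Set ℂ)ᶜ ∈ 𝓝 w :=
    inter_mem (hU.mem_nhds (hSU hw))
      ((S.erase w).finite_toSet.isClosed.isOpen_compl.mem_nhds (by simp))
  obtain ⟨δ₀, hδ₀, hsub⟩ := Metric.mem_nhds_iff.1 hnh
  refine Tendsto.limUnder_eq (tendsto_const_nhds.congr' ?_)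
  filter_upwards [Ioo_mem_nhdsGT hδ₀] with δ hδ
  have hcb : Metric.closedBall w δ ⊆ U ∩ ((S.erase w : Finset ℂ) : Set ℂ)ᶜ :=
    (Metric.closedBall_subset_ball hδ.2).trans hsub
  have hsph : ∀ z ∈ Metric.sphere w δ, z ∈ U ∧ z ∉ S := by
    intro z hz
    have h := hcb (Metric.sphere_subset_closedBall hz)
    refine ⟨h.1, fun hzS => h.2 ?_⟩
    have : z ≠ w := by rintro rfl; simp [hδ.1.ne] at hz
    simp [this, hzS]
  rw [circleIntegral_of_principalParts (S := S) (a := a) (H := H) (R := R) (R' := R') hδ.1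
    (fun z hz => (hH z (hsph z hz).1).continuousAt) hR (fun z hz => (hsph z hz).2)
    (fun z hz => hF z (hsph z hz).1 (hsph z hz).2)]
  rw [Complex.circleIntegral_eq_zero_of_differentiable_on_off_countable hδ.1.le Set.countable_empty
    (fun z hz => (hH z (hcb hz).1).continuousAt.continuousWithinAt)
    (fun z hz => (hH z (hcb (Metric.ball_subset_closedBall hz.1)).1).differentiableAt), zero_add,
    Finset.sum_eq_single w]
  · rw [if_pos (Metric.mem_ball_self hδ.1)]
    have := Real.pi_ne_zero
    have := Complex.I_ne_zero
    field_simp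
  · intro y hy hyw
    rw [if_neg]
    intro hyb
    exact (hcb (Metric.ball_subset_closedBall hyb)).2 (by simp [hyw, hy])
  · exact fun h => (h hw).elim

open Classical in
/-- Deformation of cycles. The points of `P` (accumulating only at zero) have to stay inside and
those of `Q` (accumulating only at infinity) outside. Correcting the circle of radius `r` by
residues gives the same value as correcting the circle of radius `r₀` by small circles of radius
`δ` which enclose the points lying on the wrong side. -/
theorem cycleIntegral_eq {P Q : Set ℂ} {F : ℂ → ℂ} {m M r r₀ δ : ℝ} {S Wi Wo : Finset ℂ}
    (hPQ : Disjoint P Q) (hm : 0 < m)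
    (hS : ∀ z, z ∈ S ↔ (z ∈ P ∨ z ∈ Q) ∧ m < ‖z‖ ∧ ‖z‖ < M)
    (hPM : ∀ z ∈ P, ‖z‖ < M) (hQm : ∀ z ∈ Q, m < ‖z‖)
    (hF : ∀ z, m < ‖z‖ → ‖z‖ < M → z ∉ S → AnalyticAt ℂ F z) (hFS : ∀ z ∈ S, MeromorphicAt F z)
    (hmr : m < r) (hrM : r < M) (hr : ∀ z ∈ P ∪ Q, ‖z‖ ≠ r)
    (hmr₀ : m < r₀) (hrM₀ : r₀ < M) (hδ : 0 < δ)
    (hWi : ∀ c ∈ Wi, ∀ z ∈ Metric.closedBall c δ, r₀ < ‖z‖ ∧ ‖z‖ < M ∧ z ∉ Q)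
    (hWo : ∀ c ∈ Wo, ∀ z ∈ Metric.closedBall c δ, m < ‖z‖ ∧ ‖z‖ < r₀ ∧ z ∉ P)
    (hWid : ∀ c ∈ Wi, ∀ c' ∈ Wi, c ≠ c' →
      Disjoint (Metric.closedBall c δ) (Metric.closedBall c' δ))
    (hWod : ∀ c ∈ Wo, ∀ c' ∈ Wo, c ≠ c' →
      Disjoint (Metric.closedBall c δ) (Metric.closedBall c' δ))
    (hP : ∀ z ∈ P, r₀ ≤ ‖z‖ → ∃ c ∈ Wi, z ∈ Metric.ball c δ)
    (hQ : ∀ z ∈ Q, ‖z‖ ≤ r₀ → ∃ c ∈ Wo, z ∈ Metric.ball c δ) :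
    (∮ z in C(0, r), F z) + 2 * Real.pi * Complex.I *
        ((∑ᶠ w ∈ {w | w ∈ P ∧ r < ‖w‖}, residue F w) -
          ∑ᶠ w ∈ {w | w ∈ Q ∧ ‖w‖ < r}, residue F w) =
      (∮ z in C(0, r₀), F z) + ((∑ c ∈ Wi, ∮ z in C(c, δ), F z) - ∑ c ∈ Wo, ∮ z in C(c, δ), F z) := by
  set U : Set ℂ := {z | m < ‖z‖ ∧ ‖z‖ < M} with hUdef
  have hU : IsOpen U := (isOpen_lt continuous_const continuous_norm).inter
    (isOpen_lt continuous_norm continuous_const)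
  have hSU : (S : Set ℂ) ⊆ U := fun z hz => ((hS z).1 hz).2
  obtain ⟨a, H, R, R', hH, hR, hdec⟩ := exists_principalParts S F hSU
    (fun z hz hzS => hF z hz.1 hz.2 hzS) hFS
  have hQP : ∀ z, z ∈ Q → z ∉ P := fun z h1 h2 => hPQ.le_bot ⟨h2, h1⟩
  -- circles of two admissible radii carry the same integral of the analytic part
  have hann : ∀ r₁ r₂ : ℝ, m < r₁ → r₁ ≤ r₂ → r₂ < M →
      (∮ z in C(0, r₂), H z) = ∮ z in C(0, r₁), H z := by
    intro r₁ r₂ h1 h2 h3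
    refine Complex.circleIntegral_eq_of_differentiable_on_annulus_off_countable (hm.trans h1) h2
      Set.countable_empty (fun z hz => (hH z ?_).continuousAt.continuousWithinAt)
      (fun z hz => (hH z ?_).differentiableAt)
    · simp only [Set.mem_sdiff, mem_closedBall_zero_iff, mem_ball_zero_iff, not_lt] at hz
      exact ⟨h1.trans_le hz.2, hz.1.trans_lt h3⟩
    · simp only [Set.mem_sdiff, mem_closedBall_zero_iff, mem_ball_zero_iff, not_le] at hz
      exact ⟨h1.trans hz.1.2, hz.1.1.trans h3⟩
  have hHr : (∮ z in C(0, r), H z) = ∮ z in C(0, r₀), H z := by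
    rcases le_total r r₀ with h | h
    · exact (hann r r₀ hmr h hrM₀).symm
    · exact hann r₀ r hmr₀ h hrM
  have hr₀ : ∀ z ∈ P ∪ Q, ‖z‖ ≠ r₀ := by
    rintro z (hz | hz) h
    · obtain ⟨c, hc, hzc⟩ := hP z hz h.ge
      exact (hWi c hc z (Metric.ball_subset_closedBall hzc)).1.ne' h
    · obtain ⟨c, hc, hzc⟩ := hQ z hz h.le
      exact (hWo c hc z (Metric.ball_subset_closedBall hzc)).2.1.ne h
  have hcirc : ∀ s : ℝ, m < s → s < M → (∀ z ∈ P ∪ Q, ‖z‖ ≠ s) →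
      (∮ z in C(0, s), F z) = (∮ z in C(0, s), H z) +
        2 * Real.pi * Complex.I * ∑ w ∈ S, (if w ∈ Metric.ball (0 : ℂ) s then a w else 0) := by
    intro s h1 h2 h3
    have hsU : ∀ z ∈ Metric.sphere (0 : ℂ) s, z ∈ U ∧ z ∉ S := fun z hz => by
      have hz' : ‖z‖ = s := mem_sphere_zero_iff_norm.1 hz
      exact ⟨⟨hz' ▸ h1, hz' ▸ h2⟩, fun h => h3 z ((hS z).1 h).1 hz'⟩
    exact circleIntegral_of_principalParts (hm.trans h1)
      (fun z hz => (hH z (hsU z hz).1).continuousAt) hR (fun z hz => (hsU z hz).2)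
      (fun z hz => hdec z (hsU z hz).1 (hsU z hz).2)
  have hsmall : ∀ c, (∀ z ∈ Metric.closedBall c δ, z ∈ U) → (∀ z ∈ Metric.sphere c δ, z ∉ S) →
      (∮ z in C(c, δ), F z) =
        2 * Real.pi * Complex.I * ∑ w ∈ S, (if w ∈ Metric.ball c δ then a w else 0) := by
    intro c h1 h2
    rw [circleIntegral_of_principalParts hδ
      (fun z hz => (hH z (h1 z (Metric.sphere_subset_closedBall hz))).continuousAt) hR h2
      (fun z hz => hdec z (h1 z (Metric.sphere_subset_closedBall hz)) (h2 z hz)),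
      Complex.circleIntegral_eq_zero_of_differentiable_on_off_countable hδ.le Set.countable_empty
        (fun z hz => (hH z (h1 z hz)).continuousAt.continuousWithinAt)
        (fun z hz => (hH z (h1 z (Metric.ball_subset_closedBall hz.1))).differentiableAt), zero_add]
  have hWi' : ∀ c ∈ Wi, (∮ z in C(c, δ), F z) =
      2 * Real.pi * Complex.I * ∑ w ∈ S, (if w ∈ Metric.ball c δ then a w else 0) := by
    intro c hc
    refine hsmall c (fun z hz => ⟨hmr₀.trans (hWi c hc z hz).1, (hWi c hc z hz).2.1⟩) ?_
    intro z hz hzS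
    have hzb := hWi c hc z (Metric.sphere_subset_closedBall hz)
    rcases ((hS z).1 hzS).1 with hzP | hzQ
    · obtain ⟨c', hc', hzc'⟩ := hP z hzP hzb.1.le
      have hne : c ≠ c' := by
        rintro rfl
        exact (Metric.mem_ball.1 hzc').ne (Metric.mem_sphere.1 hz)
      exact (hWid c hc c' hc' hne).le_bot ⟨Metric.sphere_subset_closedBall hz,
        Metric.ball_subset_closedBall hzc'⟩
    · exact hzb.2.2 hzQ
  have hWo' : ∀ c ∈ Wo, (∮ z in C(c, δ), F z) =
      2 * Real.pi * Complex.I * ∑ w ∈ S, (if w ∈ Metric.ball c δ then a w else 0) := by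
    intro c hc
    refine hsmall c (fun z hz => ⟨(hWo c hc z hz).1, (hWo c hc z hz).2.1.trans hrM₀⟩) ?_
    intro z hz hzS
    have hzb := hWo c hc z (Metric.sphere_subset_closedBall hz)
    rcases ((hS z).1 hzS).1 with hzP | hzQ
    · exact hzb.2.2 hzP
    · obtain ⟨c', hc', hzc'⟩ := hQ z hzQ hzb.2.1.le
      have hne : c ≠ c' := by
        rintro rfl
        exact (Metric.mem_ball.1 hzc').ne (Metric.mem_sphere.1 hz)
      exact (hWod c hc c' hc' hne).le_bot ⟨Metric.sphere_subset_closedBall hz,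
        Metric.ball_subset_closedBall hzc'⟩
  have hres : ∀ w ∈ S, residue F w = a w := fun w hw =>
    residue_of_principalParts hU hSU hH hR (fun z hz hzS => hdec z hz hzS) hw
  -- both sides count each point of `S` once if it belongs to `P`, and not at all otherwise
  have hfP : (∑ᶠ w ∈ {w | w ∈ P ∧ r < ‖w‖}, residue F w) =
      ∑ w ∈ S, if w ∈ P ∧ r < ‖w‖ then a w else 0 := by
    have hset : {w | w ∈ P ∧ r < ‖w‖} = ((S.filter fun w => w ∈ P ∧ r < ‖w‖ : Finset ℂ) : Set ℂ) := by
      ext w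
      simp only [Set.mem_ofPred_eq, Finset.coe_filter, hS]
      exact ⟨fun h => ⟨⟨Or.inl h.1, hmr.trans h.2, hPM w h.1⟩, h⟩, fun h => h.2⟩
    rw [hset, finsum_mem_coe_finset, ← Finset.sum_filter]
    exact Finset.sum_congr rfl fun w hw => hres w (Finset.mem_of_mem_filter w hw)
  have hfQ : (∑ᶠ w ∈ {w | w ∈ Q ∧ ‖w‖ < r}, residue F w) =
      ∑ w ∈ S, if w ∈ Q ∧ ‖w‖ < r then a w else 0 := by
    have hset : {w | w ∈ Q ∧ ‖w‖ < r} = ((S.filter fun w => w ∈ Q ∧ ‖w‖ < r : Finset ℂ) : Set ℂ) := by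
      ext w
      simp only [Set.mem_ofPred_eq, Finset.coe_filter, hS]
      exact ⟨fun h => ⟨⟨Or.inr h.1, hQm w h.1, h.2.trans hrM⟩, h⟩, fun h => h.2⟩
    rw [hset, finsum_mem_coe_finset, ← Finset.sum_filter]
    exact Finset.sum_congr rfl fun w hw => hres w (Finset.mem_of_mem_filter w hw)
  have hi : ∀ w ∈ S, (∑ c ∈ Wi, if w ∈ Metric.ball c δ then a w else 0) =
      if w ∈ P ∧ r₀ < ‖w‖ then a w else 0 := by
    intro w hw
    split_ifs with h
    · obtain ⟨c, hc, hwc⟩ := hP w h.1 h.2.le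
      rw [Finset.sum_eq_single c, if_pos hwc]
      · intro c' hc' hne
        rw [if_neg]
        exact fun hwc' => (hWid c' hc' c hc hne).le_bot ⟨Metric.ball_subset_closedBall hwc',
          Metric.ball_subset_closedBall hwc⟩
      · exact fun h => (h hc).elim
    · refine Finset.sum_eq_zero fun c hc => if_neg fun hwc => h ?_
      have hb := hWi c hc w (Metric.ball_subset_closedBall hwc)
      exact ⟨((hS w).1 hw).1.resolve_right hb.2.2, hb.1⟩
  have ho : ∀ w ∈ S, (∑ c ∈ Wo, if w ∈ Metric.ball c δ then a w else 0) =
      if w ∈ Q ∧ ‖w‖ < r₀ then a w else 0 := by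
    intro w hw
    split_ifs with h
    · obtain ⟨c, hc, hwc⟩ := hQ w h.1 h.2.le
      rw [Finset.sum_eq_single c, if_pos hwc]
      · intro c' hc' hne
        rw [if_neg]
        exact fun hwc' => (hWod c' hc' c hc hne).le_bot ⟨Metric.ball_subset_closedBall hwc',
          Metric.ball_subset_closedBall hwc⟩
      · exact fun h => (h hc).elim
    · refine Finset.sum_eq_zero fun c hc => if_neg fun hwc => h ?_
      have hb := hWo c hc w (Metric.ball_subset_closedBall hwc)
      exact ⟨((hS w).1 hw).1.resolve_left hb.2.2, hb.2.1⟩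
  have hcount : ∀ s : ℝ, (∀ z ∈ P ∪ Q, ‖z‖ ≠ s) →
      (∑ w ∈ S, if w ∈ Metric.ball (0 : ℂ) s then a w else 0) +
        ((∑ w ∈ S, if w ∈ P ∧ s < ‖w‖ then a w else 0) -
          ∑ w ∈ S, if w ∈ Q ∧ ‖w‖ < s then a w else 0) = ∑ w ∈ S, if w ∈ P then a w else 0 := by
    intro s hs
    rw [← Finset.sum_sub_distrib, ← Finset.sum_add_distrib]
    refine Finset.sum_congr rfl fun w hw => ?_
    have hne := hs w ((hS w).1 hw).1
    rw [mem_ball_zero_iff]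
    rcases ((hS w).1 hw).1 with h | h
    · have hQ' : w ∉ Q := fun h' => hQP w h' h
      rcases hne.lt_or_gt with h1 | h1 <;> simp [h, hQ', h1, h1.not_gt]
    · have hP' := hQP w h
      rcases hne.lt_or_gt with h1 | h1 <;> simp [h, hP', h1, h1.not_gt]
  rw [Finset.sum_congr rfl hWi', Finset.sum_congr rfl hWo', ← Finset.mul_sum, ← Finset.mul_sum,
    Finset.sum_comm, Finset.sum_congr rfl hi, Finset.sum_comm (s := Wo), Finset.sum_congr rfl ho,
    hcirc r hmr hrM hr, hcirc r₀ hmr₀ hrM₀ hr₀, hfP, hfQ, hHr]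
  linear_combination 2 * Real.pi * Complex.I * (hcount r hr - hcount r₀ hr₀)

/-! ### Analytic dependence of `V` on the parameters -/

/-- A circle integral of a jointly analytic function depends analytically on the parameter. -/
theorem analyticAt_circleIntegral {f : ℂ → ℂ → ℂ} {s₀ c : ℂ} {ρ : ℝ} (hρ : 0 ≤ ρ)
    (hf : ∀ z ∈ Metric.sphere c ρ, AnalyticAt ℂ (fun x : ℂ × ℂ => f x.1 x.2) (s₀, z)) :
    AnalyticAt ℂ (fun s => ∮ z in C(c, ρ), f s z) s₀ := by
  have hev : ∀ᶠ s in 𝓝 s₀, ∀ z ∈ Metric.sphere c ρ,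
      AnalyticAt ℂ (fun x : ℂ × ℂ => f x.1 x.2) (s, z) :=
    (isCompact_sphere c ρ).eventually_forall_of_forall_eventually fun z hz =>
      (hf z hz).eventually_analyticAt
  obtain ⟨ε, hε, hball⟩ := Metric.eventually_nhds_iff_ball.1 hev
  refine DifferentiableOn.analyticAt (s := Metric.ball s₀ ε) (fun s₁ hs₁ => ?_)
    (Metric.ball_mem_nhds s₀ hε)
  refine DifferentiableAt.differentiableWithinAt ?_
  obtain ⟨η, hη, hsub⟩ := Metric.nhds_basis_closedBall.mem_iff.1 (Metric.isOpen_ball.mem_nhds hs₁)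
  set D : ℂ × ℂ → ℂ := fun x => fderiv ℂ (fun x : ℂ × ℂ => f x.1 x.2) x (1, 0) with hD
  have hDc : ContinuousOn D (Metric.closedBall s₁ η ×ˢ Metric.sphere c ρ) := by
    rintro ⟨s, z⟩ ⟨hs, hz⟩
    exact ((hball s (hsub hs) z hz).fderiv.continuousAt.clm_apply
      continuousAt_const).continuousWithinAt
  obtain ⟨C, hC⟩ := ((isCompact_closedBall s₁ η).prod (isCompact_sphere c ρ)).exists_bound_of_continuousOn hDc
  have hfd : ∀ s ∈ Metric.ball s₀ ε, ∀ z ∈ Metric.sphere c ρ,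
      HasDerivAt (fun s => f s z) (D (s, z)) s := by
    intro s hs z hz
    have h1 := (hball s hs z hz).differentiableAt.hasFDerivAt
    have h2 : HasDerivAt (fun s : ℂ => (s, z)) ((1 : ℂ), (0 : ℂ)) s :=
      (hasDerivAt_id s).prodMk (hasDerivAt_const s z)
    exact h1.comp_hasDerivAt s h2
  have hmem : ∀ θ : ℝ, circleMap c ρ θ ∈ Metric.sphere c ρ := fun θ => circleMap_mem_sphere c hρ θ
  have hcont : ∀ s ∈ Metric.ball s₀ ε, Continuous fun θ => f s (circleMap c ρ θ) := by
    intro s hs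
    refine continuous_iff_continuousAt.2 fun θ => ?_
    have h1 := (hball s hs _ (hmem θ)).continuousAt
    exact ContinuousAt.comp (g := fun x : ℂ × ℂ => f x.1 x.2)
      (f := fun θ => (s, circleMap c ρ θ)) h1 (by fun_prop)
  have hDcont : Continuous fun θ => D (s₁, circleMap c ρ θ) := by
    refine continuous_iff_continuousAt.2 fun θ => ?_
    have h1 : ContinuousAt D (s₁, circleMap c ρ θ) :=
      (hball s₁ hs₁ _ (hmem θ)).fderiv.continuousAt.clm_apply continuousAt_const
    exact ContinuousAt.comp (g := D) (f := fun θ => (s₁, circleMap c ρ θ)) h1 (by fun_prop)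
  have key := intervalIntegral.hasDerivAt_integral_of_dominated_loc_of_deriv_le
    (μ := MeasureTheory.volume) (a := 0) (b := 2 * Real.pi)
    (F := fun s θ => deriv (circleMap c ρ) θ • f s (circleMap c ρ θ))
    (F' := fun s θ => deriv (circleMap c ρ) θ • D (s, circleMap c ρ θ))
    (x₀ := s₁) (s := Metric.closedBall s₁ η) (bound := fun _ => |ρ| * C)
    (Metric.closedBall_mem_nhds s₁ hη) ?_ ?_ ?_ ?_ ?_ ?_
  · exact key.2.differentiableAt
  · filter_upwards [Metric.closedBall_mem_nhds s₁ hη] with s hs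
    simp only [deriv_circleMap]
    exact Continuous.aestronglyMeasurable 
      (((continuous_circleMap 0 ρ).mul continuous_const).smul (hcont s (hsub hs)))
  · simp only [deriv_circleMap]
    exact Continuous.intervalIntegrable 
      (((continuous_circleMap 0 ρ).mul continuous_const).smul (hcont s₁ hs₁)) _ _
  · simp only [deriv_circleMap]
    exact Continuous.aestronglyMeasurable
      (((continuous_circleMap 0 ρ).mul continuous_const).smul hDcont)
  · refine Eventually.of_forall fun θ _ s hs => ?_
    rw [norm_smul]
    gcongr
    · simp
    · exact hC _ ⟨hs, hmem θ⟩
  · exact intervalIntegrable_const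
  · refine Eventually.of_forall fun θ _ s hs => ?_
    exact (hfd s (hsub hs) _ (hmem θ)).const_mul _

/-- The kernel with `1 / Γ(z^{±2}; p, q)` written as `θ(z²; p) θ(z⁻²; q)`. It agrees with `kernel`
except where a quotient in `kernel` has a vanishing denominator at a removable singularity. -/
def regKernel (p q : ℂ) (t : Fin 8 → ℂ) (z : ℂ) : ℂ :=
  (∏ j, ellGamma p q (t j * z) * ellGamma p q (t j * z⁻¹)) *
    (theta p (z ^ 2) * theta q (z ^ 2)⁻¹)

theorem kernel_eq_regKernel {p q : ℂ} (hp : ‖p‖ < 1) (hq : ‖q‖ < 1) (t : Fin 8 → ℂ) {z : ℂ}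
    (h1 : pqPoch p q (p * q * z ^ 2) ≠ 0) (h2 : pqPoch p q (p * q / z ^ 2) ≠ 0) :
    kernel p q t z = regKernel p q t z := by
  rw [kernel, regKernel, inv_pow, ← inv_ellGamma_mul_ellGamma_inv hp hq h1 h2, div_eq_mul_inv]

theorem circleIntegral_kernel {p q : ℂ} (hp : ‖p‖ < 1) (hq : ‖q‖ < 1) (t : Fin 8 → ℂ) {c : ℂ}
    {ρ : ℝ} (hρ : ρ ≠ 0) (h0 : (0 : ℂ) ∉ Metric.sphere c |ρ|) :
    (∮ z in C(c, ρ), kernel p q t z / z) = ∮ z in C(c, ρ), regKernel p q t z / z := by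
  refine circleIntegral.circleIntegral_congr_codiscreteWithin ?_ hρ
  have hE := differentiable_pqPoch hp hq
  set f : ℂ → ℂ := fun z => pqPoch p q (p * q * z ^ 2) * pqPoch p q (p * q / z ^ 2) with hf
  have hpq : ‖p * q‖ < 1 := by
    rw [norm_mul]; exact mul_lt_one_of_nonneg_of_lt_one_left (norm_nonneg _) hp hq.le
  have han : AnalyticOnNhd ℂ f {0}ᶜ := by
    refine DifferentiableOn.analyticOnNhd (fun z hz => ?_) isOpen_compl_singleton
    have hz' : z ≠ 0 := hz
    refine DifferentiableAt.differentiableWithinAt (DifferentiableAt.mul ?_ ?_)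
    · exact (hE _).comp z (by fun_prop)
    · exact (hE _).comp z (by fun_prop (disch := exact pow_ne_zero 2 hz'))
  have hcod := han.preimage_zero_mem_codiscreteWithin (x := 1)
    (by simpa [hf] using pqPoch_ne_zero_of_norm_lt hp hq hpq) (by simp)
    (isConnected_compl_singleton_of_one_lt_rank (by simp) 0)
  have hmono := codiscreteWithin_mono (X := ℂ) (U₁ := Metric.sphere c |ρ|) (U := {0}ᶜ)
    (fun z hz h => h0 (by rwa [Set.mem_singleton_iff.1 h] at hz))
  filter_upwards [hmono hcod] with z hz
  have hz' : f z ≠ 0 := hz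
  rw [kernel_eq_regKernel hp hq t (left_ne_zero_of_mul hz') (right_ne_zero_of_mul hz')]

theorem residue_kernel {p q : ℂ} (hp : ‖p‖ < 1) (hq : ‖q‖ < 1) (t : Fin 8 → ℂ) {w : ℂ}
    (hw : w ≠ 0) : residue (fun z => kernel p q t z / z) w =
      residue (fun z => regKernel p q t z / z) w := by
  unfold residue limUnder
  congr 1
  refine Filter.map_congr ?_
  filter_upwards [Ioo_mem_nhdsGT (norm_pos_iff.2 hw)] with δ hδ
  rw [circleIntegral_kernel hp hq t hδ.1.ne']
  rw [mem_sphere_iff_norm, zero_sub, norm_neg, abs_of_pos hδ.1]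
  exact hδ.2.ne'

/-! ### The poles of the kernel -/

/-- The function whose zeros are the inner poles. -/
def innerDen (p q : ℂ) (t : Fin 8 → ℂ) (z : ℂ) : ℂ := ∏ j, pqPoch p q (t j * z⁻¹)

/-- The function whose zeros are the outer poles. -/
def outerDen (p q : ℂ) (t : Fin 8 → ℂ) (z : ℂ) : ℂ := ∏ j, pqPoch p q (t j * z)

theorem innerDen_eq_zero_iff {p q : ℂ} (hp : ‖p‖ < 1) (hq : ‖q‖ < 1) {t : Fin 8 → ℂ} {z : ℂ}
    (hz : z ≠ 0) : innerDen p q t z = 0 ↔ z ∈ innerPoles p q t := by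
  simp only [innerDen, Finset.prod_eq_zero_iff, Finset.mem_univ, true_and,
    pqPoch_eq_zero_iff hp hq, innerPoles, Set.mem_ofPred_eq]
  refine exists_congr fun j => exists_congr fun a => exists_congr fun b => ?_
  field_simp
  exact eq_comm

theorem outerDen_eq_zero_iff {p q : ℂ} (hp : ‖p‖ < 1) (hq : ‖q‖ < 1) {t : Fin 8 → ℂ} {z : ℂ}
    (hz : z ≠ 0) : outerDen p q t z = 0 ↔ z ∈ outerPoles p q t := by
  simp only [outerDen, Finset.prod_eq_zero_iff, Finset.mem_univ, true_and,
    pqPoch_eq_zero_iff hp hq, outerPoles, Set.mem_ofPred_eq]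
  refine exists_congr fun j => exists_congr fun a => exists_congr fun b => ?_
  constructor
  · intro h
    exact eq_inv_of_mul_eq_one_left (by rw [← h]; ring)
  · rintro rfl
    rw [mul_right_comm (t j), mul_right_comm (t j * p ^ a)]
    exact mul_inv_cancel₀ (fun h => hz (by rw [h, inv_zero]))

theorem inv_mem_outerPoles_iff {p q : ℂ} {t : Fin 8 → ℂ} {z : ℂ} :
    z⁻¹ ∈ outerPoles p q t ↔ z ∈ innerPoles p q t := by
  simp only [outerPoles, innerPoles, Set.mem_ofPred_eq, inv_inj]

theorem ne_zero_of_mem_innerPoles {p q : ℂ} (hp0 : p ≠ 0) (hq0 : q ≠ 0) {t : Fin 8 → ℂ}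
    (ht : ∀ j, t j ≠ 0) {z : ℂ} (hz : z ∈ innerPoles p q t) : z ≠ 0 := by
  obtain ⟨j, a, b, rfl⟩ := hz
  exact mul_ne_zero (mul_ne_zero (ht j) (pow_ne_zero _ hp0)) (pow_ne_zero _ hq0)

theorem ne_zero_of_mem_outerPoles {p q : ℂ} (hp0 : p ≠ 0) (hq0 : q ≠ 0) {t : Fin 8 → ℂ}
    (ht : ∀ j, t j ≠ 0) {z : ℂ} (hz : z ∈ outerPoles p q t) : z ≠ 0 := by
  rw [← inv_inv z, inv_mem_outerPoles_iff] at hz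
  exact fun h => ne_zero_of_mem_innerPoles hp0 hq0 ht hz (by rw [h, inv_zero])

theorem finite_innerPoles {p q : ℂ} (hp : ‖p‖ < 1) (hq : ‖q‖ < 1) (t : Fin 8 → ℂ) {c : ℝ}
    (hc : 0 < c) : {z | z ∈ innerPoles p q t ∧ c ≤ ‖z‖}.Finite := by
  have hs : ∀ j, {jk : ℕ × ℕ | c ≤ ‖t j * (p ^ jk.1 * q ^ jk.2)‖}.Finite := by
    intro j
    have h1 : Summable fun jk : ℕ × ℕ => ‖t j * (p ^ jk.1 * q ^ jk.2)‖ := by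
      simpa only [norm_mul (t j)] using (summable_norm_pow_mul_pow hp hq).mul_left ‖t j‖
    have h2 := h1.tendsto_cofinite_zero.eventually (gt_mem_nhds hc)
    rw [eventually_cofinite] at h2
    simpa only [not_lt] using h2
  refine (Set.finite_iUnion fun j => (hs j).image fun jk => t j * (p ^ jk.1 * q ^ jk.2)).subset ?_
  rintro z ⟨⟨j, a, b, rfl⟩, hz⟩
  refine Set.mem_iUnion.2 ⟨j, (a, b), ?_, by simp only; ring⟩
  rw [Set.mem_ofPred_eq, ← mul_assoc]
  exact hz

theorem finite_outerPoles {p q : ℂ} (hp : ‖p‖ < 1) (hq : ‖q‖ < 1) (t : Fin 8 → ℂ) {c : ℝ}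
    (hc : 0 < c) : {z | z ∈ outerPoles p q t ∧ z ≠ 0 ∧ ‖z‖ ≤ c}.Finite := by
  refine ((finite_innerPoles hp hq t (inv_pos.2 hc)).image (·⁻¹)).subset ?_
  rintro z ⟨hz, hz0, hzc⟩
  refine ⟨z⁻¹, ⟨by rw [← inv_mem_outerPoles_iff, inv_inv]; exact hz, ?_⟩, inv_inv z⟩
  rw [norm_inv]
  exact inv_anti₀ (norm_pos_iff.2 hz0) hzc

theorem norm_le_of_mem_innerPoles {p q : ℂ} (hp : ‖p‖ < 1) (hq : ‖q‖ < 1) {t : Fin 8 → ℂ} {z : ℂ}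
    (hz : z ∈ innerPoles p q t) : ∃ j, ‖z‖ ≤ ‖t j‖ := by
  obtain ⟨j, a, b, rfl⟩ := hz
  refine ⟨j, ?_⟩
  rw [norm_mul, norm_mul, norm_pow, norm_pow]
  have h1 : ‖p‖ ^ a ≤ 1 := pow_le_one₀ (norm_nonneg _) hp.le
  have h2 : ‖q‖ ^ b ≤ 1 := pow_le_one₀ (norm_nonneg _) hq.le
  calc ‖t j‖ * ‖p‖ ^ a * ‖q‖ ^ b ≤ ‖t j‖ * 1 * 1 := by gcongr
    _ = ‖t j‖ := by ring

theorem Unpinched.disjoint {p q : ℂ} (hp0 : p ≠ 0) (hq0 : q ≠ 0) {t : Fin 8 → ℂ}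
    (ht : ∀ j, t j ≠ 0) (h : Unpinched p q t) : Disjoint (innerPoles p q t) (outerPoles p q t) := by
  rw [Set.disjoint_left]
  rintro z hz ⟨k, a', b', rfl⟩
  have h0 : t k * p ^ a' * q ^ b' ≠ 0 :=
    mul_ne_zero (mul_ne_zero (ht k) (pow_ne_zero _ hp0)) (pow_ne_zero _ hq0)
  obtain ⟨j, a, b, hz⟩ := hz
  apply h j k (a + a') (b + b')
  have h1 : t j * p ^ a * q ^ b * (t k * p ^ a' * q ^ b') = 1 := by rw [← hz, inv_mul_cancel₀ h0]
  rw [← h1, pow_add, pow_add]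
  ring

theorem unpinched_iff {p q : ℂ} (hp : ‖p‖ < 1) (hq : ‖q‖ < 1) {t : Fin 8 → ℂ} :
    Unpinched p q t ↔ ∏ j, ∏ k, pqPoch p q (t j * t k) ≠ 0 := by
  simp only [Finset.prod_ne_zero_iff, Finset.mem_univ, true_imp_iff, Ne, pqPoch_eq_zero_iff hp hq,
    not_exists, Unpinched]

theorem analyticAt_ellGamma {p q u : ℂ} (hp : ‖p‖ < 1) (hq : ‖q‖ < 1) (hu : u ≠ 0)
    (h : pqPoch p q u ≠ 0) : AnalyticAt ℂ (ellGamma p q) u := by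
  have hE := differentiable_pqPoch hp hq
  refine AnalyticAt.div ?_ (hE.analyticAt u) h
  exact (hE.analyticAt _).fun_comp (analyticAt_const.div analyticAt_id hu)

theorem meromorphicAt_ellGamma_comp {p q : ℂ} (hp : ‖p‖ < 1) (hq : ‖q‖ < 1) {g : ℂ → ℂ} {z : ℂ}
    (hg : AnalyticAt ℂ g z) (h0 : g z ≠ 0) : MeromorphicAt (fun z => ellGamma p q (g z)) z := by
  have hE := differentiable_pqPoch hp hq
  refine MeromorphicAt.div (AnalyticAt.meromorphicAt ?_) (AnalyticAt.meromorphicAt ?_)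
  · exact (hE.analyticAt _).fun_comp (analyticAt_const.div hg h0)
  · exact (hE.analyticAt _).fun_comp hg

theorem analyticAt_theta {p z : ℂ} (hp : ‖p‖ < 1) (hz : z ≠ 0) : AnalyticAt ℂ (theta p) z := by
  have hE := differentiable_qPoch hp
  exact (hE.analyticAt z).mul ((hE.analyticAt _).fun_comp (analyticAt_const.div analyticAt_id hz))

theorem analyticAt_regKernel {p q : ℂ} (hp : ‖p‖ < 1) (hq : ‖q‖ < 1) {τ : ℂ → Fin 8 → ℂ} {s z : ℂ}
    (hτ : ∀ j, AnalyticAt ℂ (fun s => τ s j) s) (h0 : ∀ j, τ s j ≠ 0) (hz : z ≠ 0)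
    (hi : innerDen p q (τ s) z ≠ 0) (ho : outerDen p q (τ s) z ≠ 0) :
    AnalyticAt ℂ (fun x : ℂ × ℂ => regKernel p q (τ x.1) x.2 / x.2) (s, z) := by
  have hsnd : AnalyticAt ℂ (fun x : ℂ × ℂ => x.2) (s, z) := analyticAt_snd
  have hinv : AnalyticAt ℂ (fun x : ℂ × ℂ => x.2⁻¹) (s, z) := hsnd.inv hz
  have hτ' : ∀ j, AnalyticAt ℂ (fun x : ℂ × ℂ => τ x.1 j) (s, z) := fun j =>
    AnalyticAt.fun_comp (g := fun s => τ s j) (f := fun x : ℂ × ℂ => x.1) (hτ j) analyticAt_fst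
  rw [innerDen, Finset.prod_ne_zero_iff] at hi
  rw [outerDen, Finset.prod_ne_zero_iff] at ho
  refine AnalyticAt.div (AnalyticAt.mul ?_ (AnalyticAt.mul ?_ ?_)) hsnd hz
  · refine Finset.analyticAt_fun_prod _ fun j hj => AnalyticAt.mul ?_ ?_
    · exact AnalyticAt.fun_comp (g := ellGamma p q) (f := fun x : ℂ × ℂ => τ x.1 j * x.2)
        (analyticAt_ellGamma hp hq (mul_ne_zero (h0 j) hz) (ho j hj)) ((hτ' j).mul hsnd)
    · exact AnalyticAt.fun_comp (g := ellGamma p q) (f := fun x : ℂ × ℂ => τ x.1 j * x.2⁻¹)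
        (analyticAt_ellGamma hp hq (mul_ne_zero (h0 j) (inv_ne_zero hz)) (hi j hj))
        ((hτ' j).mul hinv)
  · exact AnalyticAt.fun_comp (g := theta p) (f := fun x : ℂ × ℂ => x.2 ^ 2)
      (analyticAt_theta hp (pow_ne_zero 2 hz)) (hsnd.pow 2)
  · exact AnalyticAt.fun_comp (g := theta q) (f := fun x : ℂ × ℂ => (x.2 ^ 2)⁻¹)
      (analyticAt_theta hq (inv_ne_zero (pow_ne_zero 2 hz))) ((hsnd.pow 2).inv (pow_ne_zero 2 hz))

theorem meromorphicAt_regKernel {p q : ℂ} (hp : ‖p‖ < 1) (hq : ‖q‖ < 1) {t : Fin 8 → ℂ} {z : ℂ}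
    (h0 : ∀ j, t j ≠ 0) (hz : z ≠ 0) : MeromorphicAt (fun z => regKernel p q t z / z) z := by
  have hid : AnalyticAt ℂ (fun z : ℂ => z) z := analyticAt_id
  refine MeromorphicAt.div (MeromorphicAt.mul ?_ (AnalyticAt.meromorphicAt (AnalyticAt.mul ?_ ?_)))
    hid.meromorphicAt
  · refine MeromorphicAt.fun_prod fun j _ => MeromorphicAt.mul ?_ ?_
    · exact meromorphicAt_ellGamma_comp hp hq (analyticAt_const.mul hid) (mul_ne_zero (h0 j) hz)
    · exact meromorphicAt_ellGamma_comp hp hq (analyticAt_const.mul (hid.inv hz))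
        (mul_ne_zero (h0 j) (inv_ne_zero hz))
  · exact AnalyticAt.fun_comp (g := theta p) (f := fun z : ℂ => z ^ 2)
      (analyticAt_theta hp (pow_ne_zero 2 hz)) (hid.fun_pow 2)
  · exact AnalyticAt.fun_comp (g := theta q) (f := fun z : ℂ => (z ^ 2)⁻¹)
      (analyticAt_theta hq (inv_ne_zero (pow_ne_zero 2 hz)))
      ((hid.fun_pow 2).fun_inv (pow_ne_zero 2 hz))

theorem admissibleRadius_contourRadius (p q : ℂ) (t : Fin 8 → ℂ) :
    AdmissibleRadius p q t (contourRadius p q t) := by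
  unfold contourRadius
  split_ifs with h
  · exact h
  · exact (exists_admissibleRadius p q t).choose_spec

/-- `V` in terms of the regularized kernel. -/
theorem V_eq_regKernel {p q : ℂ} (hp0 : p ≠ 0) (hq0 : q ≠ 0) (hp : ‖p‖ < 1) (hq : ‖q‖ < 1)
    {t : Fin 8 → ℂ} (ht : ∀ j, t j ≠ 0) : V p q t = kappa p q *
    ((∮ z in C(0, contourRadius p q t), regKernel p q t z / z) +
      2 * Real.pi * Complex.I *
        ((∑ᶠ w ∈ {w | w ∈ innerPoles p q t ∧ contourRadius p q t < ‖w‖},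
            residue (fun z => regKernel p q t z / z) w) -
          ∑ᶠ w ∈ {w | w ∈ outerPoles p q t ∧ ‖w‖ < contourRadius p q t},
            residue (fun z => regKernel p q t z / z) w)) := by
  have hr := (admissibleRadius_contourRadius p q t).1
  rw [V, circleIntegral_kernel hp hq t hr.ne' (by simpa [abs_of_pos hr] using hr.ne),
    finsum_mem_congr rfl fun w hw =>
      residue_kernel hp hq t (ne_zero_of_mem_innerPoles hp0 hq0 ht hw.1),
    finsum_mem_congr rfl fun w hw =>
      residue_kernel hp hq t (ne_zero_of_mem_outerPoles hp0 hq0 ht hw.1)]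

theorem eventually_closedBall_subset {c : ℂ} {O : Set ℂ} (hO : O ∈ 𝓝 c) :
    ∀ᶠ δ in 𝓝[>] (0 : ℝ), Metric.closedBall c δ ⊆ O := by
  obtain ⟨ε, hε, hsub⟩ := Metric.nhds_basis_closedBall.mem_iff.1 hO
  filter_upwards [Ioo_mem_nhdsGT hε] with δ hδ
  exact (Metric.closedBall_subset_closedBall hδ.2.le).trans hsub

theorem eventually_disjoint_closedBall {c c' : ℂ} (h : c ≠ c') :
    ∀ᶠ δ in 𝓝[>] (0 : ℝ), Disjoint (Metric.closedBall c δ) (Metric.closedBall c' δ) := by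
  filter_upwards [Ioo_mem_nhdsGT (half_pos (dist_pos.2 h))] with δ hδ
  exact Metric.closedBall_disjoint_closedBall (by linarith [hδ.2])

/-- Small closed discs about a finite set of points, disjoint and inside a given neighbourhood. -/
theorem eventually_discs {O : Set ℂ} (hO : IsOpen O) (W : Finset ℂ) (hW : ∀ c ∈ W, c ∈ O) :
    ∀ᶠ δ in 𝓝[>] (0 : ℝ), (∀ c ∈ W, Metric.closedBall c δ ⊆ O) ∧
      ∀ c ∈ W, ∀ c' ∈ W, c ≠ c' → Disjoint (Metric.closedBall c δ) (Metric.closedBall c' δ) := by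
  refine Filter.Eventually.and ?_ ?_
  · rw [Filter.eventually_all_finset]
    exact fun c hc => eventually_closedBall_subset (hO.mem_nhds (hW c hc))
  · rw [Filter.eventually_all_finset]
    intro c hc
    rw [Filter.eventually_all_finset]
    intro c' hc'
    rcases eq_or_ne c c' with rfl | h
    · exact Eventually.of_forall fun _ h => (h rfl).elim
    · filter_upwards [eventually_disjoint_closedBall h] with δ hδ using fun _ => hδ

/-- Nonvanishing on a compact set is stable under small changes of the parameter. -/
theorem eventually_forall_ne_zero {G : ℂ → ℂ → ℂ} {s₀ : ℂ} {K : Set ℂ} (hK : IsCompact K)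
    (hG : ∀ z ∈ K, ContinuousAt (fun x : ℂ × ℂ => G x.1 x.2) (s₀, z)) (h0 : ∀ z ∈ K, G s₀ z ≠ 0) :
    ∀ᶠ s in 𝓝 s₀, ∀ z ∈ K, G s z ≠ 0 :=
  hK.eventually_forall_of_forall_eventually fun z hz => (hG z hz).eventually_ne (h0 z hz)

theorem continuousAt_innerDen {p q : ℂ} (hp : ‖p‖ < 1) (hq : ‖q‖ < 1) {τ : ℂ → Fin 8 → ℂ} {s z : ℂ}
    (hτ : ∀ j, ContinuousAt (fun s => τ s j) s) (hz : z ≠ 0) :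
    ContinuousAt (fun x : ℂ × ℂ => innerDen p q (τ x.1) x.2) (s, z) := by
  have hE := (differentiable_pqPoch hp hq).continuous
  have hτ' : ∀ j, ContinuousAt (fun x : ℂ × ℂ => τ x.1 j) (s, z) := fun j =>
    ContinuousAt.comp (g := fun s => τ s j) (f := fun x : ℂ × ℂ => x.1) (hτ j) continuousAt_fst
  unfold innerDen
  refine tendsto_finsetProd _ fun j _ => ?_
  exact hE.continuousAt.comp ((hτ' j).mul (continuousAt_snd.inv₀ hz))

theorem continuousAt_outerDen {p q : ℂ} (hp : ‖p‖ < 1) (hq : ‖q‖ < 1) {τ : ℂ → Fin 8 → ℂ} {s z : ℂ}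
    (hτ : ∀ j, ContinuousAt (fun s => τ s j) s) :
    ContinuousAt (fun x : ℂ × ℂ => outerDen p q (τ x.1) x.2) (s, z) := by
  have hE := (differentiable_pqPoch hp hq).continuous
  have hτ' : ∀ j, ContinuousAt (fun x : ℂ × ℂ => τ x.1 j) (s, z) := fun j =>
    ContinuousAt.comp (g := fun s => τ s j) (f := fun x : ℂ × ℂ => x.1) (hτ j) continuousAt_fst
  unfold outerDen
  refine tendsto_finsetProd _ fun j _ => ?_
  exact hE.continuousAt.comp ((hτ' j).mul continuousAt_snd)

/-- `V` is analytic along every analytic family of parameters, at unpinched parameters. -/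
theorem analyticAt_V {p q : ℂ} (hp0 : p ≠ 0) (hq0 : q ≠ 0) (hp : ‖p‖ < 1) (hq : ‖q‖ < 1)
    {τ : ℂ → Fin 8 → ℂ} {s₀ : ℂ} (hτ : ∀ j, AnalyticAt ℂ (fun s => τ s j) s₀)
    (h0 : ∀ j, τ s₀ j ≠ 0) (hU : Unpinched p q (τ s₀)) :
    AnalyticAt ℂ (fun s => V p q (τ s)) s₀ := by
  classical
  set t := τ s₀ with ht
  have hτc : ∀ j, ContinuousAt (fun s => τ s j) s₀ := fun j => (hτ j).continuousAt
  obtain ⟨r₀, hr₀, hr₀P⟩ := exists_admissibleRadius p q t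
  have hdisj := hU.disjoint hp0 hq0 h0
  -- all `t_j` have modulus less than `M₀`, and `r₀` lies between `M₀⁻¹` and `M₀`
  set M₀ : ℝ := 1 + r₀ + r₀⁻¹ + ∑ j, ‖t j‖ with hM₀
  have hsum0 : 0 ≤ ∑ j, ‖t j‖ := Finset.sum_nonneg fun j _ => norm_nonneg _
  have hr₀' : 0 < r₀⁻¹ := inv_pos.2 hr₀
  have hM₀pos : 0 < M₀ := by linarith
  have hrM₀ : r₀ < M₀ := by linarith
  have hmr₀ : M₀⁻¹ < r₀ := inv_lt_of_inv_lt₀ hr₀ (by linarith)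
  have htM₀ : ∀ j, ‖t j‖ < M₀ := fun j => by
    have := Finset.single_le_sum (f := fun j => ‖t j‖) (fun j _ => norm_nonneg _) (Finset.mem_univ j)
    linarith
  have hm₀pos : 0 < M₀⁻¹ := inv_pos.2 hM₀pos
  have hPM : ∀ t' : Fin 8 → ℂ, (∀ j, ‖t' j‖ < M₀) → ∀ z ∈ innerPoles p q t', ‖z‖ < M₀ := by
    intro t' ht' z hz
    obtain ⟨j, hj⟩ := norm_le_of_mem_innerPoles hp hq hz
    exact hj.trans_lt (ht' j)
  have hQm : ∀ t' : Fin 8 → ℂ, (∀ j, t' j ≠ 0) → (∀ j, ‖t' j‖ < M₀) →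
      ∀ z ∈ outerPoles p q t', M₀⁻¹ < ‖z‖ := by
    intro t' h0' ht' z hz
    have hz0 := ne_zero_of_mem_outerPoles hp0 hq0 h0' hz
    rw [← inv_inv z, inv_mem_outerPoles_iff] at hz
    have := hPM t' ht' _ hz
    rw [norm_inv] at this
    exact inv_lt_of_inv_lt₀ (norm_pos_iff.2 hz0) this
  have hne : ∀ {z : ℂ} {c : ℝ}, 0 < c → c ≤ ‖z‖ → z ≠ 0 := fun hc h =>
    norm_pos_iff.1 (hc.trans_le h)
  have hWifin : {z | z ∈ innerPoles p q t ∧ r₀ ≤ ‖z‖}.Finite := finite_innerPoles hp hq t hr₀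
  have hWofin : {z | z ∈ outerPoles p q t ∧ z ≠ 0 ∧ ‖z‖ ≤ r₀}.Finite := finite_outerPoles hp hq t hr₀
  set Wi := hWifin.toFinset with hWi
  set Wo := hWofin.toFinset with hWo
  -- small discs about the points on the wrong side
  have hDi : ∀ z, z ≠ 0 → ContinuousAt (fun x : ℂ × ℂ => innerDen p q (τ x.1) x.2) (s₀, z) :=
    fun z hz => continuousAt_innerDen hp hq hτc hz
  have hDo : ∀ z, ContinuousAt (fun x : ℂ × ℂ => outerDen p q (τ x.1) x.2) (s₀, z) :=
    fun z => continuousAt_outerDen hp hq hτc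
  set Oi : Set ℂ := {z | r₀ < ‖z‖ ∧ ‖z‖ < M₀} ∩ {z | outerDen p q t z ≠ 0} with hOi
  set Oo : Set ℂ := {z | M₀⁻¹ < ‖z‖ ∧ ‖z‖ < r₀} ∩ {z | innerDen p q t z ≠ 0} with hOo
  have hE := (differentiable_pqPoch hp hq).continuous
  have hOiopen : IsOpen Oi := by
    refine IsOpen.inter ((isOpen_lt continuous_const continuous_norm).inter
      (isOpen_lt continuous_norm continuous_const)) (isOpen_ne_fun ?_ continuous_const)
    unfold outerDen
    exact continuous_finsetProd _ fun j _ => hE.comp (by fun_prop)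
  have hOoopen : IsOpen Oo := by
    have hann : IsOpen {z : ℂ | M₀⁻¹ < ‖z‖ ∧ ‖z‖ < r₀} :=
      (isOpen_lt continuous_const continuous_norm).inter (isOpen_lt continuous_norm continuous_const)
    refine ContinuousOn.isOpen_inter_preimage (f := innerDen p q t) (t := {0}ᶜ) ?_ hann
      isOpen_compl_singleton
    intro z hz
    have hz0 : z ≠ 0 := hne hm₀pos hz.1.le
    refine ContinuousAt.continuousWithinAt ?_
    unfold innerDen
    exact tendsto_finsetProd _ fun j _ =>
      hE.continuousAt.comp (continuousAt_const.mul (continuousAt_id.inv₀ hz0))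
  have hWiO : ∀ c ∈ Wi, c ∈ Oi := by
    intro c hc
    obtain ⟨hcP, hcr⟩ := hWifin.mem_toFinset.1 hc
    refine ⟨⟨lt_of_le_of_ne hcr (hr₀P c (Or.inl hcP)).symm, hPM t htM₀ c hcP⟩, fun h => ?_⟩
    exact hdisj.le_bot ⟨hcP, (outerDen_eq_zero_iff hp hq (hne hr₀ hcr)).1 h⟩
  have hWoO : ∀ c ∈ Wo, c ∈ Oo := by
    intro c hc
    obtain ⟨hcQ, hc0, hcr⟩ := hWofin.mem_toFinset.1 hc
    refine ⟨⟨hQm t h0 htM₀ c hcQ, lt_of_le_of_ne hcr (hr₀P c (Or.inr hcQ))⟩, fun h => ?_⟩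
    exact hdisj.le_bot ⟨(innerDen_eq_zero_iff hp hq hc0).1 h, hcQ⟩
  obtain ⟨δ, ⟨hδi, hδid⟩, ⟨hδo, hδod⟩, hδ⟩ := ((eventually_discs hOiopen Wi hWiO).and
    ((eventually_discs hOoopen Wo hWoO).and self_mem_nhdsWithin)).exists
  have hδ : 0 < δ := hδ
  -- compact sets on which no pole of one of the two families lies
  set Ki : Set ℂ := (Metric.closedBall 0 M₀ \ Metric.ball 0 r₀) \ ⋃ c ∈ Wi, Metric.ball c δ with hKi
  set Ko : Set ℂ := (Metric.closedBall 0 r₀ \ Metric.ball 0 M₀⁻¹) \ ⋃ c ∈ Wo, Metric.ball c δ with hKo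
  have hKic : IsCompact Ki := ((isCompact_closedBall _ _).diff Metric.isOpen_ball).diff
    (isOpen_biUnion fun c _ => Metric.isOpen_ball)
  have hKoc : IsCompact Ko := ((isCompact_closedBall _ _).diff Metric.isOpen_ball).diff
    (isOpen_biUnion fun c _ => Metric.isOpen_ball)
  have hmemKi : ∀ z, z ∈ Ki ↔ (‖z‖ ≤ M₀ ∧ r₀ ≤ ‖z‖) ∧ ∀ c ∈ Wi, z ∉ Metric.ball c δ := by
    intro z
    simp only [hKi, Set.mem_sdiff, mem_closedBall_zero_iff, mem_ball_zero_iff, not_lt, Set.mem_iUnion,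
      not_exists]
  have hmemKo : ∀ z, z ∈ Ko ↔ (‖z‖ ≤ r₀ ∧ M₀⁻¹ ≤ ‖z‖) ∧ ∀ c ∈ Wo, z ∉ Metric.ball c δ := by
    intro z
    simp only [hKo, Set.mem_sdiff, mem_closedBall_zero_iff, mem_ball_zero_iff, not_lt, Set.mem_iUnion,
      not_exists]
  have hKi0 : ∀ z ∈ Ki, innerDen p q t z ≠ 0 := by
    intro z hz h
    obtain ⟨⟨-, hzr⟩, hzb⟩ := (hmemKi z).1 hz
    have hzP := (innerDen_eq_zero_iff hp hq (hne hr₀ hzr)).1 h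
    exact hzb z (hWifin.mem_toFinset.2 ⟨hzP, hzr⟩) (Metric.mem_ball_self hδ)
  have hKo0 : ∀ z ∈ Ko, outerDen p q t z ≠ 0 := by
    intro z hz h
    obtain ⟨⟨hzr, hzm⟩, hzb⟩ := (hmemKo z).1 hz
    have hz0 := hne hm₀pos hzm
    have hzQ := (outerDen_eq_zero_iff hp hq hz0).1 h
    exact hzb z (hWofin.mem_toFinset.2 ⟨hzQ, hz0, hzr⟩) (Metric.mem_ball_self hδ)
  have hBi : ∀ᶠ s in 𝓝 s₀, ∀ c ∈ Wi, ∀ z ∈ Metric.closedBall c δ, outerDen p q (τ s) z ≠ 0 := by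
    rw [Filter.eventually_all_finset]
    exact fun c hc => eventually_forall_ne_zero (G := fun s z => outerDen p q (τ s) z)
      (isCompact_closedBall c δ) (fun z _ => hDo z) fun z hz => (hδi c hc hz).2
  have hBo : ∀ᶠ s in 𝓝 s₀, ∀ c ∈ Wo, ∀ z ∈ Metric.closedBall c δ, innerDen p q (τ s) z ≠ 0 := by
    rw [Filter.eventually_all_finset]
    exact fun c hc => eventually_forall_ne_zero (G := fun s z => innerDen p q (τ s) z)
      (isCompact_closedBall c δ) (fun z hz => hDi z (hne hm₀pos (hδo c hc hz).1.1.le))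
      fun z hz => (hδo c hc hz).2
  have hKi' : ∀ᶠ s in 𝓝 s₀, ∀ z ∈ Ki, innerDen p q (τ s) z ≠ 0 :=
    eventually_forall_ne_zero (G := fun s z => innerDen p q (τ s) z) hKic
      (fun z hz => hDi z (hne hr₀ ((hmemKi z).1 hz).1.2)) hKi0
  have hKo' : ∀ᶠ s in 𝓝 s₀, ∀ z ∈ Ko, outerDen p q (τ s) z ≠ 0 :=
    eventually_forall_ne_zero (G := fun s z => outerDen p q (τ s) z) hKoc
      (fun z _ => hDo z) hKo0
  have hnear : ∀ᶠ s in 𝓝 s₀, ∀ j, ‖τ s j‖ < M₀ ∧ τ s j ≠ 0 := by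
    rw [Filter.eventually_all]
    exact fun j => ((hτc j).norm.eventually (gt_mem_nhds (htM₀ j))).and ((hτc j).eventually_ne (h0 j))
  have hUnear : ∀ᶠ s in 𝓝 s₀, Unpinched p q (τ s) := by
    have : ContinuousAt (fun s => ∏ j, ∏ k, pqPoch p q (τ s j * τ s k)) s₀ :=
      tendsto_finsetProd _ fun j _ => tendsto_finsetProd _ fun k _ =>
        hE.continuousAt.comp ((hτc j).mul (hτc k))
    filter_upwards [this.eventually_ne ((unpinched_iff hp hq).1 hU)] with s hs
    exact (unpinched_iff hp hq).2 hs
  -- near `s₀` the cycle may be kept fixed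
  have hfix : ∀ᶠ s in 𝓝 s₀, V p q (τ s) = kappa p q *
      ((∮ z in C(0, r₀), regKernel p q (τ s) z / z) +
        ((∑ c ∈ Wi, ∮ z in C(c, δ), regKernel p q (τ s) z / z) -
          ∑ c ∈ Wo, ∮ z in C(c, δ), regKernel p q (τ s) z / z)) := by
    filter_upwards [hBi, hBo, hKi', hKo', hnear, hUnear] with s h1 h2 h3 h4 h5 h6
    have h0s : ∀ j, τ s j ≠ 0 := fun j => (h5 j).2
    rw [V_eq_regKernel hp0 hq0 hp hq h0s]
    congr 1
    obtain ⟨hr, hrP⟩ := admissibleRadius_contourRadius p q (τ s)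
    set r := contourRadius p q (τ s) with hrdef
    have hm : 0 < min M₀⁻¹ (r / 2) := lt_min hm₀pos (half_pos hr)
    have hSfin : {z | (z ∈ innerPoles p q (τ s) ∨ z ∈ outerPoles p q (τ s)) ∧
        min M₀⁻¹ (r / 2) < ‖z‖ ∧ ‖z‖ < max M₀ (r + 1)}.Finite := by
      refine ((finite_innerPoles hp hq (τ s) hm).union
        (finite_outerPoles hp hq (τ s) (hM₀pos.trans_le (le_max_left M₀ (r + 1))))).subset ?_
      rintro z ⟨hz | hz, hz1, hz2⟩
      · exact Or.inl ⟨hz, hz1.le⟩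
      · exact Or.inr ⟨hz, hne hm hz1.le, hz2.le⟩
    refine cycleIntegral_eq (P := innerPoles p q (τ s)) (Q := outerPoles p q (τ s))
      (m := min M₀⁻¹ (r / 2)) (M := max M₀ (r + 1)) (S := hSfin.toFinset)
      (h6.disjoint hp0 hq0 h0s) hm (fun z => hSfin.mem_toFinset)
      (fun z hz => (hPM _ (fun j => (h5 j).1) z hz).trans_le (le_max_left _ _))
      (fun z hz => (min_le_left _ _).trans_lt (hQm _ h0s (fun j => (h5 j).1) z hz))
      ?_ ?_ ((min_le_right _ _).trans_lt (half_lt_self hr))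
      ((lt_add_one r).trans_le (le_max_right _ _)) hrP ((min_le_left _ _).trans_lt hmr₀)
      (hrM₀.trans_le (le_max_left _ _)) hδ ?_ ?_ hδid hδod ?_ ?_
    · intro z hz1 hz2 hzS
      have hz0 := hne hm hz1.le
      have hz3 : ¬ (z ∈ innerPoles p q (τ s) ∨ z ∈ outerPoles p q (τ s)) := fun h =>
        hzS (hSfin.mem_toFinset.2 ⟨h, hz1, hz2⟩)
      rw [not_or] at hz3
      have h7 := analyticAt_regKernel hp hq (τ := fun _ => τ s) (s := s) (z := z)
        (fun j => analyticAt_const) h0s hz0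
        (fun h => hz3.1 ((innerDen_eq_zero_iff hp hq hz0).1 h))
        (fun h => hz3.2 ((outerDen_eq_zero_iff hp hq hz0).1 h))
      exact AnalyticAt.fun_comp (g := fun x : ℂ × ℂ => regKernel p q (τ s) x.2 / x.2)
        (f := fun z => (s, z)) h7 (analyticAt_const.prod analyticAt_id)
    · intro z hz
      exact meromorphicAt_regKernel hp hq h0s (hne hm (hSfin.mem_toFinset.1 hz).2.1.le)
    · intro c hc z hz
      have hz' := (hδi c hc hz).1
      exact ⟨hz'.1, hz'.2.trans_le (le_max_left _ _), fun hzQ =>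
        h1 c hc z hz ((outerDen_eq_zero_iff hp hq (hne hr₀ hz'.1.le)).2 hzQ)⟩
    · intro c hc z hz
      have hz' := (hδo c hc hz).1
      exact ⟨(min_le_left _ _).trans_lt hz'.1, hz'.2, fun hzP =>
        h2 c hc z hz ((innerDen_eq_zero_iff hp hq (hne hm₀pos hz'.1.le)).2 hzP)⟩
    · intro z hz hzr
      by_contra! hcon
      refine h3 z ((hmemKi z).2 ⟨⟨(hPM _ (fun j => (h5 j).1) z hz).le, hzr⟩, hcon⟩) ?_
      exact (innerDen_eq_zero_iff hp hq (hne hr₀ hzr)).2 hz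
    · intro z hz hzr
      have hzm := hQm _ h0s (fun j => (h5 j).1) z hz
      by_contra! hcon
      refine h4 z ((hmemKo z).2 ⟨⟨hzr, hzm.le⟩, hcon⟩) ?_
      exact (outerDen_eq_zero_iff hp hq (hne hm₀pos hzm.le)).2 hz
  refine AnalyticAt.congr ?_ (EventuallyEq.symm hfix)
  have hcirc : ∀ (c : ℂ) (ρ : ℝ), 0 ≤ ρ → (∀ z ∈ Metric.sphere c ρ, z ≠ 0 ∧ innerDen p q t z ≠ 0 ∧
      outerDen p q t z ≠ 0) → AnalyticAt ℂ (fun s => ∮ z in C(c, ρ), regKernel p q (τ s) z / z) s₀ :=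
    fun c ρ hρ h => analyticAt_circleIntegral (f := fun s z => regKernel p q (τ s) z / z) hρ fun z hz =>
      analyticAt_regKernel hp hq hτ h0 (h z hz).1 (h z hz).2.1 (h z hz).2.2
  refine analyticAt_const.mul (AnalyticAt.add ?_ (AnalyticAt.sub ?_ ?_))
  · refine hcirc 0 r₀ hr₀.le fun z hz => ?_
    have hz' : ‖z‖ = r₀ := mem_sphere_zero_iff_norm.1 hz
    have hz0 := hne hr₀ hz'.ge
    exact ⟨hz0, fun h => hr₀P z (Or.inl ((innerDen_eq_zero_iff hp hq hz0).1 h)) hz',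
      fun h => hr₀P z (Or.inr ((outerDen_eq_zero_iff hp hq hz0).1 h)) hz'⟩
  · refine Finset.analyticAt_fun_sum _ fun c hc => hcirc c δ hδ.le fun z hz => ?_
    have hzc := Metric.sphere_subset_closedBall hz
    have hz' := hδi c hc hzc
    refine ⟨hne hr₀ hz'.1.1.le, hKi0 z ((hmemKi z).2 ⟨⟨hz'.1.2.le, hz'.1.1.le⟩, ?_⟩), hz'.2⟩
    intro c' hc' hzc'
    rcases eq_or_ne c c' with rfl | hcc
    · exact (Metric.mem_ball.1 hzc').ne (Metric.mem_sphere.1 hz)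
    · exact (hδid c hc c' hc' hcc).le_bot ⟨hzc, Metric.ball_subset_closedBall hzc'⟩
  · refine Finset.analyticAt_fun_sum _ fun c hc => hcirc c δ hδ.le fun z hz => ?_
    have hzc := Metric.sphere_subset_closedBall hz
    have hz' := hδo c hc hzc
    refine ⟨hne hm₀pos hz'.1.1.le, hz'.2, hKo0 z ((hmemKo z).2 ⟨⟨hz'.1.2.le, hz'.1.1.le⟩, ?_⟩)⟩
    intro c' hc' hzc'
    rcases eq_or_ne c c' with rfl | hcc
    · exact (Metric.mem_ball.1 hzc').ne (Metric.mem_sphere.1 hz)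
    · exact (hδod c hc c' hc' hcc).le_bot ⟨hzc, Metric.ball_subset_closedBall hzc'⟩

/-! ### Uniqueness of theta functions -/

/-- A function holomorphic on `ℂ \ {0}` with `G(pz) = C z G(z)` vanishes: it is bounded near zero,
and the equation is incompatible with a finite order of vanishing there. -/
theorem eq_zero_of_map_mul_p {p C : ℂ} (hp0 : p ≠ 0) (hp : ‖p‖ < 1) {G : ℂ → ℂ}
    (hG : DifferentiableOn ℂ G {0}ᶜ) (h : ∀ z ≠ 0, G (p * z) = C * z * G z) :
    ∀ z ≠ 0, G z = 0 := by
  have hpn : 0 < ‖p‖ := norm_pos_iff.2 hp0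
  set ρ : ℝ := (1 + ‖C‖)⁻¹ with hρ
  have hC1 : 0 < 1 + ‖C‖ := by positivity
  have hρ0 : 0 < ρ := inv_pos.2 hC1
  have hCρ : ‖C‖ * ρ ≤ 1 := by
    rw [hρ, ← div_eq_mul_inv, div_le_one hC1]; linarith
  have hK : IsCompact (Metric.closedBall (0 : ℂ) ρ \ Metric.ball 0 (‖p‖ * ρ)) :=
    (isCompact_closedBall _ _).diff Metric.isOpen_ball
  obtain ⟨M, hM⟩ := hK.exists_bound_of_continuousOn (hG.continuousOn.mono fun z hz h0 => by
    rw [Set.mem_singleton_iff.1 h0] at hz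
    exact hz.2 (Metric.mem_ball_self (mul_pos hpn hρ0)))
  have hbd : ∀ n : ℕ, ∀ z : ℂ, ‖p‖ ^ (n + 1) * ρ ≤ ‖z‖ → ‖z‖ ≤ ρ → ‖G z‖ ≤ M := by
    intro n
    induction n with
    | zero =>
      intro z h1 h2
      exact hM z ⟨mem_closedBall_zero_iff.2 h2, by simpa using h1⟩
    | succ n ih =>
      intro z h1 h2
      rcases le_or_gt (‖p‖ * ρ) ‖z‖ with h3 | h3
      · exact hM z ⟨mem_closedBall_zero_iff.2 h2, by simpa using h3⟩
      · have hz0 : z ≠ 0 := norm_pos_iff.1 (lt_of_lt_of_le (by positivity) h1)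
        have e : z = p * (z / p) := by field_simp
        have hn : ‖z / p‖ = ‖z‖ / ‖p‖ := norm_div _ _
        have h4 : ‖z / p‖ ≤ ρ := by rw [hn, div_le_iff₀ hpn]; linarith
        have h5 : ‖p‖ ^ (n + 1) * ρ ≤ ‖z / p‖ := by
          rw [hn, le_div_iff₀ hpn]; calc _ = ‖p‖ ^ (n + 1 + 1) * ρ := by ring
            _ ≤ _ := h1
        rw [e, h _ (div_ne_zero hz0 hp0), norm_mul, norm_mul]
        calc ‖C‖ * ‖z / p‖ * ‖G (z / p)‖ ≤ ‖C‖ * ρ * ‖G (z / p)‖ := by gcongr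
          _ ≤ 1 * ‖G (z / p)‖ := by gcongr
          _ ≤ M := by rw [one_mul]; exact ih _ h5 h4
  have hbd' : ∀ z ∈ Metric.ball (0 : ℂ) ρ \ {0}, ‖G z‖ ≤ M := by
    rintro z ⟨hz, hz0⟩
    have hz0' : 0 < ‖z‖ := norm_pos_iff.2 hz0
    obtain ⟨n, hn⟩ := exists_pow_lt_of_lt_one (div_pos hz0' hρ0) hp
    refine hbd n z ?_ (mem_ball_zero_iff.1 hz).le
    rw [lt_div_iff₀ hρ0] at hn
    exact (mul_le_mul_of_nonneg_right (pow_le_pow_of_le_one hpn.le hp.le (Nat.le_succ n))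
      hρ0.le).trans hn.le
  -- extend over zero
  set g : ℂ → ℂ := Function.update G 0 (limUnder (𝓝[≠] 0) G) with hg
  have hgd : DifferentiableOn ℂ g (Metric.ball 0 ρ) :=
    Complex.differentiableOn_update_limUnder_of_bddAbove (Metric.ball_mem_nhds 0 hρ0)
      (hG.mono fun z hz => hz.2) ⟨M, by rintro _ ⟨z, hz, rfl⟩; exact hbd' z hz⟩
  have hgG : ∀ z ≠ 0, g z = G z := fun z hz => Function.update_of_ne hz _ _
  have hgan : AnalyticAt ℂ g 0 := hgd.analyticAt (Metric.ball_mem_nhds 0 hρ0)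
  have hev0 : ∀ᶠ z in 𝓝 0, g z = 0 := by
    by_contra hcon
    obtain ⟨n, k, hk, hk0, hgk⟩ := hgan.exists_eventuallyEq_pow_smul_nonzero_iff.2 hcon
    have htend : Tendsto (fun z : ℂ => p * z) (𝓝 0) (𝓝 0) := by
      exact Continuous.tendsto' (by fun_prop) _ _ (mul_zero p)
    have hev : ∀ᶠ z in 𝓝[≠] (0 : ℂ), p ^ n * k (p * z) = C * z * k z := by
      filter_upwards [self_mem_nhdsWithin, nhdsWithin_le_nhds hgk,
        nhdsWithin_le_nhds (htend.eventually hgk)] with z hz h1 h2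
      have hz' : z ≠ 0 := hz
      have h3 := h z hz'
      rw [← hgG z hz', ← hgG _ (mul_ne_zero hp0 hz'), h1, h2, smul_eq_mul, smul_eq_mul, sub_zero,
        sub_zero] at h3
      have hzn : z ^ n ≠ 0 := pow_ne_zero n hz'
      apply mul_left_cancel₀ hzn
      rw [mul_pow] at h3
      linear_combination h3
    have hL : Tendsto (fun z => p ^ n * k (p * z)) (𝓝[≠] 0) (𝓝 (p ^ n * k 0)) :=
      ((hk.continuousAt.tendsto.comp htend).const_mul _).mono_left nhdsWithin_le_nhds
    have hR : Tendsto (fun z => C * z * k z) (𝓝[≠] 0) (𝓝 (C * 0 * k 0)) :=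
      ((continuousAt_const.mul continuousAt_id).mul hk.continuousAt).tendsto.mono_left
        nhdsWithin_le_nhds
    have := tendsto_nhds_unique (hL.congr' hev) hR
    rw [mul_zero, zero_mul] at this
    exact mul_ne_zero (pow_ne_zero n hp0) hk0 this
  obtain ⟨ε, hε, hball⟩ := Metric.eventually_nhds_iff_ball.1 hev0
  have han := hG.analyticOnNhd isOpen_compl_singleton
  set z₁ : ℂ := ((ε / 2 : ℝ) : ℂ) with hz₁
  have hz₁n : ‖z₁‖ = ε / 2 := by
    rw [hz₁, Complex.norm_real, Real.norm_of_nonneg (half_pos hε).le]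
  have hz₁0 : z₁ ≠ 0 := norm_pos_iff.1 (by rw [hz₁n]; exact half_pos hε)
  have hz₁ev : G =ᶠ[𝓝 z₁] 0 := by
    filter_upwards [isOpen_compl_singleton.mem_nhds (show z₁ ∈ ({0}ᶜ : Set ℂ) from hz₁0),
      Metric.isOpen_ball.mem_nhds (show z₁ ∈ Metric.ball (0 : ℂ) ε by
        rw [mem_ball_zero_iff, hz₁n]; exact half_lt_self hε)] with z h1 h2
    rw [← hgG z h1]
    exact hball z h2
  have hconn : IsPreconnected ({0}ᶜ : Set ℂ) :=
    (isConnected_compl_singleton_of_one_lt_rank (by simp) 0).isPreconnected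
  exact fun z hz => han.eqOn_zero_of_preconnected_of_eventuallyEq_zero hconn hz₁0 hz₁ev hz

theorem deriv_theta_mul_p {p z : ℂ} (hp0 : p ≠ 0) (hp : ‖p‖ < 1) (hz : z ≠ 0)
    (h : theta p z = 0) : p * deriv (theta p) (p * z) = -z⁻¹ * deriv (theta p) z := by
  have h1 : HasDerivAt (fun y => theta p (p * y)) (deriv (theta p) (p * z) * p) z :=
    HasDerivAt.comp z (differentiableAt_theta hp (mul_ne_zero hp0 hz)).hasDerivAt
      (by simpa using (hasDerivAt_id z).const_mul p)
  have h2 : HasDerivAt (fun y => -y⁻¹ * theta p y)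
      (-(-(z ^ 2)⁻¹) * theta p z + -z⁻¹ * deriv (theta p) z) z :=
    (hasDerivAt_inv hz).neg.mul (differentiableAt_theta hp hz).hasDerivAt
  have h3 : (fun y => theta p (p * y)) =ᶠ[𝓝 z] fun y => -y⁻¹ * theta p y := by
    filter_upwards [isOpen_compl_singleton.mem_nhds (show z ∈ ({0}ᶜ : Set ℂ) from hz)] with y hy
    exact theta_mul_p hp0 hp hy
  have := h1.unique (h2.congr_of_eventuallyEq h3)
  rw [h, mul_zero, zero_add] at this
  linear_combination this

/-- The zeros of the theta function are simple. -/
theorem deriv_theta_ne_zero {p z : ℂ} (hp0 : p ≠ 0) (hp : ‖p‖ < 1) (hz : z ≠ 0)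
    (h : theta p z = 0) : deriv (theta p) z ≠ 0 := by
  have hE := differentiable_qPoch hp
  have hone : deriv (theta p) 1 ≠ 0 := by
    have hd : DifferentiableAt ℂ (fun z => qPoch p (p * z) * qPoch p (p / z)) 1 :=
      ((hE _).comp (1 : ℂ) (by fun_prop)).mul
        ((hE _).comp (1 : ℂ) (by fun_prop (disch := exact one_ne_zero)))
    have h1 : HasDerivAt (fun z => (1 - z) * (qPoch p (p * z) * qPoch p (p / z)))
        (-1 * (qPoch p (p * 1) * qPoch p (p / 1)) +
          (1 - 1) * deriv (fun z => qPoch p (p * z) * qPoch p (p / z)) 1) 1 :=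
      ((hasDerivAt_id (1 : ℂ)).const_sub 1).mul hd.hasDerivAt
    have h2 : theta p = fun z => (1 - z) * (qPoch p (p * z) * qPoch p (p / z)) := by
      ext z
      rw [theta, qPoch_eq_mul hp z, mul_assoc]
    rw [h2, h1.deriv]
    simpa using qPoch_ne_zero_of_norm_lt hp hp
  have hzero : ∀ n : ℤ, theta p (p ^ n) = 0 := fun n =>
    (theta_eq_zero_iff hp0 hp (zpow_ne_zero n hp0)).2 ⟨n, rfl⟩
  obtain ⟨n, rfl⟩ := (theta_eq_zero_iff hp0 hp hz).1 h
  clear h hz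
  induction n using Int.induction_on with
  | zero => simpa using hone
  | succ n ih =>
    have hz := zpow_ne_zero (n : ℤ) hp0
    have := deriv_theta_mul_p hp0 hp hz (hzero n)
    rw [zpow_add_one₀ hp0, mul_comm _ p]
    intro h0
    rw [h0, mul_zero] at this
    exact mul_ne_zero (neg_ne_zero.2 (inv_ne_zero hz)) ih this.symm
  | pred n ih =>
    have hz := zpow_ne_zero (-(n : ℤ) - 1) hp0
    have := deriv_theta_mul_p hp0 hp hz (hzero _)
    rw [← zpow_one_add₀ hp0, add_sub_cancel] at this
    intro h0
    rw [h0, mul_zero] at this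
    exact mul_ne_zero hp0 ih this

theorem hasDerivAt_theta_div {p a z : ℂ} (hp : ‖p‖ < 1) (ha : a ≠ 0) (hz : z ≠ 0) :
    HasDerivAt (fun z => theta p (z / a)) (deriv (theta p) (z / a) * (1 / a)) z :=
  HasDerivAt.comp (h₂ := theta p) (h := fun z => z / a) z
    (differentiableAt_theta hp (div_ne_zero hz ha)).hasDerivAt ((hasDerivAt_id z).div_const a)

/-- A function holomorphic on `ℂ \ {0}` which vanishes at the zeros of `θ(z / a; p)` is divisible
by it. -/
theorem exists_eq_theta_mul {p a : ℂ} (hp0 : p ≠ 0) (hp : ‖p‖ < 1) (ha : a ≠ 0) {F : ℂ → ℂ}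
    (hF : DifferentiableOn ℂ F {0}ᶜ) (h0 : ∀ z ≠ 0, theta p (z / a) = 0 → F z = 0) :
    ∃ G : ℂ → ℂ, DifferentiableOn ℂ G {0}ᶜ ∧ ∀ z ≠ 0, F z = theta p (z / a) * G z := by
  classical
  set T : ℂ → ℂ := fun z => theta p (z / a) with hT
  have hTd : ∀ z ≠ 0, HasDerivAt T (deriv (theta p) (z / a) * (1 / a)) z := fun z hz =>
    hasDerivAt_theta_div hp ha hz
  have hTan : AnalyticOnNhd ℂ T {0}ᶜ := DifferentiableOn.analyticOnNhd
    (fun z hz => (hTd z hz).differentiableAt.differentiableWithinAt) isOpen_compl_singleton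
  have hFan := hF.analyticOnNhd isOpen_compl_singleton
  set G : ℂ → ℂ := fun z => if T z = 0 then deriv F z / deriv T z else F z / T z with hG
  refine ⟨G, fun w hw => ?_, fun z hz => ?_⟩
  · have hw0 : w ≠ 0 := hw
    have hwn : ({0}ᶜ : Set ℂ) ∈ 𝓝 w := isOpen_compl_singleton.mem_nhds hw
    have hFw : DifferentiableAt ℂ F w := hF.differentiableAt hwn
    have hTw : DifferentiableAt ℂ T w := (hTd w hw0).differentiableAt
    refine DifferentiableAt.differentiableWithinAt ?_
    by_cases hz : T w = 0
    · have hdT : dslope T w w ≠ 0 := by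
        rw [dslope_same, (hTd w hw0).deriv]
        exact mul_ne_zero (deriv_theta_ne_zero hp0 hp (div_ne_zero hw0 ha) hz)
          (one_div_ne_zero ha)
      have hdF : DifferentiableAt ℂ (dslope F w) w :=
        (((Complex.differentiableOn_dslope hwn).2 hF).differentiableAt hwn)
      have hdT' : DifferentiableAt ℂ (dslope T w) w :=
        (((Complex.differentiableOn_dslope hwn).2 hTan.differentiableOn).differentiableAt hwn)
      refine (hdF.div hdT' hdT).congr_of_eventuallyEq ?_
      filter_upwards [hdT'.continuousAt.eventually_ne hdT] with z hne
      rcases eq_or_ne z w with rfl | hzw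
      · simp [hG, hz, dslope_same]
      · have hzw' : z - w ≠ 0 := sub_ne_zero.2 hzw
        have e1 : dslope T w z = T z / (z - w) := by
          rw [dslope_of_ne _ hzw, slope_def_field, hz, sub_zero]
        have e2 : dslope F w z = F z / (z - w) := by
          rw [dslope_of_ne _ hzw, slope_def_field, h0 w hw0 hz, sub_zero]
        have hTz : T z ≠ 0 := fun h => hne (by rw [e1, h, zero_div])
        simp only [hG, if_neg hTz, Pi.div_apply, e1, e2]
        field_simp
    · refine (hFw.div hTw hz).congr_of_eventuallyEq ?_
      filter_upwards [hTw.continuousAt.eventually_ne hz] with z hne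
      simp only [hG, if_neg hne, Pi.div_apply]
  · by_cases hz0 : T z = 0
    · rw [h0 z hz hz0]
      exact (mul_eq_zero_of_left hz0 _).symm
    · simp only [hG, if_neg hz0]
      exact (mul_div_cancel₀ _ hz0).symm

/-- A theta function of degree `n - 1` with `n` zeros which are distinct modulo `p^ℤ` vanishes. -/
theorem eq_zero_of_zeros {p : ℂ} (hp0 : p ≠ 0) (hp : ‖p‖ < 1) (A : Finset ℂ) :
    ∀ (C : ℂ) (F : ℂ → ℂ), DifferentiableOn ℂ F {0}ᶜ →
    (∀ z ≠ 0, z ^ A.card * F (p * z) = C * z * F z) → (∀ a ∈ A, a ≠ 0 ∧ F a = 0) →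
    (∀ a ∈ A, ∀ b ∈ A, a ≠ b → theta p (b / a) ≠ 0) → ∀ z ≠ 0, F z = 0 := by
  classical
  induction A using Finset.induction_on with
  | empty =>
    intro C F hF h _ _
    exact eq_zero_of_map_mul_p hp0 hp hF fun z hz => by simpa using h z hz
  | insert a A haA ih =>
    intro C F hF h hz hd
    obtain ⟨ha, hFa⟩ := hz a (by simp)
    rw [Finset.card_insert_of_notMem haA] at h
    have hstep : ∀ z ≠ 0, F z = 0 → F (p * z) = 0 := by
      intro z hz0 hFz
      have := h z hz0
      rw [hFz, mul_zero] at this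
      exact (mul_eq_zero.1 this).resolve_left (pow_ne_zero _ hz0)
    rcases eq_or_ne C 0 with rfl | hC
    · intro z hz0
      have := h (z / p) (div_ne_zero hz0 hp0)
      rw [mul_div_cancel₀ _ hp0, zero_mul, zero_mul] at this
      exact (mul_eq_zero.1 this).resolve_left (pow_ne_zero _ (div_ne_zero hz0 hp0))
    have hback : ∀ z ≠ 0, F (p * z) = 0 → F z = 0 := by
      intro z hz0 hFz
      have := h z hz0
      rw [hFz, mul_zero] at this
      exact (mul_eq_zero.1 this.symm).resolve_left (mul_ne_zero hC hz0)
    have hFpow : ∀ n : ℤ, F (a * p ^ n) = 0 := by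
      intro n
      induction n using Int.induction_on with
      | zero => simpa using hFa
      | succ n ih =>
        rw [zpow_add_one₀ hp0, ← mul_assoc, mul_comm _ p]
        exact hstep _ (mul_ne_zero ha (zpow_ne_zero _ hp0)) ih
      | pred n ih =>
        refine hback _ (mul_ne_zero ha (zpow_ne_zero _ hp0)) ?_
        rwa [mul_left_comm, ← zpow_one_add₀ hp0, add_sub_cancel]
    obtain ⟨G, hG, hFG⟩ := exists_eq_theta_mul hp0 hp ha hF (by
      intro z hz0 hT
      obtain ⟨n, hn⟩ := (theta_eq_zero_iff hp0 hp (div_ne_zero hz0 ha)).1 hT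
      rw [← mul_div_cancel₀ z ha, hn]
      exact hFpow n)
    have hGeq : ∀ z ≠ 0, theta p (z / a) ≠ 0 →
        z ^ A.card * G (p * z) = -C / a * z * G z := by
      intro z hz0 hT
      have h1 := h z hz0
      rw [hFG z hz0, hFG _ (mul_ne_zero hp0 hz0), mul_div_assoc,
        theta_mul_p hp0 hp (div_ne_zero hz0 ha), pow_succ] at h1
      apply mul_left_cancel₀ hT
      field_simp at h1 ⊢
      linear_combination -h1
    have hGzero := ih (-C / a) G hG ?_ ?_ ?_
    · intro z hz0
      rw [hFG z hz0, hGzero z hz0, mul_zero]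
    · -- the zeros of the theta factor are isolated, so the equation extends by continuity
      intro z hz0
      by_cases hT : theta p (z / a) = 0
      · have hza := div_ne_zero hz0 ha
        have hcd : ContinuousAt (fun z => z ^ A.card * G (p * z)) z := by
          refine ContinuousAt.mul (by fun_prop) ?_
          exact ContinuousAt.comp (g := G) (f := fun z => p * z)
            (hG.continuousOn.continuousAt (isOpen_compl_singleton.mem_nhds (mul_ne_zero hp0 hz0)))
            (by fun_prop)
        have hcd' : ContinuousAt (fun z => -C / a * z * G z) z :=
          ContinuousAt.mul (by fun_prop)
            (hG.continuousOn.continuousAt (isOpen_compl_singleton.mem_nhds hz0))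
        have hderiv : HasDerivAt (fun z => theta p (z / a)) (deriv (theta p) (z / a) * (1 / a)) z :=
          hasDerivAt_theta_div hp ha hz0
        have hne := hderiv.eventually_ne (c := 0)
          (mul_ne_zero (deriv_theta_ne_zero hp0 hp hza hT) (one_div_ne_zero ha))
        refine tendsto_nhds_unique_of_eventuallyEq (l := 𝓝[≠] z)
          (hcd.tendsto.mono_left nhdsWithin_le_nhds) (hcd'.tendsto.mono_left nhdsWithin_le_nhds) ?_
        filter_upwards [hne, nhdsWithin_le_nhds (isOpen_compl_singleton.mem_nhds
          (show z ∈ ({0}ᶜ : Set ℂ) from hz0))] with y hy hy0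
        exact hGeq y hy0 hy
      · exact hGeq z hz0 hT
    · intro b hb
      obtain ⟨hb0, hFb⟩ := hz b (by simp [hb])
      refine ⟨hb0, ?_⟩
      rw [hFG b hb0] at hFb
      refine (mul_eq_zero.1 hFb).resolve_left (hd a (by simp) b (by simp [hb]) ?_)
      rintro rfl
      exact haA hb
    · exact fun b hb c hc => hd b (by simp [hb]) c (by simp [hc])

/-! ### Theta function identities -/

/-- The product `θ(a z, a z⁻¹; p)`. -/
def thetaPair (p a z : ℂ) : ℂ := theta p (a * z) * theta p (a * z⁻¹)

theorem theta_div_comm {p a b : ℂ} (hp : ‖p‖ < 1) (ha : a ≠ 0) (hb : b ≠ 0) :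
    theta p (a * b⁻¹) = -(a / b) * theta p (b * a⁻¹) := by
  have h := theta_inv hp (mul_ne_zero hb (inv_ne_zero ha))
  rw [mul_inv, inv_inv, mul_comm b⁻¹ a] at h
  rw [h, div_eq_mul_inv]

theorem thetaPair_inv (p a z : ℂ) : thetaPair p a z⁻¹ = thetaPair p a z := by
  rw [thetaPair, thetaPair, inv_inv, mul_comm]

theorem thetaPair_self {p a : ℂ} (hp : ‖p‖ < 1) (ha : a ≠ 0) : thetaPair p a a = 0 := by
  rw [thetaPair, mul_inv_cancel₀ ha, theta_one hp, mul_zero]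

theorem thetaPair_comm {p a z : ℂ} (hp : ‖p‖ < 1) (ha : a ≠ 0) (hz : z ≠ 0) :
    thetaPair p a z = -(a / z) * thetaPair p z a := by
  rw [thetaPair, thetaPair, theta_div_comm hp ha hz, mul_comm a z]
  ring

theorem theta_mul_inv_p_mul {p a z : ℂ} (hp0 : p ≠ 0) (hp : ‖p‖ < 1) (ha : a ≠ 0) (hz : z ≠ 0) :
    theta p (a * (p * z)⁻¹) = -(a / (p * z)) * theta p (a * z⁻¹) := by
  have h := theta_mul_p hp0 hp (mul_ne_zero ha (inv_ne_zero (mul_ne_zero hp0 hz)))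
  have e : p * (a * (p * z)⁻¹) = a * z⁻¹ := by field_simp
  rw [e] at h
  rw [h]
  field_simp

theorem thetaPair_mul_p {p a z : ℂ} (hp0 : p ≠ 0) (hp : ‖p‖ < 1) (ha : a ≠ 0) (hz : z ≠ 0) :
    thetaPair p a (p * z) = (p * z ^ 2)⁻¹ * thetaPair p a z := by
  rw [thetaPair, thetaPair, theta_mul_inv_p_mul hp0 hp ha hz, mul_left_comm a p z,
    theta_mul_p hp0 hp (mul_ne_zero ha hz)]
  field_simp

theorem differentiableAt_theta_comp {p : ℂ} (hp : ‖p‖ < 1) {f : ℂ → ℂ} {z : ℂ}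
    (hf : DifferentiableAt ℂ f z) (h0 : f z ≠ 0) : DifferentiableAt ℂ (fun z => theta p (f z)) z :=
  (differentiableAt_theta hp h0).comp z hf

theorem differentiableAt_thetaPair {p a z : ℂ} (hp : ‖p‖ < 1) (ha : a ≠ 0) (hz : z ≠ 0) :
    DifferentiableAt ℂ (thetaPair p a) z :=
  (differentiableAt_theta_comp hp (by fun_prop) (mul_ne_zero ha hz)).mul
    (differentiableAt_theta_comp hp (by fun_prop (disch := exact hz))
      (mul_ne_zero ha (inv_ne_zero hz)))

theorem eventually_theta_ne_zero {p : ℂ} (hp0 : p ≠ 0) (hp : ‖p‖ < 1) {f : ℂ → ℂ} {f' z : ℂ}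
    (hf : HasDerivAt f f' z) (h0 : f z ≠ 0) (hf' : f' ≠ 0) :
    ∀ᶠ y in 𝓝[≠] z, theta p (f y) ≠ 0 := by
  have hd : HasDerivAt (fun y => theta p (f y)) (deriv (theta p) (f z) * f') z :=
    HasDerivAt.comp (h₂ := theta p) z (differentiableAt_theta hp h0).hasDerivAt hf
  by_cases h : theta p (f z) = 0
  · exact hd.eventually_ne (mul_ne_zero (deriv_theta_ne_zero hp0 hp h0 h) hf')
  · exact nhdsWithin_le_nhds (hd.continuousAt.eventually_ne h)

theorem theta_addition_of_ne {p a b s z : ℂ} (hp0 : p ≠ 0) (hp : ‖p‖ < 1) (ha : a ≠ 0) (hb : b ≠ 0)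
    (hs : s ≠ 0) (hz : z ≠ 0) (h1 : theta p (a * a) ≠ 0) (h2 : theta p (a * b) ≠ 0)
    (h3 : theta p (a * b⁻¹) ≠ 0) :
    b * thetaPair p s b * thetaPair p a z - a * thetaPair p s a * thetaPair p b z =
      b * thetaPair p a b * thetaPair p s z := by
  classical
  set F : ℂ → ℂ := fun z => b * thetaPair p s b * thetaPair p a z -
    a * thetaPair p s a * thetaPair p b z - b * thetaPair p a b * thetaPair p s z with hF
  suffices h : F z = 0 from sub_eq_zero.1 h
  have hai := inv_ne_zero ha
  have hFinv : ∀ z, F z⁻¹ = F z := fun z => by simp only [hF, thetaPair_inv]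
  have hFa : F a = 0 := by
    simp only [hF, thetaPair_self hp ha, thetaPair_comm hp ha hb]
    field_simp
    ring
  have hFb : F b = 0 := by
    simp only [hF, thetaPair_self hp hb]
    ring
  have hinv : ∀ y : ℂ, y ≠ 0 → theta p y ≠ 0 → theta p y⁻¹ ≠ 0 := fun y hy h => by
    rw [theta_inv hp hy]
    exact mul_ne_zero (neg_ne_zero.2 (inv_ne_zero hy)) h
  have hbne : b ∉ ({a, a⁻¹} : Finset ℂ) := by
    simp only [Finset.mem_insert, Finset.mem_singleton, not_or]
    refine ⟨?_, ?_⟩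
    · rintro rfl
      exact h3 (by rw [mul_inv_cancel₀ hb, theta_one hp])
    · rintro rfl
      exact h2 (by rw [mul_inv_cancel₀ ha, theta_one hp])
  have hane : a ∉ ({a⁻¹} : Finset ℂ) := by
    rw [Finset.mem_singleton]
    intro h
    refine h1 ?_
    conv_lhs => rw [show a * a = 1 by nth_rewrite 2 [h]; exact mul_inv_cancel₀ ha]
    exact theta_one hp
  refine eq_zero_of_zeros hp0 hp (insert b {a, a⁻¹}) p⁻¹ F ?_ ?_ ?_ ?_ z hz
  · intro z hz
    refine DifferentiableAt.differentiableWithinAt ?_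
    exact (((differentiableAt_thetaPair hp ha hz).const_mul _).sub
      ((differentiableAt_thetaPair hp hb hz).const_mul _)).sub
      ((differentiableAt_thetaPair hp hs hz).const_mul _)
  · intro z hz
    rw [Finset.card_insert_of_notMem hbne, Finset.card_insert_of_notMem hane,
      Finset.card_singleton]
    simp only [hF, thetaPair_mul_p hp0 hp ha hz, thetaPair_mul_p hp0 hp hb hz,
      thetaPair_mul_p hp0 hp hs hz]
    field_simp
  · intro y hy
    simp only [Finset.mem_insert, Finset.mem_singleton] at hy
    rcases hy with rfl | rfl | rfl
    · exact ⟨hb, hFb⟩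
    · exact ⟨ha, hFa⟩
    · exact ⟨hai, by rw [hFinv, hFa]⟩
  · have e1 : theta p (b / a) ≠ 0 := by
      have := hinv _ (mul_ne_zero ha (inv_ne_zero hb)) h3
      rwa [mul_inv, inv_inv, mul_comm, ← div_eq_mul_inv] at this
    have e2 : theta p (a⁻¹ / b) ≠ 0 := by
      have := hinv _ (mul_ne_zero ha hb) h2
      rwa [mul_inv, ← div_eq_mul_inv] at this
    have e3 : theta p (a⁻¹ / a) ≠ 0 := by
      have := hinv _ (mul_ne_zero ha ha) h1
      rwa [mul_inv, ← div_eq_mul_inv] at this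
    intro y hy y' hy' hne
    simp only [Finset.mem_insert, Finset.mem_singleton] at hy hy'
    rcases hy with rfl | rfl | rfl <;> rcases hy' with rfl | rfl | rfl <;>
      first
      | exact absurd rfl hne
      | assumption
      | (rw [div_inv_eq_mul]; first | assumption | (rw [mul_comm]; assumption))

/-- The addition formula (three-term relation) for the theta function. -/
theorem theta_addition {p a b s z : ℂ} (hp0 : p ≠ 0) (hp : ‖p‖ < 1) (ha : a ≠ 0) (hb : b ≠ 0)
    (hs : s ≠ 0) (hz : z ≠ 0) :
    b * thetaPair p s b * thetaPair p a z - a * thetaPair p s a * thetaPair p b z =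
      b * thetaPair p a b * thetaPair p s z := by
  have hc : ∀ y : ℂ, y ≠ 0 → ContinuousAt (fun a => thetaPair p a y) a := fun y hy =>
    ((differentiableAt_theta_comp (f := fun a => a * y) hp (by fun_prop) (mul_ne_zero ha hy)).mul
      (differentiableAt_theta_comp (f := fun a => a * y⁻¹) hp (by fun_prop)
        (mul_ne_zero ha (inv_ne_zero hy)))).continuousAt
  have hcs := (differentiableAt_thetaPair hp hs ha).continuousAt
  refine tendsto_nhds_unique_of_eventuallyEq (l := 𝓝[≠] a)
    (f := fun a => b * thetaPair p s b * thetaPair p a z - a * thetaPair p s a * thetaPair p b z)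
    (g := fun a => b * thetaPair p a b * thetaPair p s z) ?_ ?_ ?_
  · exact (((continuousAt_const.mul (hc z hz)).sub
      ((continuousAt_id.mul hcs).mul continuousAt_const)).tendsto).mono_left nhdsWithin_le_nhds
  · exact (((continuousAt_const.mul (hc b hb)).mul continuousAt_const).tendsto).mono_left
      nhdsWithin_le_nhds
  · have e1 : ∀ᶠ y in 𝓝[≠] a, theta p (y * y) ≠ 0 :=
      eventually_theta_ne_zero hp0 hp ((hasDerivAt_id a).mul (hasDerivAt_id a)) (mul_ne_zero ha ha)
        (by simpa using ha)
    have e2 : ∀ᶠ y in 𝓝[≠] a, theta p (y * b) ≠ 0 :=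
      eventually_theta_ne_zero hp0 hp ((hasDerivAt_id a).mul_const b) (mul_ne_zero ha hb)
        (by simpa using hb)
    have e3 : ∀ᶠ y in 𝓝[≠] a, theta p (y * b⁻¹) ≠ 0 :=
      eventually_theta_ne_zero hp0 hp ((hasDerivAt_id a).mul_const b⁻¹)
        (mul_ne_zero ha (inv_ne_zero hb)) (by simpa using hb)
    filter_upwards [e1, e2, e3, nhdsWithin_le_nhds (isOpen_compl_singleton.mem_nhds
      (show a ∈ ({0}ᶜ : Set ℂ) from ha))] with y h1 h2 h3 hy
    exact theta_addition_of_ne hp0 hp hy hb hs hz h1 h2 h3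

/-- `∏_{j=1}^8 θ(w_j z; p)`. -/
def thetaProd (p : ℂ) (w : Fin 8 → ℂ) (z : ℂ) : ℂ := ∏ j, theta p (w j * z)

/-- `∏_{j=1}^5 θ(w_j z; p)`. -/
def thetaProd₅ (p : ℂ) (w : Fin 8 → ℂ) (z : ℂ) : ℂ :=
  ∏ k : Fin 5, theta p (w (k.castLE (by norm_num)) * z)

theorem prod_fin_eight (f : Fin 8 → ℂ) :
    ∏ j, f j = (∏ k : Fin 5, f (k.castLE (by norm_num))) * f 5 * f 6 * f 7 := by
  rw [Fin.prod_univ_eight, Fin.prod_univ_five]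
  rfl

theorem thetaProd_eq (p : ℂ) (w : Fin 8 → ℂ) (z : ℂ) : thetaProd p w z =
    thetaProd₅ p w z * theta p (w 5 * z) * theta p (w 6 * z) * theta p (w 7 * z) :=
  prod_fin_eight _

theorem thetaProd_mul_p {p z : ℂ} {w : Fin 8 → ℂ} (hp0 : p ≠ 0) (hp : ‖p‖ < 1)
    (hw : ∀ j, w j ≠ 0) (hz : z ≠ 0) :
    thetaProd p w (p * z) = (∏ j, w j)⁻¹ * (z ^ 8)⁻¹ * thetaProd p w z := by
  have : ∀ j, theta p (w j * (p * z)) = -((w j)⁻¹ * z⁻¹) * theta p (w j * z) := fun j => by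
    rw [mul_left_comm, theta_mul_p hp0 hp (mul_ne_zero (hw j) hz), mul_inv]
  simp only [thetaProd, this, Finset.prod_mul_distrib, Finset.prod_neg, Finset.prod_inv_distrib,
    Finset.prod_const, Finset.card_univ, Fintype.card_fin]
  ring

/-- The difference of the two sides of the interpolation identity, as a function of `z`. -/
def interpolationDefect (p : ℂ) (w : Fin 8 → ℂ) (z : ℂ) : ℂ :=
  theta p (z ^ 2) *
      (thetaProd₅ p w (w 7) * thetaPair p (w 5) z * thetaPair p (w 6) z * theta p (w 5 * (w 6)⁻¹) -
        thetaProd₅ p w (w 6) * theta p (w 5 * (w 7)⁻¹) * thetaPair p (w 7) z * thetaPair p (w 5) z +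
        w 5 / w 6 * thetaProd₅ p w (w 5) * theta p (w 6 * (w 7)⁻¹) * thetaPair p (w 7) z *
          thetaPair p (w 6) z) -
    w 7 * theta p (w 5 * (w 7)⁻¹) * theta p (w 6 * (w 7)⁻¹) * theta p (w 5 * (w 6)⁻¹) *
      (z⁻¹ * thetaProd p w z - z ^ 3 * thetaProd p w z⁻¹)

theorem differentiableAt_thetaProd {p z : ℂ} {w : Fin 8 → ℂ} (hp : ‖p‖ < 1) (hw : ∀ j, w j ≠ 0)
    (hz : z ≠ 0) : DifferentiableAt ℂ (thetaProd p w) z := by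
  unfold thetaProd
  exact DifferentiableAt.fun_finsetProd fun j _ =>
    differentiableAt_theta_comp hp (by fun_prop) (mul_ne_zero (hw j) hz)

theorem differentiableAt_interpolationDefect {p z : ℂ} {w : Fin 8 → ℂ} (hp : ‖p‖ < 1)
    (hw : ∀ j, w j ≠ 0) (hz : z ≠ 0) : DifferentiableAt ℂ (interpolationDefect p w) z := by
  have h1 : DifferentiableAt ℂ (fun z : ℂ => theta p (z ^ 2)) z :=
    differentiableAt_theta_comp hp (by fun_prop) (pow_ne_zero 2 hz)
  have h2 := fun j => differentiableAt_thetaPair (a := w j) hp (hw j) hz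
  have h3 := differentiableAt_thetaProd hp hw hz
  have h4 : DifferentiableAt ℂ (fun z : ℂ => thetaProd p w z⁻¹) z :=
    (differentiableAt_thetaProd hp hw (inv_ne_zero hz)).comp z (differentiableAt_inv hz)
  have h5 : DifferentiableAt ℂ (fun z : ℂ => z⁻¹) z := differentiableAt_inv hz
  unfold interpolationDefect
  fun_prop

theorem interpolationDefect_inv {p z : ℂ} {w : Fin 8 → ℂ} (hp : ‖p‖ < 1) (hz : z ≠ 0) :
    interpolationDefect p w z⁻¹ = -(z ^ 2)⁻¹ * interpolationDefect p w z := by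
  simp only [interpolationDefect, thetaPair_inv, inv_pow, theta_inv hp (pow_ne_zero 2 hz), inv_inv]
  field_simp
  ring

theorem interpolationDefect_mul_p {p z : ℂ} {w : Fin 8 → ℂ} (hp0 : p ≠ 0) (hp : ‖p‖ < 1)
    (hw : ∀ j, w j ≠ 0) (hprod : ∏ j, w j = p ^ 2) (hz : z ≠ 0) :
    interpolationDefect p w (p * z) = (p ^ 3 * z ^ 8)⁻¹ * interpolationDefect p w z := by
  have h1 : theta p ((p * z) ^ 2) = (p * z ^ 4)⁻¹ * theta p (z ^ 2) := by
    rw [show (p * z) ^ 2 = p * (p * z ^ 2) by ring,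
      theta_mul_p hp0 hp (mul_ne_zero hp0 (pow_ne_zero 2 hz)), theta_mul_p hp0 hp (pow_ne_zero 2 hz)]
    field_simp
  have h2 : thetaProd p w (p * z)⁻¹ = (p ^ 6 * z ^ 8)⁻¹ * thetaProd p w z⁻¹ := by
    have h := thetaProd_mul_p hp0 hp hw (inv_ne_zero (mul_ne_zero hp0 hz))
    rw [show p * (p * z)⁻¹ = z⁻¹ by field_simp, hprod] at h
    rw [h]
    field_simp
  simp only [interpolationDefect, h1, h2, thetaProd_mul_p hp0 hp hw hz, hprod,
    fun j => thetaPair_mul_p (a := w j) hp0 hp (hw j) hz]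
  field_simp

theorem interpolationDefect_eq_zero_at {p : ℂ} {w : Fin 8 → ℂ} (hp : ‖p‖ < 1)
    (hw : ∀ j, w j ≠ 0) : interpolationDefect p w (w 5) = 0 ∧ interpolationDefect p w (w 6) = 0 ∧
      interpolationDefect p w (w 7) = 0 := by
  have h5 := hw 5
  have h6 := hw 6
  have h7 := hw 7
  refine ⟨?_, ?_, ?_⟩
  · have e : thetaProd p w (w 5)⁻¹ = 0 := by
      rw [thetaProd_eq, mul_inv_cancel₀ h5, theta_one hp]; ring
    simp only [interpolationDefect, e, thetaPair_self hp h5, thetaProd_eq]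
    simp only [thetaPair, theta_div_comm hp h7 h5, theta_div_comm hp h6 h5, pow_two]
    field_simp
    ring
  · have e : thetaProd p w (w 6)⁻¹ = 0 := by
      rw [thetaProd_eq, mul_inv_cancel₀ h6, theta_one hp]; ring
    simp only [interpolationDefect, e, thetaPair_self hp h6, thetaProd_eq]
    simp only [thetaPair, theta_div_comm hp h7 h6, pow_two]
    field_simp
    ring
  · have e : thetaProd p w (w 7)⁻¹ = 0 := by
      rw [thetaProd_eq, mul_inv_cancel₀ h7, theta_one hp]; ring
    simp only [interpolationDefect, e, thetaPair_self hp h7, thetaProd_eq]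
    simp only [thetaPair, pow_two]
    field_simp
    ring

theorem eq_of_theta_div_eq_zero {p y y' : ℂ} (hp0 : p ≠ 0) (hp : ‖p‖ < 1) (h1 : ‖p‖ < ‖y‖)
    (h2 : ‖y‖ ≤ 1) (h1' : ‖p‖ < ‖y'‖) (h2' : ‖y'‖ ≤ 1) (h : theta p (y' / y) = 0) : y = y' := by
  have hp' : 0 < ‖p‖ := norm_pos_iff.2 hp0
  have hy : y ≠ 0 := norm_pos_iff.1 (hp'.trans h1)
  have hy' : y' ≠ 0 := norm_pos_iff.1 (hp'.trans h1')
  obtain ⟨n, hn⟩ := (theta_eq_zero_iff hp0 hp (div_ne_zero hy' hy)).1 h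
  have hn' : ‖y'‖ = ‖p‖ ^ n * ‖y‖ := by
    rw [← norm_zpow, ← hn, norm_div, div_mul_cancel₀ _ (norm_ne_zero_iff.2 hy)]
  have hn0 : n = 0 := by
    rcases lt_trichotomy n 0 with hlt | h0 | hgt
    · have h3 : ‖p‖ ^ (-1 : ℤ) ≤ ‖p‖ ^ n := zpow_le_zpow_right_of_le_one₀ hp' hp.le (by omega)
      rw [zpow_neg_one] at h3
      have h4 : ‖p‖⁻¹ * ‖y‖ ≤ 1 := (by gcongr : ‖p‖⁻¹ * ‖y‖ ≤ ‖p‖ ^ n * ‖y‖).trans (hn' ▸ h2')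
      rw [inv_mul_le_iff₀ hp'] at h4
      linarith
    · exact h0
    · have h3 : ‖p‖ ^ n ≤ ‖p‖ ^ (1 : ℤ) := zpow_le_zpow_right_of_le_one₀ hp' hp.le (by omega)
      rw [zpow_one] at h3
      have h4 : ‖y'‖ ≤ ‖p‖ * 1 := by rw [hn']; gcongr
      linarith
  rw [hn0, zpow_zero, div_eq_one_iff_eq hy] at hn
  exact hn.symm

/-- The interpolation identity, for parameters in the annulus `|p| < |w|² < 1`: both sides are
theta functions of degree eight which agree at nine points. -/
theorem interpolationDefect_eq_zero {p z : ℂ} {w : Fin 8 → ℂ} (hp0 : p ≠ 0) (hp : ‖p‖ < 1)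
    (hw : ∀ j, w j ≠ 0) (hprod : ∏ j, w j = p ^ 2) (hlt : ∀ j, ‖w j‖ < 1)
    (hgt : ∀ j, ‖p‖ < ‖w j‖ ^ 2) (h56 : w 5 ≠ w 6) (h57 : w 5 ≠ w 7) (h67 : w 6 ≠ w 7)
    (hz : z ≠ 0) : interpolationDefect p w z = 0 := by
  classical
  -- the nine points are `±1`, a square root `s` of `p`, the three `w_j` with `|s| < |w_j| < 1`, and
  -- their images `p / w_j`
  have hp' : 0 < ‖p‖ := norm_pos_iff.2 hp0
  obtain ⟨s, hs⟩ := IsAlgClosed.exists_pow_nat_eq p (n := 2) two_pos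
  have hs0 : s ≠ 0 := by rintro rfl; exact hp0 (by rw [← hs]; norm_num)
  have hsn : ‖s‖ ^ 2 = ‖p‖ := by rw [← norm_pow, hs]
  have hs' : 0 < ‖s‖ := norm_pos_iff.2 hs0
  have hs1 : ‖s‖ < 1 := by nlinarith
  have hps : ‖p‖ < ‖s‖ := by nlinarith
  obtain ⟨h5, h6, h7⟩ := interpolationDefect_eq_zero_at hp hw
  set B : Finset ℂ := {w 5, w 6, w 7} with hB
  have hBcard : B.card = 3 := Finset.card_eq_three.2 ⟨_, _, _, h56, h57, h67, rfl⟩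
  have hBmem : ∀ y ∈ B, ∃ j, y = w j := by
    intro y hy
    simp only [hB, Finset.mem_insert, Finset.mem_singleton] at hy
    rcases hy with h | h | h
    exacts [⟨5, h⟩, ⟨6, h⟩, ⟨7, h⟩]
  have hB0 : ∀ y ∈ B, interpolationDefect p w y = 0 := by
    intro y hy
    simp only [hB, Finset.mem_insert, Finset.mem_singleton] at hy
    rcases hy with rfl | rfl | rfl <;> assumption
  have hBn : ∀ y ∈ B, ‖s‖ < ‖y‖ ∧ ‖y‖ < 1 := by
    intro y hy
    obtain ⟨j, rfl⟩ := hBmem y hy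
    exact ⟨lt_of_pow_lt_pow_left₀ 2 (norm_nonneg _) (hsn ▸ hgt j), hlt j⟩
  set B' := B.image fun y => p * y⁻¹ with hB'
  have hB'card : B'.card = 3 := by
    rw [hB', Finset.card_image_of_injective _ (fun x y h => inv_injective (mul_left_cancel₀ hp0 h)),
      hBcard]
  have hB'n : ∀ y ∈ B', ‖p‖ < ‖y‖ ∧ ‖y‖ < ‖s‖ := by
    intro y hy
    obtain ⟨x, hx, rfl⟩ := Finset.mem_image.1 hy
    obtain ⟨hx1, hx2⟩ := hBn x hx
    have hx0 : 0 < ‖x‖ := hs'.trans hx1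
    rw [norm_mul, norm_inv, ← div_eq_mul_inv]
    refine ⟨by rw [lt_div_iff₀ hx0]; nlinarith, by rw [div_lt_iff₀ hx0]; nlinarith⟩
  set A : Finset ℂ := ({1, -1} ∪ {s}) ∪ (B ∪ B') with hA
  have hd1 : Disjoint ({1, -1} : Finset ℂ) {s} := by
    rw [Finset.disjoint_singleton_right]
    intro h
    simp only [Finset.mem_insert, Finset.mem_singleton] at h
    rcases h with rfl | rfl <;> simp at hs1
  have hd2 : Disjoint B B' := Finset.disjoint_left.2 fun y hy hy' =>
    lt_asymm (hBn y hy).1 (hB'n y hy').2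
  have hd3 : Disjoint (({1, -1} : Finset ℂ) ∪ {s}) (B ∪ B') := by
    rw [Finset.disjoint_left]
    intro y hy hy'
    have h1 : ‖y‖ = 1 ∨ ‖y‖ = ‖s‖ := by
      simp only [Finset.mem_union, Finset.mem_insert, Finset.mem_singleton] at hy
      rcases hy with (rfl | rfl) | rfl <;> simp
    rcases Finset.mem_union.1 hy' with h | h
    · rcases h1 with h1 | h1 <;> linarith [(hBn y h).1, (hBn y h).2]
    · rcases h1 with h1 | h1 <;> linarith [(hB'n y h).1, (hB'n y h).2]
  have hAcard : A.card = 9 := by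
    rw [hA, Finset.card_union_of_disjoint hd3, Finset.card_union_of_disjoint hd1,
      Finset.card_union_of_disjoint hd2, hBcard, hB'card, Finset.card_singleton,
      Finset.card_pair (by norm_num)]
  have hAn : ∀ y ∈ A, ‖p‖ < ‖y‖ ∧ ‖y‖ ≤ 1 := by
    intro y hy
    rcases Finset.mem_union.1 hy with h | h
    · simp only [Finset.mem_union, Finset.mem_insert, Finset.mem_singleton] at h
      rcases h with (rfl | rfl) | rfl
      · simpa using hp
      · simpa using hp
      · exact ⟨hps, hs1.le⟩
    · rcases Finset.mem_union.1 h with h | h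
      · exact ⟨hps.trans (hBn y h).1, (hBn y h).2.le⟩
      · exact ⟨(hB'n y h).1, (hB'n y h).2.le.trans hs1.le⟩
  have hA0 : ∀ y ∈ A, interpolationDefect p w y = 0 := by
    intro y hy
    rcases Finset.mem_union.1 hy with h | h
    · simp only [Finset.mem_union, Finset.mem_insert, Finset.mem_singleton] at h
      rcases h with (rfl | rfl) | rfl
      · simp [interpolationDefect, theta_one hp]
      · norm_num [interpolationDefect, theta_one hp]
      · have e1 : theta p (y ^ 2) = 0 := by
          have := theta_p_div p 1 hp0
          rw [hs]
          rwa [div_one, theta_one hp] at this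
        have e2 : thetaProd p w y = y ^ 4 * thetaProd p w y⁻¹ := by
          have := thetaProd_mul_p hp0 hp hw (inv_ne_zero hs0)
          rw [hprod, ← hs, show y ^ 2 * y⁻¹ = y by field_simp] at this
          rw [hs] at this
          rw [this, ← hs]
          field_simp
        rw [interpolationDefect, e1, e2]
        field_simp
        ring
    · rcases Finset.mem_union.1 h with h | h
      · exact hB0 y h
      · obtain ⟨x, hx, rfl⟩ := Finset.mem_image.1 h
        have hx0 : x ≠ 0 := norm_pos_iff.1 (hs'.trans (hBn x hx).1)
        rw [interpolationDefect_mul_p hp0 hp hw hprod (inv_ne_zero hx0),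
          interpolationDefect_inv hp hx0, hB0 x hx, mul_zero, mul_zero]
  refine eq_zero_of_zeros hp0 hp A (p ^ 3)⁻¹ _ (fun y hy =>
    (differentiableAt_interpolationDefect hp hw hy).differentiableWithinAt) ?_ ?_ ?_ z hz
  · intro y hy
    rw [hAcard, interpolationDefect_mul_p hp0 hp hw hprod hy]
    have hy' : y ≠ 0 := hy
    field_simp
  · intro y hy
    exact ⟨norm_pos_iff.1 (hp'.trans (hAn y hy).1), hA0 y hy⟩
  · intro y hy y' hy' hne h
    exact hne (eq_of_theta_div_eq_zero hp0 hp (hAn y hy).1 (hAn y hy).2 (hAn y' hy').1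
      (hAn y' hy').2 h)

/-! ### Relations between integrals over the unit circle -/

/-- The parameter `t_j` is multiplied by `q`. -/
def shift (q : ℂ) (t : Fin 8 → ℂ) (j : Fin 8) : Fin 8 → ℂ := Function.update t j (q * t j)

theorem shift_self (q : ℂ) (t : Fin 8 → ℂ) (j : Fin 8) : shift q t j j = q * t j :=
  Function.update_self ..

theorem shift_of_ne (q : ℂ) (t : Fin 8 → ℂ) {j k : Fin 8} (h : k ≠ j) : shift q t j k = t k :=
  Function.update_of_ne h ..

theorem shift_comm (q : ℂ) (t : Fin 8 → ℂ) {j k : Fin 8} (h : j ≠ k) :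
    shift q (shift q t j) k = shift q (shift q t k) j := by
  ext i
  rcases eq_or_ne i j with rfl | hij
  · rw [shift_of_ne _ _ h, shift_self, shift_self, shift_of_ne _ _ h]
  · rcases eq_or_ne i k with rfl | hik
    · rw [shift_self, shift_of_ne _ _ hij, shift_of_ne _ _ hij, shift_self]
    · rw [shift_of_ne _ _ hik, shift_of_ne _ _ hij, shift_of_ne _ _ hij, shift_of_ne _ _ hik]

theorem shift_ne_zero {q : ℂ} (hq0 : q ≠ 0) {t : Fin 8 → ℂ} (ht : ∀ j, t j ≠ 0) (i j : Fin 8) :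
    shift q t i j ≠ 0 := by
  rcases eq_or_ne j i with rfl | h
  · rw [shift_self]; exact mul_ne_zero hq0 (ht _)
  · rw [shift_of_ne _ _ h]; exact ht j

theorem norm_shift_lt {q : ℂ} (hq : ‖q‖ < 1) {t : Fin 8 → ℂ} (ht : ∀ j, ‖t j‖ < 1) (i j : Fin 8) :
    ‖shift q t i j‖ < 1 := by
  rcases eq_or_ne j i with rfl | h
  · rw [shift_self, norm_mul]
    exact mul_lt_one_of_nonneg_of_lt_one_left (norm_nonneg _) hq (ht j).le
  · rw [shift_of_ne _ _ h]; exact ht j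

theorem regKernel_shift {p q : ℂ} (hp : ‖p‖ < 1) (hq0 : q ≠ 0) (hq : ‖q‖ < 1) {t : Fin 8 → ℂ}
    {j : Fin 8} (ht : ‖t j‖ < 1) {z : ℂ} (hz : ‖z‖ = 1) :
    regKernel p q (shift q t j) z = thetaPair p (t j) z * regKernel p q t z := by
  have h1 : qPoch p (t j * z) ≠ 0 := qPoch_ne_zero_of_norm_lt hp (by rwa [norm_mul, hz, mul_one])
  have h2 : qPoch p (t j * z⁻¹) ≠ 0 :=
    qPoch_ne_zero_of_norm_lt hp (by rwa [norm_mul, norm_inv, hz, inv_one, mul_one])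
  rw [regKernel, regKernel, ← Finset.mul_prod_erase _ _ (Finset.mem_univ j),
    ← Finset.mul_prod_erase Finset.univ (fun i => ellGamma p q (t i * z) * ellGamma p q (t i * z⁻¹))
      (Finset.mem_univ j),
    Finset.prod_congr rfl (g := fun i => ellGamma p q (t i * z) * ellGamma p q (t i * z⁻¹))
      (fun i hi => by rw [shift_of_ne _ _ (Finset.ne_of_mem_erase hi)]),
    shift_self, mul_assoc q, mul_assoc q, ellGamma_mul_q hp hq0 hq h1, ellGamma_mul_q hp hq0 hq h2,
    thetaPair]
  ring

theorem V_eq_unitCircle {p q : ℂ} (hp0 : p ≠ 0) (hq0 : q ≠ 0) (hp : ‖p‖ < 1) (hq : ‖q‖ < 1)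
    {t : Fin 8 → ℂ} (ht0 : ∀ j, t j ≠ 0) (ht : ∀ j, ‖t j‖ < 1) :
    V p q t = kappa p q * ∮ z in C(0, 1), regKernel p q t z / z := by
  rw [V_eq_integral p q hp0 hq0 hp hq t ht0 ht, circleIntegral_kernel hp hq t one_ne_zero (by simp)]

theorem continuousOn_regKernel {p q : ℂ} (hp : ‖p‖ < 1) (hq : ‖q‖ < 1) {t : Fin 8 → ℂ}
    (ht0 : ∀ j, t j ≠ 0) (ht : ∀ j, ‖t j‖ < 1) :
    ContinuousOn (fun z => regKernel p q t z / z) (Metric.sphere 0 1) := by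
  intro z hz
  have hz1 : ‖z‖ = 1 := mem_sphere_zero_iff_norm.1 hz
  have hz0 : z ≠ 0 := norm_pos_iff.1 (by rw [hz1]; exact one_pos)
  have h := analyticAt_regKernel hp hq (τ := fun _ => t) (s := 0) (z := z)
    (fun j => analyticAt_const) ht0 hz0
    (Finset.prod_ne_zero_iff.2 fun j _ => pqPoch_ne_zero_of_norm_lt hp hq (by
      rw [norm_mul, norm_inv, hz1, inv_one, mul_one]; exact ht j))
    (Finset.prod_ne_zero_iff.2 fun j _ => pqPoch_ne_zero_of_norm_lt hp hq (by
      rw [norm_mul, hz1, mul_one]; exact ht j))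
  exact (ContinuousAt.comp (g := fun x : ℂ × ℂ => regKernel p q t x.2 / x.2)
    (f := fun z => ((0 : ℂ), z)) h.continuousAt (by fun_prop)).continuousWithinAt

/-- A linear combination of three `V`-functions as a single integral. -/
theorem V_linearCombination {p q : ℂ} (hp0 : p ≠ 0) (hq0 : q ≠ 0) (hp : ‖p‖ < 1) (hq : ‖q‖ < 1)
    {t₁ t₂ t₃ : Fin 8 → ℂ} (h1 : ∀ j, t₁ j ≠ 0) (h2 : ∀ j, t₂ j ≠ 0) (h3 : ∀ j, t₃ j ≠ 0)
    (h1' : ∀ j, ‖t₁ j‖ < 1) (h2' : ∀ j, ‖t₂ j‖ < 1) (h3' : ∀ j, ‖t₃ j‖ < 1) (c₁ c₂ c₃ : ℂ) :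
    c₁ * V p q t₁ + c₂ * V p q t₂ + c₃ * V p q t₃ = kappa p q * ∮ z in C(0, 1),
      (c₁ * (regKernel p q t₁ z / z) + c₂ * (regKernel p q t₂ z / z) +
        c₃ * (regKernel p q t₃ z / z)) := by
  have hi : ∀ (t : Fin 8 → ℂ) (c : ℂ), (∀ j, t j ≠ 0) → (∀ j, ‖t j‖ < 1) →
      CircleIntegrable (fun z => c * (regKernel p q t z / z)) 0 1 := fun t c h h' =>
    ((continuousOn_regKernel hp hq h h').const_smul c).circleIntegrable zero_le_one
  have h12 : CircleIntegrable (fun z => c₁ * (regKernel p q t₁ z / z) +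
      c₂ * (regKernel p q t₂ z / z)) 0 1 := (hi t₁ c₁ h1 h1').add (hi t₂ c₂ h2 h2')
  rw [circleIntegral.integral_add h12 (hi t₃ c₃ h3 h3'),
    circleIntegral.integral_add (hi t₁ c₁ h1 h1') (hi t₂ c₂ h2 h2'),
    circleIntegral.integral_const_mul, circleIntegral.integral_const_mul,
    circleIntegral.integral_const_mul, V_eq_unitCircle hp0 hq0 hp hq h1 h1',
    V_eq_unitCircle hp0 hq0 hp hq h2 h2', V_eq_unitCircle hp0 hq0 hp hq h3 h3']
  ring

/-- The contiguous relation inside the unit polydisc: the addition formula under the integral. -/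
theorem contiguous_of_norm_lt {p q : ℂ} (hp0 : p ≠ 0) (hq0 : q ≠ 0) (hp : ‖p‖ < 1) (hq : ‖q‖ < 1)
    {s : Fin 8 → ℂ} (h0 : ∀ j, s j ≠ 0) (h1 : ∀ j, ‖s j‖ < 1) :
    s 6 * thetaPair p (s 7) (s 6) * V p q (shift q s 5) -
        s 5 * thetaPair p (s 7) (s 5) * V p q (shift q s 6) =
      s 6 * thetaPair p (s 5) (s 6) * V p q (shift q s 7) := by
  have h := V_linearCombination hp0 hq0 hp hq (shift_ne_zero hq0 h0 5) (shift_ne_zero hq0 h0 6)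
    (shift_ne_zero hq0 h0 7) (norm_shift_lt hq h1 5) (norm_shift_lt hq h1 6) (norm_shift_lt hq h1 7)
    (s 6 * thetaPair p (s 7) (s 6)) (-(s 5 * thetaPair p (s 7) (s 5)))
    (-(s 6 * thetaPair p (s 5) (s 6)))
  have hzero : (∮ z in C(0, 1), (s 6 * thetaPair p (s 7) (s 6) * (regKernel p q (shift q s 5) z / z) +
      -(s 5 * thetaPair p (s 7) (s 5)) * (regKernel p q (shift q s 6) z / z) +
      -(s 6 * thetaPair p (s 5) (s 6)) * (regKernel p q (shift q s 7) z / z))) = 0 := by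
    rw [circleIntegral.integral_congr (g := fun _ => 0) zero_le_one]
    · simp [circleIntegral]
    · intro z hz
      have hz1 : ‖z‖ = 1 := mem_sphere_zero_iff_norm.1 hz
      have hz0 : z ≠ 0 := norm_pos_iff.1 (by rw [hz1]; exact one_pos)
      simp only [regKernel_shift hp hq0 hq (h1 _) hz1]
      have hadd := theta_addition hp0 hp (h0 5) (h0 6) (h0 7) hz0
      linear_combination regKernel p q s z / z * hadd
  rw [hzero, mul_zero] at h
  linear_combination h

theorem circleIntegral_div_eq (g : ℂ → ℂ) {R : ℝ} (hR : R ≠ 0) :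
    (∮ z in C(0, R), g z / z) = ∫ θ in (0)..(2 * Real.pi), Complex.I * g (circleMap 0 R θ) := by
  unfold circleIntegral
  refine intervalIntegral.integral_congr fun θ _ => ?_
  have hne : circleMap 0 R θ ≠ 0 := circleMap_ne_center hR
  simp only [deriv_circleMap, smul_eq_mul]
  field_simp

theorem circleIntegral_comp_inv (g : ℂ → ℂ) :
    (∮ z in C(0, 1), g z⁻¹ / z) = ∮ z in C(0, 1), g z / z := by
  rw [circleIntegral_div_eq (fun z => g z⁻¹) one_ne_zero, circleIntegral_div_eq g one_ne_zero]
  have e : ∀ θ : ℝ, (circleMap 0 1 θ)⁻¹ = circleMap 0 1 (-θ) := fun θ => by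
    simp [circleMap, Complex.exp_neg]
  simp only [e]
  rw [intervalIntegral.integral_comp_neg (fun θ => Complex.I * g (circleMap 0 1 θ)), neg_zero]
  have hper : Function.Periodic (fun θ => Complex.I * g (circleMap 0 1 θ)) (2 * Real.pi) :=
    fun θ => by simp only [periodic_circleMap 0 1 θ]
  have := hper.intervalIntegral_add_eq (-(2 * Real.pi)) 0
  simpa using this

theorem circleIntegral_comp_inv_mul (g : ℂ → ℂ) {q : ℂ} (hq0 : q ≠ 0) :
    (∮ z in C(0, 1), g (q⁻¹ * z) / z) = ∮ z in C(0, ‖q‖⁻¹), g z / z := by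
  have hqn : ‖q‖⁻¹ ≠ 0 := inv_ne_zero (norm_ne_zero_iff.2 hq0)
  rw [circleIntegral_div_eq (fun z => g (q⁻¹ * z)) one_ne_zero, circleIntegral_div_eq g hqn]
  have e : ∀ θ : ℝ, q⁻¹ * circleMap 0 1 θ = circleMap 0 ‖q‖⁻¹ (θ + (q⁻¹).arg) := fun θ => by
    conv_lhs => rw [← Complex.norm_mul_exp_arg_mul_I q⁻¹]
    simp only [circleMap, norm_inv, zero_add, Complex.ofReal_one, one_mul, Complex.ofReal_add,
      add_mul, Complex.exp_add, Complex.ofReal_inv]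
    ring
  simp only [e]
  rw [intervalIntegral.integral_comp_add_right (fun θ => Complex.I * g (circleMap 0 ‖q‖⁻¹ θ))]
  have hper : Function.Periodic (fun θ => Complex.I * g (circleMap 0 ‖q‖⁻¹ θ)) (2 * Real.pi) :=
    fun θ => by simp only [periodic_circleMap 0 ‖q‖⁻¹ θ]
  have := hper.intervalIntegral_add_eq (0 + (q⁻¹).arg) 0
  rw [zero_add] at this ⊢
  rw [zero_add] at this
  rw [← this, add_comm]

/-- The integrand `∏_{j=1}^8 Γ(q w_j z, w_j z⁻¹; p, q) θ(z⁻²; q) z⁻¹`, which changes sign under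
`z ↦ 1 / z` followed by a `q`-shift. -/
def antisymKernel (p q : ℂ) (w : Fin 8 → ℂ) (z : ℂ) : ℂ :=
  (∏ j, ellGamma p q (q * (w j * z)) * ellGamma p q (w j * z⁻¹)) * (theta q (z ^ 2)⁻¹ * z⁻¹)

theorem antisymKernel_inv_mul {p q : ℂ} (hq0 : q ≠ 0) (hq : ‖q‖ < 1) (w : Fin 8 → ℂ) {z : ℂ}
    (hz : z ≠ 0) : antisymKernel p q w (q⁻¹ * z) = -antisymKernel p q w z⁻¹ := by
  have hz2 : (z ^ 2)⁻¹ ≠ 0 := inv_ne_zero (pow_ne_zero 2 hz)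
  have e1 : theta q ((q⁻¹ * z) ^ 2)⁻¹ = -(q⁻¹ * z ^ 2) * theta q (z ^ 2) := by
    rw [show ((q⁻¹ * z) ^ 2)⁻¹ = q * (q * (z ^ 2)⁻¹) by field_simp,
      theta_mul_p hq0 hq (mul_ne_zero hq0 hz2), theta_mul_p hq0 hq hz2,
      theta_inv hq (pow_ne_zero 2 hz)]
    field_simp
  have e2 : ∀ j, q * (w j * (q⁻¹ * z)) = w j * z := fun j => by field_simp
  have e3 : ∀ j, w j * (q⁻¹ * z)⁻¹ = q * (w j * z⁻¹) := fun j => by field_simp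
  rw [antisymKernel, antisymKernel, e1, inv_pow, inv_inv]
  simp only [e2, e3, inv_inv]
  rw [Finset.prod_congr rfl fun j _ => mul_comm (ellGamma p q (w j * z)) _]
  generalize (∏ j, ellGamma p q (q * (w j * z⁻¹)) * ellGamma p q (w j * z)) = g
  field_simp

theorem differentiableAt_antisymKernel {p q : ℂ} (hp : ‖p‖ < 1) (hq0 : q ≠ 0) (hq : ‖q‖ < 1)
    {w : Fin 8 → ℂ} (h0 : ∀ j, w j ≠ 0) (h1 : ∀ j, ‖w j‖ < 1) {z : ℂ} (hz1 : 1 ≤ ‖z‖)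
    (hzq : ‖z‖ ≤ ‖q‖⁻¹) : DifferentiableAt ℂ (fun z => antisymKernel p q w z / z) z := by
  have hz0 : z ≠ 0 := norm_pos_iff.1 (one_pos.trans_le hz1)
  have hqn : 0 < ‖q‖ := norm_pos_iff.2 hq0
  have hΓ : ∀ (f : ℂ → ℂ), DifferentiableAt ℂ f z → f z ≠ 0 → ‖f z‖ < 1 →
      DifferentiableAt ℂ (fun z => ellGamma p q (f z)) z := fun f hf hf0 hf1 =>
    (analyticAt_ellGamma hp hq hf0 (pqPoch_ne_zero_of_norm_lt hp hq hf1)).differentiableAt.comp z hf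
  refine DifferentiableAt.fun_div (DifferentiableAt.mul (DifferentiableAt.fun_finsetProd fun j _ =>
    DifferentiableAt.mul ?_ ?_) (DifferentiableAt.mul ?_ (differentiableAt_inv hz0)))
    differentiableAt_id hz0
  · refine hΓ (fun z => q * (w j * z)) (by fun_prop) (mul_ne_zero hq0 (mul_ne_zero (h0 j) hz0)) ?_
    have hqz : ‖q‖ * ‖z‖ ≤ 1 := by
      calc ‖q‖ * ‖z‖ ≤ ‖q‖ * ‖q‖⁻¹ := by gcongr
        _ = 1 := mul_inv_cancel₀ hqn.ne'
    rw [norm_mul, norm_mul, mul_left_comm]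
    exact (mul_le_of_le_one_right (norm_nonneg _) hqz).trans_lt (h1 j)
  · refine hΓ (fun z => w j * z⁻¹) (by fun_prop (disch := exact hz0))
      (mul_ne_zero (h0 j) (inv_ne_zero hz0)) ?_
    rw [norm_mul, norm_inv]
    exact (mul_le_of_le_one_right (norm_nonneg _) (inv_le_one_of_one_le₀ hz1)).trans_lt (h1 j)
  · exact differentiableAt_theta_comp hq (by fun_prop (disch := exact pow_ne_zero 2 hz0))
      (inv_ne_zero (pow_ne_zero 2 hz0))

/-- By the symmetry of the integrand, the integral over `|z| = 1 / |q|` is minus the integral over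
the unit circle; as there are no poles in between, both vanish. -/
theorem circleIntegral_antisymKernel {p q : ℂ} (hp : ‖p‖ < 1) (hq0 : q ≠ 0) (hq : ‖q‖ < 1)
    {w : Fin 8 → ℂ} (h0 : ∀ j, w j ≠ 0) (h1 : ∀ j, ‖w j‖ < 1) :
    (∮ z in C(0, 1), antisymKernel p q w z / z) = 0 := by
  have hqn : 0 < ‖q‖ := norm_pos_iff.2 hq0
  have hle : 1 ≤ ‖q‖⁻¹ := (one_le_inv₀ hqn).2 hq.le
  have e1 : (∮ z in C(0, ‖q‖⁻¹), antisymKernel p q w z / z) =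
      ∮ z in C(0, 1), antisymKernel p q w z / z := by
    refine Complex.circleIntegral_eq_of_differentiable_on_annulus_off_countable one_pos hle
      Set.countable_empty (fun z hz => ?_) (fun z hz => ?_)
    · simp only [Set.mem_sdiff, mem_closedBall_zero_iff, mem_ball_zero_iff, not_lt] at hz
      exact (differentiableAt_antisymKernel hp hq0 hq h0 h1 hz.2
        hz.1).continuousAt.continuousWithinAt
    · simp only [Set.mem_sdiff, mem_closedBall_zero_iff, mem_ball_zero_iff, not_le] at hz
      exact differentiableAt_antisymKernel hp hq0 hq h0 h1 hz.1.2.le hz.1.1.le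
  have e2 : (∮ z in C(0, 1), antisymKernel p q w (q⁻¹ * z) / z) =
      -∮ z in C(0, 1), antisymKernel p q w z⁻¹ / z := by
    rw [← neg_one_mul, ← circleIntegral.integral_const_mul]
    refine circleIntegral.integral_congr zero_le_one fun z hz => ?_
    have hz0 : z ≠ 0 := norm_pos_iff.1 (by rw [mem_sphere_zero_iff_norm.1 hz]; exact one_pos)
    simp only [antisymKernel_inv_mul hq0 hq w hz0]
    ring
  rw [circleIntegral_comp_inv_mul _ hq0, e1, circleIntegral_comp_inv] at e2
  linear_combination (1 / 2) * e2

theorem theta_mul_antisymKernel {p q : ℂ} (hp : ‖p‖ < 1) (hq0 : q ≠ 0) (hq : ‖q‖ < 1)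
    {w : Fin 8 → ℂ} (h1 : ∀ j, ‖w j‖ < 1) {z : ℂ} (hz : ‖z‖ = 1) :
    theta p (z ^ 2) * (antisymKernel p q w z + antisymKernel p q w z⁻¹) =
      (z⁻¹ * thetaProd p w z - z ^ 3 * thetaProd p w z⁻¹) * regKernel p q w z := by
  have hz0 : z ≠ 0 := norm_pos_iff.1 (by rw [hz]; exact one_pos)
  have e1 : ∀ j, ellGamma p q (q * (w j * z)) = theta p (w j * z) * ellGamma p q (w j * z) :=
    fun j => ellGamma_mul_q hp hq0 hq
      (qPoch_ne_zero_of_norm_lt hp (by rw [norm_mul, hz, mul_one]; exact h1 j))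
  have e2 : ∀ j, ellGamma p q (q * (w j * z⁻¹)) = theta p (w j * z⁻¹) * ellGamma p q (w j * z⁻¹) :=
    fun j => ellGamma_mul_q hp hq0 hq
      (qPoch_ne_zero_of_norm_lt hp (by rw [norm_mul, norm_inv, hz, inv_one, mul_one]; exact h1 j))
  simp only [antisymKernel, regKernel, thetaProd, e1, e2, inv_inv, inv_pow,
    theta_inv hq (pow_ne_zero 2 hz0), Finset.prod_mul_distrib]
  field_simp
  ring

/-- A three-term relation inside the unit polydisc: the interpolation identity turns the
combination of kernels into the symmetrization of an integrand with vanishing integral. -/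
theorem secondContiguous_of_norm_lt {p q : ℂ} (hp0 : p ≠ 0) (hq0 : q ≠ 0) (hp : ‖p‖ < 1)
    (hq : ‖q‖ < 1) {w : Fin 8 → ℂ} (h0 : ∀ j, w j ≠ 0) (hprod : ∏ j, w j = p ^ 2)
    (h1 : ∀ j, ‖w j‖ < 1) (hgt : ∀ j, ‖p‖ < ‖w j‖ ^ 2) (h56 : w 5 ≠ w 6) (h57 : w 5 ≠ w 7)
    (h67 : w 6 ≠ w 7) :
    thetaProd₅ p w (w 7) * theta p (w 5 * (w 6)⁻¹) * V p q (shift q (shift q w 5) 6) -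
        thetaProd₅ p w (w 6) * theta p (w 5 * (w 7)⁻¹) * V p q (shift q (shift q w 5) 7) +
      w 5 / w 6 * thetaProd₅ p w (w 5) * theta p (w 6 * (w 7)⁻¹) *
        V p q (shift q (shift q w 6) 7) = 0 := by
  have hs0 := fun i => shift_ne_zero hq0 h0 i
  have hs1 := fun i => norm_shift_lt hq h1 i
  have h := V_linearCombination hp0 hq0 hp hq (shift_ne_zero hq0 (hs0 5) 6)
    (shift_ne_zero hq0 (hs0 5) 7) (shift_ne_zero hq0 (hs0 6) 7) (norm_shift_lt hq (hs1 5) 6)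
    (norm_shift_lt hq (hs1 5) 7) (norm_shift_lt hq (hs1 6) 7)
    (thetaProd₅ p w (w 7) * theta p (w 5 * (w 6)⁻¹))
    (-(thetaProd₅ p w (w 6) * theta p (w 5 * (w 7)⁻¹)))
    (w 5 / w 6 * thetaProd₅ p w (w 5) * theta p (w 6 * (w 7)⁻¹))
  set c : ℂ := w 7 * theta p (w 5 * (w 7)⁻¹) * theta p (w 6 * (w 7)⁻¹) * theta p (w 5 * (w 6)⁻¹)
    with hc
  have hd : ∀ z ∈ Metric.sphere (0 : ℂ) 1,
      ContinuousAt (fun z => antisymKernel p q w z / z) z := fun z hz => by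
    have hz1 : ‖z‖ = 1 := mem_sphere_zero_iff_norm.1 hz
    refine (differentiableAt_antisymKernel hp hq0 hq h0 h1 hz1.ge ?_).continuousAt
    rw [hz1]
    exact (one_le_inv₀ (norm_pos_iff.2 hq0)).2 hq.le
  have hi1 : CircleIntegrable (fun z => antisymKernel p q w z / z) 0 1 :=
    ContinuousOn.circleIntegrable zero_le_one fun z hz => (hd z hz).continuousWithinAt
  have hi2 : CircleIntegrable (fun z => antisymKernel p q w z⁻¹ / z) 0 1 := by
    refine ContinuousOn.circleIntegrable zero_le_one fun z hz =>
      ContinuousAt.continuousWithinAt ?_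
    have hz1 : ‖z‖ = 1 := mem_sphere_zero_iff_norm.1 hz
    have hz0 : z ≠ 0 := norm_pos_iff.1 (by rw [hz1]; exact one_pos)
    have hzi : z⁻¹ ∈ Metric.sphere (0 : ℂ) 1 := by simp [hz1]
    have h2 : ContinuousAt (fun z => antisymKernel p q w z⁻¹ / z⁻¹ * (z⁻¹ / z)) z :=
      (ContinuousAt.comp (g := fun z => antisymKernel p q w z / z) (f := fun z : ℂ => z⁻¹) (hd _ hzi)
        (continuousAt_inv₀ hz0)).mul ((continuousAt_inv₀ hz0).div continuousAt_id hz0)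
    refine h2.congr ?_
    filter_upwards [isOpen_compl_singleton.mem_nhds (show z ∈ ({0}ᶜ : Set ℂ) from hz0)] with y hy
    have hy0 : y ≠ 0 := hy
    field_simp
  have hzero : (∮ z in C(0, 1), (c * (antisymKernel p q w z / z + antisymKernel p q w z⁻¹ / z))) =
      0 := by
    rw [circleIntegral.integral_const_mul, circleIntegral.integral_add hi1 hi2,
      circleIntegral_comp_inv, circleIntegral_antisymKernel hp hq0 hq h0 h1, add_zero, mul_zero]
  rw [circleIntegral.circleIntegral_congr_codiscreteWithin (f₂ := fun z =>
    c * (antisymKernel p q w z / z + antisymKernel p q w z⁻¹ / z)) ?_ one_ne_zero, hzero,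
    mul_zero] at h
  · linear_combination h
  · -- the factor `θ(z²; p)` may be cancelled except at `z = ±1`
    have hfin : ({1, -1} : Set ℂ).Finite := Set.toFinite _
    filter_upwards [compl_finite_mem_codiscreteWithin hfin,
      self_mem_codiscreteWithin (Metric.sphere (0 : ℂ) |1|)] with z hz hzs
    rw [abs_one] at hzs
    have hz1 : ‖z‖ = 1 := mem_sphere_zero_iff_norm.1 hzs
    have hz0 : z ≠ 0 := norm_pos_iff.1 (by rw [hz1]; exact one_pos)
    have hθ : theta p (z ^ 2) ≠ 0 := by
      intro h
      rw [← div_one (z ^ 2)] at h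
      have := eq_of_theta_div_eq_zero hp0 hp (y := 1) (y' := z ^ 2) (by simpa using hp) (by simp)
        (by simpa [hz1] using hp) (by simp [hz1]) h
      exact hz (mul_self_eq_one_iff.1 ((pow_two z).symm.trans this.symm))
    have hS := interpolationDefect_eq_zero hp0 hp h0 hprod h1 hgt h56 h57 h67 hz0
    have hA := theta_mul_antisymKernel hp hq0 hq h1 hz1
    simp only [regKernel_shift hp hq0 hq (hs1 _ _) hz1, regKernel_shift hp hq0 hq (h1 _) hz1,
      shift_of_ne q w (show (6 : Fin 8) ≠ 5 by decide),
      shift_of_ne q w (show (7 : Fin 8) ≠ 5 by decide),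
      shift_of_ne q w (show (7 : Fin 8) ≠ 6 by decide)]
    rw [interpolationDefect, ← hc] at hS
    apply mul_left_cancel₀ hθ
    linear_combination regKernel p q w z / z * hS - c / z * hA

/-! ### Analytic continuation in the parameters -/

theorem countable_zeros {f : ℂ → ℂ} (hf : Differentiable ℂ f) {x : ℂ} (hx : f x ≠ 0) :
    {z | f z = 0}.Countable := by
  have han : AnalyticOnNhd ℂ f Set.univ := fun z _ => hf.analyticAt z
  have hcod := han.preimage_zero_mem_codiscrete hx
  have hfin : ∀ n : ℕ, (Metric.closedBall (0 : ℂ) n \ f ⁻¹' {0}ᶜ).Finite := fun n =>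
    (isCompact_closedBall _ _).finite_sdiff_of_mem_codiscreteWithin
      (codiscreteWithin_mono (Set.subset_univ _) hcod)
  refine (Set.countable_iUnion fun n => (hfin n).countable).mono fun z hz => ?_
  obtain ⟨n, hn⟩ := exists_nat_ge ‖z‖
  exact Set.mem_iUnion.2 ⟨n, mem_closedBall_zero_iff.2 hn, fun h => h hz⟩

/-- The identity theorem on the complement of the zero set of an entire function. -/
theorem eq_zero_of_analyticAt_off_zeros {D Φ : ℂ → ℂ} (hD : Differentiable ℂ D)
    (hΦ : ∀ s, D s ≠ 0 → AnalyticAt ℂ Φ s) {s₀ s₁ : ℂ} (h0 : ∀ᶠ s in 𝓝[≠] s₀, D s ≠ 0 → Φ s = 0)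
    (h1 : D s₁ ≠ 0) : Φ s₁ = 0 := by
  have hconn : IsPreconnected {s | D s = 0}ᶜ :=
    ((countable_zeros hD h1).isPathConnected_compl_of_one_lt_rank (by simp)).isConnected.isPreconnected
  have hne : ∀ᶠ s in 𝓝[≠] s₀, D s ≠ 0 := by
    rcases (hD.analyticAt s₀).eventually_eq_zero_or_eventually_ne_zero with h | h
    · have han : AnalyticOnNhd ℂ D Set.univ := fun z _ => hD.analyticAt z
      exact (h1 (han.eqOn_zero_of_preconnected_of_eventuallyEq_zero isPreconnected_univ
        (Set.mem_univ s₀) h (Set.mem_univ s₁))).elim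
    · exact h
  obtain ⟨s₂, hs₂, hs₂D, hs₂ne⟩ := ((eventually_eventually_nhdsWithin.2 (h0.and hne)).and
    (hne.and self_mem_nhdsWithin)).exists
  rw [(isOpen_compl_singleton.nhdsWithin_eq hs₂ne)] at hs₂
  have han : AnalyticOnNhd ℂ Φ {s | D s = 0}ᶜ := fun s hs => hΦ s hs
  refine han.eqOn_zero_of_preconnected_of_eventuallyEq_zero hconn (z₀ := s₂) hs₂D ?_ h1
  filter_upwards [hs₂] with s hs using hs.1 hs.2

/-- A path in the parameter space: `w_j(s) = exp(m + s (l_j - m))` with `m` the mean of the `l_j`,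
so that the product of the parameters is constant and all of them agree at `s = 0`. -/
def expPath (l : Fin 8 → ℂ) (s : ℂ) (j : Fin 8) : ℂ :=
  Complex.exp ((∑ k, l k) / 8 + s * (l j - (∑ k, l k) / 8))

theorem prod_expPath (l : Fin 8 → ℂ) (s : ℂ) : ∏ j, expPath l s j = Complex.exp (∑ k, l k) := by
  simp only [expPath, ← Complex.exp_sum, Finset.sum_add_distrib, ← Finset.mul_sum,
    Finset.sum_sub_distrib, Finset.sum_const, Finset.card_univ, Fintype.card_fin, nsmul_eq_mul]
  congr 1
  push_cast
  ring

/-- A relation between analytic functions of parameters with fixed product `c`, `|c| < 1`, holds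
wherever the functions are analytic if it holds for parameters close to the torus
`|w_j| = |c|^{1/8}`. -/
theorem eq_zero_of_eq_zero_near_torus {c : ℂ} (hc1 : ‖c‖ < 1)
    {D Φ : (Fin 8 → ℂ) → ℂ} (hD : ∀ l : Fin 8 → ℂ, Differentiable ℂ fun s => D (expPath l s))
    (hΦ : ∀ (l : Fin 8 → ℂ) (s : ℂ), D (expPath l s) ≠ 0 →
      AnalyticAt ℂ (fun s => Φ (expPath l s)) s)
    (h0 : ∀ w : Fin 8 → ℂ, (∀ j, w j ≠ 0) → ∏ j, w j = c → (∀ j, ‖w j‖ < 1) →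
      (∀ j, ‖c‖ < ‖w j‖ ^ 4) → (∀ j k, j ≠ k → w j ≠ w k) → Φ w = 0)
    {w : Fin 8 → ℂ} (hw0 : ∀ j, w j ≠ 0) (hw : ∏ j, w j = c) (hDw : D w ≠ 0) : Φ w = 0 := by
  -- the logarithms are chosen distinct, by taking different branches
  set l : Fin 8 → ℂ := fun j => Complex.log (w j) + (j : ℕ) * (2 * Real.pi * Complex.I) with hl
  have hexp : ∀ j, Complex.exp (l j) = w j := fun j => by
    rw [hl, Complex.exp_add, Complex.exp_log (hw0 j), Complex.exp_nat_mul_two_pi_mul_I, mul_one]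
  have hlne : ∀ j k, j ≠ k → l j ≠ l k := by
    intro j k hjk h
    have h2 := congrArg Complex.im h
    have him : ∀ j, (l j).im = (w j).arg + (j : ℕ) * (2 * Real.pi) := fun j => by
      simp [hl, Complex.log_im]
    rw [him, him] at h2
    have h3 := Complex.neg_pi_lt_arg (w j)
    have h4 := Complex.arg_le_pi (w j)
    have h5 := Complex.neg_pi_lt_arg (w k)
    have h6 := Complex.arg_le_pi (w k)
    have hpi := Real.pi_pos
    rcases lt_or_gt_of_ne hjk with hlt | hlt
    · have : ((j : ℕ) : ℝ) + 1 ≤ (k : ℕ) := by exact_mod_cast hlt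
      nlinarith
    · have : ((k : ℕ) : ℝ) + 1 ≤ (j : ℕ) := by exact_mod_cast hlt
      nlinarith
  have hpath1 : expPath l 1 = w := by
    ext j
    rw [expPath, one_mul, add_sub_cancel, hexp]
  have hsum : Complex.exp (∑ k, l k) = c := by
    rw [Complex.exp_sum, ← hw]
    exact Finset.prod_congr rfl fun j _ => hexp j
  set m : ℂ := (∑ k, l k) / 8 with hm
  have hm8 : Complex.exp m ^ 8 = c := by
    rw [← Complex.exp_nat_mul, ← hsum, hm]
    congr 1
    push_cast
    ring
  have hmn : ‖Complex.exp m‖ ^ 8 = ‖c‖ := by rw [← norm_pow, hm8]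
  have hmpos : 0 < ‖Complex.exp m‖ := norm_pos_iff.2 (Complex.exp_ne_zero m)
  have hm1 : ‖Complex.exp m‖ < 1 := by
    by_contra! h
    exact absurd hc1 (not_lt.2 (hmn ▸ one_le_pow₀ h))
  have hm2 : ‖c‖ < ‖Complex.exp m‖ ^ 4 := by
    rw [← hmn]
    exact pow_lt_pow_right_of_lt_one₀ hmpos hm1 (by norm_num)
  have hcont : ∀ j, Continuous fun s => ‖expPath l s j‖ := fun j => by
    unfold expPath
    fun_prop
  have hzero : ∀ j, expPath l 0 j = Complex.exp m := fun j => by simp [expPath, hm]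
  rw [← hpath1]
  refine eq_zero_of_analyticAt_off_zeros (D := fun s => D (expPath l s))
    (Φ := fun s => Φ (expPath l s)) (hD l) (hΦ l) (s₀ := 0) ?_ (hpath1.symm ▸ hDw)
  have e1 : ∀ᶠ s in 𝓝[≠] (0 : ℂ), ∀ j, ‖expPath l s j‖ < 1 := by
    refine nhdsWithin_le_nhds (Filter.eventually_all.2 fun j => ?_)
    exact (hcont j).continuousAt.eventually (gt_mem_nhds (by simpa only [hzero] using hm1))
  have e2 : ∀ᶠ s in 𝓝[≠] (0 : ℂ), ∀ j, ‖c‖ < ‖expPath l s j‖ ^ 4 := by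
    refine nhdsWithin_le_nhds (Filter.eventually_all.2 fun j => ?_)
    have hc4 : Continuous fun s => ‖expPath l s j‖ ^ 4 := (hcont j).fun_pow 4
    exact hc4.continuousAt.eventually (lt_mem_nhds (by simpa only [hzero] using hm2))
  have e3 : ∀ᶠ s in 𝓝[≠] (0 : ℂ), ∀ j k, j ≠ k → expPath l s j ≠ expPath l s k := by
    refine Filter.eventually_all.2 fun j => Filter.eventually_all.2 fun k => ?_
    rcases eq_or_ne j k with rfl | hjk
    · exact Eventually.of_forall fun _ h => (h rfl).elim
    have hd : HasDerivAt (fun s => expPath l s j - expPath l s k)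
        (Complex.exp m * (l j - l k)) 0 := by
      have h1 : ∀ j, HasDerivAt (fun s => expPath l s j) (Complex.exp m * (l j - m)) 0 := fun j => by
        have h2 := (((hasDerivAt_id (0 : ℂ)).mul_const (l j - m)).const_add m).cexp
        simpa [expPath, ← hm] using h2
      exact ((h1 j).sub (h1 k)).congr_deriv (by ring)
    filter_upwards [hd.eventually_ne (c := 0)
      (mul_ne_zero (Complex.exp_ne_zero _) (sub_ne_zero.2 (hlne j k hjk)))] with s hs _
    exact sub_ne_zero.1 hs
  filter_upwards [e1, e2, e3] with s h1 h2 h3 _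
  exact h0 _ (fun j => Complex.exp_ne_zero _) ((prod_expPath l s).trans hsum) h1 h2 h3

/-! ### The relations for all unpinched parameters -/

/-- The product `∏_{j,k} (t_j t_k; p, q)_∞`, which vanishes exactly at the pinched parameters. -/
def pinchProd (p q : ℂ) (t : Fin 8 → ℂ) : ℂ := ∏ j, ∏ k, pqPoch p q (t j * t k)

theorem differentiable_expPath (l : Fin 8 → ℂ) (j : Fin 8) :
    Differentiable ℂ fun s => expPath l s j := by
  unfold expPath
  fun_prop

theorem differentiable_shift {q : ℂ} {τ : ℂ → Fin 8 → ℂ}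
    (hτ : ∀ j, Differentiable ℂ fun s => τ s j) (i j : Fin 8) :
    Differentiable ℂ fun s => shift q (τ s) i j := by
  rcases eq_or_ne j i with rfl | h
  · simp only [shift_self]
    exact (hτ j).const_mul q
  · simp only [shift_of_ne _ _ h]
    exact hτ j

theorem differentiable_pinchProd {p q : ℂ} (hp : ‖p‖ < 1) (hq : ‖q‖ < 1) {τ : ℂ → Fin 8 → ℂ}
    (hτ : ∀ j, Differentiable ℂ fun s => τ s j) :
    Differentiable ℂ fun s => pinchProd p q (τ s) := by
  unfold pinchProd
  exact Differentiable.fun_finsetProd fun j _ => Differentiable.fun_finsetProd fun k _ =>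
    (differentiable_pqPoch hp hq).comp ((hτ j).mul (hτ k))

theorem analyticAt_V_of_pinchProd {p q : ℂ} (hp0 : p ≠ 0) (hq0 : q ≠ 0) (hp : ‖p‖ < 1)
    (hq : ‖q‖ < 1) {τ : ℂ → Fin 8 → ℂ} {s : ℂ} (hτ : ∀ j, Differentiable ℂ fun s => τ s j)
    (h0 : ∀ j, τ s j ≠ 0) (hD : pinchProd p q (τ s) ≠ 0) :
    AnalyticAt ℂ (fun s => V p q (τ s)) s :=
  analyticAt_V hp0 hq0 hp hq (fun j => (hτ j).analyticAt s) h0 ((unpinched_iff hp hq).2 hD)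

theorem analyticAt_theta_comp {p : ℂ} (hp : ‖p‖ < 1) {f : ℂ → ℂ} {s : ℂ} (hf : AnalyticAt ℂ f s)
    (h0 : f s ≠ 0) : AnalyticAt ℂ (fun s => theta p (f s)) s :=
  (analyticAt_theta hp h0).fun_comp hf

theorem analyticAt_thetaPair {p : ℂ} (hp : ‖p‖ < 1) {f g : ℂ → ℂ} {s : ℂ} (hf : AnalyticAt ℂ f s)
    (hg : AnalyticAt ℂ g s) (hf0 : f s ≠ 0) (hg0 : g s ≠ 0) :
    AnalyticAt ℂ (fun s => thetaPair p (f s) (g s)) s :=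
  (analyticAt_theta_comp hp (hf.fun_mul hg) (mul_ne_zero hf0 hg0)).fun_mul
    (analyticAt_theta_comp hp (hf.fun_mul (hg.fun_inv hg0)) (mul_ne_zero hf0 (inv_ne_zero hg0)))

theorem analyticAt_thetaProd₅ {p : ℂ} (hp : ‖p‖ < 1) (l : Fin 8 → ℂ) (j : Fin 8) (s : ℂ) :
    AnalyticAt ℂ (fun s => thetaProd₅ p (expPath l s) (expPath l s j)) s := by
  unfold thetaProd₅
  exact Finset.analyticAt_fun_prod _ fun k _ => analyticAt_theta_comp hp
    (((differentiable_expPath l _).analyticAt s).fun_mul ((differentiable_expPath l _).analyticAt s))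
    (mul_ne_zero (Complex.exp_ne_zero _) (Complex.exp_ne_zero _))

/-- The contiguous relation, in terms of parameters of which one at a time is multiplied by `q`. -/
theorem contiguous_shift {p q : ℂ} (hp0 : p ≠ 0) (hq0 : q ≠ 0) (hp : ‖p‖ < 1) (hq : ‖q‖ < 1)
    {s : Fin 8 → ℂ} (h0 : ∀ j, s j ≠ 0) (hprod : ∏ j, s j = p ^ 2 * q)
    (h5 : Unpinched p q (shift q s 5)) (h6 : Unpinched p q (shift q s 6))
    (h7 : Unpinched p q (shift q s 7)) :
    s 6 * thetaPair p (s 7) (s 6) * V p q (shift q s 5) -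
        s 5 * thetaPair p (s 7) (s 5) * V p q (shift q s 6) =
      s 6 * thetaPair p (s 5) (s 6) * V p q (shift q s 7) := by
  rw [← sub_eq_zero]
  have hc : ‖p ^ 2 * q‖ < 1 := by
    rw [norm_mul, norm_pow]
    exact mul_lt_one_of_nonneg_of_lt_one_right (pow_le_one₀ (norm_nonneg _) hp.le) (norm_nonneg _) hq
  refine eq_zero_of_eq_zero_near_torus hc
    (D := fun s => pinchProd p q (shift q s 5) * pinchProd p q (shift q s 6) *
      pinchProd p q (shift q s 7))
    (Φ := fun s => s 6 * thetaPair p (s 7) (s 6) * V p q (shift q s 5) -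
        s 5 * thetaPair p (s 7) (s 5) * V p q (shift q s 6) -
      s 6 * thetaPair p (s 5) (s 6) * V p q (shift q s 7)) ?_ ?_ ?_ h0 hprod ?_
  · intro l
    have hd := fun i => differentiable_pinchProd hp hq
      (differentiable_shift (q := q) (differentiable_expPath l) i)
    exact ((hd 5).mul (hd 6)).mul (hd 7)
  · intro l s hD
    have hne : ∀ j, expPath l s j ≠ 0 := fun j => Complex.exp_ne_zero _
    have ha := fun j => (differentiable_expPath l j).analyticAt s
    have hV := fun i (h : pinchProd p q (shift q (expPath l s) i) ≠ 0) =>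
      analyticAt_V_of_pinchProd hp0 hq0 hp hq
        (differentiable_shift (q := q) (differentiable_expPath l) i) (shift_ne_zero hq0 hne i) h
    have hP := fun i j => analyticAt_thetaPair hp (ha i) (ha j) (hne i) (hne j)
    have hD7 := right_ne_zero_of_mul hD
    have hD6 := right_ne_zero_of_mul (left_ne_zero_of_mul hD)
    have hD5 := left_ne_zero_of_mul (left_ne_zero_of_mul hD)
    exact ((((ha 6).fun_mul (hP 7 6)).fun_mul (hV 5 hD5)).fun_sub
      (((ha 5).fun_mul (hP 7 5)).fun_mul (hV 6 hD6))).fun_sub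
      (((ha 6).fun_mul (hP 5 6)).fun_mul (hV 7 hD7))
  · intro w hw0 _ hw1 _ _
    exact sub_eq_zero.2 (contiguous_of_norm_lt hp0 hq0 hp hq hw0 hw1)
  · exact mul_ne_zero (mul_ne_zero ((unpinched_iff hp hq).1 h5) ((unpinched_iff hp hq).1 h6))
      ((unpinched_iff hp hq).1 h7)

/-- The three-term relation behind the elliptic hypergeometric equation: all factors except the
functions `V` are theta functions, and no denominator can vanish. -/
theorem threeTerm_shift {p q : ℂ} (hp0 : p ≠ 0) (hq0 : q ≠ 0) (hp : ‖p‖ < 1) (hq : ‖q‖ < 1)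
    {w : Fin 8 → ℂ} (h0 : ∀ j, w j ≠ 0) (hprod : ∏ j, w j = p ^ 2)
    (h56 : Unpinched p q (shift q (shift q w 5) 6)) (h55 : Unpinched p q (shift q (shift q w 5) 5))
    (h66 : Unpinched p q (shift q (shift q w 6) 6)) :
    thetaProd₅ p w (w 7) * theta p (w 5 * (w 6)⁻¹) * theta p (q * w 5 * w 6) *
          theta p (q * w 5 * (w 6)⁻¹) * theta p (q * w 6 * (w 5)⁻¹) *
          V p q (shift q (shift q w 5) 6) -
        thetaProd₅ p w (w 6) * theta p (w 5 * (w 7)⁻¹) * theta p (q * w 6 * (w 5)⁻¹) *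
          (thetaPair p (w 7) (w 6) * V p q (shift q (shift q w 5) 5) -
            q * w 5 / w 6 * thetaPair p (w 7) (q * w 5) * V p q (shift q (shift q w 5) 6)) +
      w 5 / w 6 * thetaProd₅ p w (w 5) * theta p (w 6 * (w 7)⁻¹) * theta p (q * w 5 * (w 6)⁻¹) *
        (thetaPair p (w 7) (w 5) * V p q (shift q (shift q w 6) 6) -
          q * w 6 / w 5 * thetaPair p (w 7) (q * w 6) * V p q (shift q (shift q w 5) 6)) = 0 := by
  have hc : ‖p ^ 2‖ < 1 := by
    rw [norm_pow]
    exact pow_lt_one₀ (norm_nonneg _) hp two_ne_zero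
  refine eq_zero_of_eq_zero_near_torus hc
    (D := fun w => pinchProd p q (shift q (shift q w 5) 6) *
      pinchProd p q (shift q (shift q w 5) 5) * pinchProd p q (shift q (shift q w 6) 6))
    (Φ := fun w => thetaProd₅ p w (w 7) * theta p (w 5 * (w 6)⁻¹) * theta p (q * w 5 * w 6) *
          theta p (q * w 5 * (w 6)⁻¹) * theta p (q * w 6 * (w 5)⁻¹) *
          V p q (shift q (shift q w 5) 6) -
        thetaProd₅ p w (w 6) * theta p (w 5 * (w 7)⁻¹) * theta p (q * w 6 * (w 5)⁻¹) *
          (thetaPair p (w 7) (w 6) * V p q (shift q (shift q w 5) 5) -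
            q * w 5 / w 6 * thetaPair p (w 7) (q * w 5) * V p q (shift q (shift q w 5) 6)) +
      w 5 / w 6 * thetaProd₅ p w (w 5) * theta p (w 6 * (w 7)⁻¹) * theta p (q * w 5 * (w 6)⁻¹) *
        (thetaPair p (w 7) (w 5) * V p q (shift q (shift q w 6) 6) -
          q * w 6 / w 5 * thetaPair p (w 7) (q * w 6) * V p q (shift q (shift q w 5) 6)))
    ?_ ?_ ?_ h0 hprod ?_
  · intro l
    have hd := fun i j => differentiable_pinchProd hp hq
      (differentiable_shift (q := q) (differentiable_shift (q := q) (differentiable_expPath l) i) j)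
    exact ((hd 5 6).mul (hd 5 5)).mul (hd 6 6)
  · intro l s hD
    have hne : ∀ j, expPath l s j ≠ 0 := fun j => Complex.exp_ne_zero _
    have ha := fun j => (differentiable_expPath l j).analyticAt s
    have hV := fun i j (h : pinchProd p q (shift q (shift q (expPath l s) i) j) ≠ 0) =>
      analyticAt_V_of_pinchProd hp0 hq0 hp hq (differentiable_shift (q := q)
        (differentiable_shift (q := q) (differentiable_expPath l) i) j)
        (shift_ne_zero hq0 (shift_ne_zero hq0 hne i) j) h
    have hV66 := hV 6 6 (right_ne_zero_of_mul hD)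
    have hV55 := hV 5 5 (right_ne_zero_of_mul (left_ne_zero_of_mul hD))
    have hV56 := hV 5 6 (left_ne_zero_of_mul (left_ne_zero_of_mul hD))
    have hq' : AnalyticAt ℂ (fun _ : ℂ => q) s := analyticAt_const
    have hP := fun i j => analyticAt_thetaPair hp (ha i) (ha j) (hne i) (hne j)
    have hPq := fun i j => analyticAt_thetaPair hp (ha i) (hq'.fun_mul (ha j)) (hne i)
      (mul_ne_zero hq0 (hne j))
    have hT := fun i j => analyticAt_theta_comp hp ((ha i).fun_mul ((ha j).fun_inv (hne j)))
      (mul_ne_zero (hne i) (inv_ne_zero (hne j)))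
    have hTq := fun i j => analyticAt_theta_comp hp
      ((hq'.fun_mul (ha i)).fun_mul ((ha j).fun_inv (hne j)))
      (mul_ne_zero (mul_ne_zero hq0 (hne i)) (inv_ne_zero (hne j)))
    have hTq' := analyticAt_theta_comp hp ((hq'.fun_mul (ha 5)).fun_mul (ha 6))
      (mul_ne_zero (mul_ne_zero hq0 (hne 5)) (hne 6))
    have h5 := fun j => analyticAt_thetaProd₅ hp l j s
    refine AnalyticAt.fun_add (AnalyticAt.fun_sub ?_ ?_) ?_
    · exact (((((h5 7).fun_mul (hT 5 6)).fun_mul hTq').fun_mul (hTq 5 6)).fun_mul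
        (hTq 6 5)).fun_mul hV56
    · exact (((h5 6).fun_mul (hT 5 7)).fun_mul (hTq 6 5)).fun_mul (((hP 7 6).fun_mul hV55).fun_sub
        ((((hq'.fun_mul (ha 5)).fun_div (ha 6) (hne 6)).fun_mul (hPq 7 5)).fun_mul hV56))
    · exact (((((ha 5).fun_div (ha 6) (hne 6)).fun_mul (h5 5)).fun_mul (hT 6 7)).fun_mul
        (hTq 5 6)).fun_mul (((hP 7 5).fun_mul hV66).fun_sub
        ((((hq'.fun_mul (ha 6)).fun_div (ha 5) (hne 5)).fun_mul (hPq 7 6)).fun_mul hV56))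
  · -- eliminate two of the five functions between three relations in the unit polydisc
    intro w hw0 hw hw1 hgt hne
    have hgt' : ∀ j, ‖p‖ < ‖w j‖ ^ 2 := fun j => by
      have := hgt j
      rw [norm_pow] at this
      exact lt_of_pow_lt_pow_left₀ 2 (by positivity) (by rwa [← pow_mul])
    have e2 := secondContiguous_of_norm_lt hp0 hq0 hp hq hw0 hw hw1 hgt' (hne 5 6 (by decide))
      (hne 5 7 (by decide)) (hne 6 7 (by decide))
    have e5 := contiguous_of_norm_lt hp0 hq0 hp hq (shift_ne_zero hq0 hw0 5) (norm_shift_lt hq hw1 5)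
    have e6 := contiguous_of_norm_lt hp0 hq0 hp hq (shift_ne_zero hq0 hw0 6) (norm_shift_lt hq hw1 6)
    rw [shift_self, shift_of_ne q w (show (6 : Fin 8) ≠ 5 by decide),
      shift_of_ne q w (show (7 : Fin 8) ≠ 5 by decide)] at e5
    rw [shift_self, shift_of_ne q w (show (5 : Fin 8) ≠ 6 by decide),
      shift_of_ne q w (show (7 : Fin 8) ≠ 6 by decide),
      shift_comm q w (show (6 : Fin 8) ≠ 5 by decide)] at e6
    have f5 : thetaPair p (q * w 5) (w 6) =
      theta p (q * w 5 * w 6) * theta p (q * w 5 * (w 6)⁻¹) := rfl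
    have f6 : thetaPair p (w 5) (q * w 6) = -(w 5 / (q * w 6)) *
        (theta p (q * w 5 * w 6) * theta p (q * w 6 * (w 5)⁻¹)) := by
      rw [thetaPair, theta_div_comm hp (hw0 5) (mul_ne_zero hq0 (hw0 6)), mul_left_comm (w 5) q,
        ← mul_assoc q]
      ring
    rw [f5] at e5
    rw [f6] at e6
    clear f5 f6 hne
    have h5 := hw0 5
    have h6 := hw0 6
    generalize theta p (q * w 5 * w 6) = x₁ at *
    generalize theta p (q * w 5 * (w 6)⁻¹) = x₂ at *
    generalize theta p (q * w 6 * (w 5)⁻¹) = x₃ at *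
    generalize V p q (shift q (shift q w 5) 6) = V₀ at *
    generalize V p q (shift q (shift q w 5) 5) = V₁ at *
    generalize V p q (shift q (shift q w 6) 6) = V₂ at *
    generalize V p q (shift q (shift q w 5) 7) = A at *
    generalize V p q (shift q (shift q w 6) 7) = B at *
    have e5' : thetaPair p (w 7) (w 6) * V₁ - q * w 5 / w 6 * thetaPair p (w 7) (q * w 5) * V₀ =
        x₁ * x₂ * A := by
      apply mul_left_cancel₀ h6
      rw [mul_sub]
      field_simp
      linear_combination e5
    have e6' : thetaPair p (w 7) (w 5) * V₂ - q * w 6 / w 5 * thetaPair p (w 7) (q * w 6) * V₀ =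
        x₁ * x₃ * B := by
      have e6'' : q * w 6 * thetaPair p (w 7) (q * w 6) * V₀ - w 5 * thetaPair p (w 7) (w 5) * V₂ =
          -w 5 * (x₁ * x₃) * B := by
        rw [e6]
        field_simp
      apply mul_left_cancel₀ h5
      rw [mul_sub]
      field_simp
      linear_combination -e6''
    simp only [e5', e6']
    linear_combination x₁ * x₂ *
      x₃ * e2
  · exact mul_ne_zero (mul_ne_zero ((unpinched_iff hp hq).1 h56) ((unpinched_iff hp hq).1 h55))
      ((unpinched_iff hp hq).1 h66)

/-! ### The elliptic hypergeometric equation -/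

theorem theta_p_pow_four_mul {p z : ℂ} (hp0 : p ≠ 0) (hp : ‖p‖ < 1) (hz : z ≠ 0) :
    theta p (p ^ 4 * z) = (z ^ 4 * p ^ 6)⁻¹ * theta p z := by
  have h1 := mul_ne_zero hp0 hz
  have h2 := mul_ne_zero hp0 h1
  have h3 := mul_ne_zero hp0 h2
  rw [show p ^ 4 * z = p * (p * (p * (p * z))) by ring, theta_mul_p hp0 hp h3,
    theta_mul_p hp0 hp h2, theta_mul_p hp0 hp h1, theta_mul_p hp0 hp hz]
  field_simp

/-- The parameters of which those of the three functions `V` in the elliptic hypergeometric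
equation are obtained by multiplying the sixth or the seventh one twice, or both once, by `q`. -/
def baseParams (q : ℂ) (ε : Fin 8 → ℂ) (c x : ℂ) : Fin 8 → ℂ :=
  ![q / (c * ε 0), q / (c * ε 1), q / (c * ε 2), q / (c * ε 3), q / (c * ε 4),
    c * x / q, c * x⁻¹ / q, c / ε 7]

theorem solParams_eq_shift {q : ℂ} (hq0 : q ≠ 0) (ε : Fin 8 → ℂ) (c x : ℂ) :
    solParams q ε c x = shift q (shift q (baseParams q ε c x) 5) 6 := by
  funext j
  fin_cases j <;>
    simp [solParams, baseParams, shift, Function.update, div_eq_mul_inv, mul_comm q, hq0]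

theorem solParams_mul_eq_shift {q : ℂ} (hq0 : q ≠ 0) (ε : Fin 8 → ℂ) (c x : ℂ) :
    solParams q ε c (q * x) = shift q (shift q (baseParams q ε c x) 5) 5 := by
  funext j
  fin_cases j <;> simp [solParams, baseParams, shift, Function.update] <;> field_simp

theorem solParams_inv_mul_eq_shift {q : ℂ} (hq0 : q ≠ 0) (ε : Fin 8 → ℂ) (c x : ℂ) :
    solParams q ε c (q⁻¹ * x) = shift q (shift q (baseParams q ε c x) 6) 6 := by
  funext j
  fin_cases j <;> simp [solParams, baseParams, shift, Function.update] <;> field_simp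

theorem prod_theta_eq {p : ℂ} (hp : ‖p‖ < 1) {f : Fin 5 → ℂ} (hf : ∀ k, f k ≠ 0) :
    ∏ k, theta p (f k) = -(∏ k, f k) * ∏ k, theta p (f k)⁻¹ := by
  have : ∀ k, theta p (f k) = -f k * theta p (f k)⁻¹ := fun k => by
    rw [theta_inv hp (hf k)]
    field_simp [hf k]
  rw [Finset.prod_congr rfl fun k _ => this k, Finset.prod_mul_distrib, Finset.prod_neg]
  simp only [Finset.card_univ, Fintype.card_fin]
  ring

section

variable {p q c x : ℂ} {ε : Fin 8 → ℂ}

theorem ne_zero_of_balancing (hp0 : p ≠ 0) (hq0 : q ≠ 0) (hprod : ∏ k, ε k = p ^ 2 * q ^ 2)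
    (k : Fin 8) : ε k ≠ 0 := fun h =>
  mul_ne_zero (pow_ne_zero 2 hp0) (pow_ne_zero 2 hq0)
    (hprod.symm.trans (Finset.prod_eq_zero (Finset.mem_univ k) h))

theorem baseParams_ne_zero (hq0 : q ≠ 0) (hc : c ≠ 0) (hx : x ≠ 0) (hε : ∀ k, ε k ≠ 0)
    (j : Fin 8) : baseParams q ε c x j ≠ 0 := by
  fin_cases j <;> simp [baseParams, hq0, hc, hx, hε]

theorem prod_baseParams (hp0 : p ≠ 0) (hq0 : q ≠ 0) (hc : c ≠ 0) (hx : x ≠ 0)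
    (hprod : ∏ k, ε k = p ^ 2 * q ^ 2) (h6 : ε 6 = ε 7 / q) (h5 : c ^ 2 = ε 5 * ε 7 / p ^ 4) :
    ∏ j, baseParams q ε c x j = p ^ 2 := by
  have hε := ne_zero_of_balancing hp0 hq0 hprod
  have hε0 := hε 0
  have hε1 := hε 1
  have hε2 := hε 2
  have hε3 := hε 3
  have hε4 := hε 4
  have hε5 := hε 5
  have hε7 := hε 7
  rw [Fin.prod_univ_eight, h6] at hprod
  rw [Fin.prod_univ_eight]
  simp only [baseParams, Matrix.cons_val]
  field_simp at hprod h5 ⊢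
  have hε57 := mul_ne_zero hε5 hε7
  apply mul_left_cancel₀ hε57
  linear_combination -q ^ 3 * h5 - p ^ 2 * c ^ 2 * hprod

/-- The potential at `y` in terms of `a = cy/q`, `b = c/(qy)`, `e = c/ε_8` and the first five base
parameters, which do not depend on `x`. For `y = x` the numbers `a`, `b` are the sixth and the
seventh base parameter, and for `y = x⁻¹` they are interchanged. -/
theorem potential_eq (hp0 : p ≠ 0) (hq0 : q ≠ 0) (hp : ‖p‖ < 1) (hc : c ≠ 0)
    (hprod : ∏ k, ε k = p ^ 2 * q ^ 2) (h6 : ε 6 = ε 7 / q) (h5 : c ^ 2 = ε 5 * ε 7 / p ^ 4)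
    {y a b e : ℂ} (hy : y ≠ 0) (ha : a = c * y / q) (hb : b = c * y⁻¹ / q) (he : e = c / ε 7) :
    potential p q ε y = -(p ^ 8 * q ^ 4 * (a * b * e) ^ 4)⁻¹ * (a * e) *
      thetaProd₅ p (baseParams q ε c x) b * theta p (a * e⁻¹) * thetaPair p (q * a) e /
        (theta p (a * b⁻¹) * theta p (q * a * b⁻¹)) := by
  have hε := ne_zero_of_balancing hp0 hq0 hprod
  have hε5 := hε 5
  have hε7 := hε 7
  have e1 : a * b⁻¹ = y ^ 2 := by rw [ha, hb]; field_simp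
  have e2 : q * a * b⁻¹ = q * y ^ 2 := by rw [mul_assoc, e1]
  have e3 : ε 6 * y = a * e⁻¹ := by rw [ha, he, h6]; field_simp
  have e4 : ε 7 * y = q * a * e⁻¹ := by rw [ha, he]; field_simp
  have e5 : ε 5 * y = p ^ 4 * (q * a * e) := by
    rw [ha, he]
    field_simp at h5 ⊢
    linear_combination -h5
  have hT : ∏ k : Fin 5, theta p (ε (k.castLE (by norm_num)) * y) =
      -((∏ k : Fin 5, ε (k.castLE (by norm_num))) * y ^ 5) *
        thetaProd₅ p (baseParams q ε c x) b := by
    rw [prod_theta_eq hp fun k => mul_ne_zero (hε _) hy, Finset.prod_mul_distrib, thetaProd₅]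
    congr 1
    · simp
    · refine Finset.prod_congr rfl fun k _ => congrArg (theta p) ?_
      have := hε (k.castLE (by norm_num))
      fin_cases k <;> simp [baseParams, hb] at this ⊢ <;> field_simp
  have hP : (∏ k : Fin 5, ε (k.castLE (by norm_num))) * (ε 5 * ε 6 * ε 7) = p ^ 2 * q ^ 2 := by
    rw [← hprod, prod_fin_eight]
    ring
  have hP' : ∏ k : Fin 5, ε (k.castLE (by norm_num)) = p ^ 2 * q ^ 2 / (ε 5 * ε 6 * ε 7) :=
    eq_div_of_mul_eq (mul_ne_zero (mul_ne_zero hε5 (hε 6)) hε7) hP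
  have hε5' : ε 5 = c ^ 2 * p ^ 4 / ε 7 := by rw [h5]; field_simp
  have hqae : q * a * e ≠ 0 := by rw [ha, he]; positivity
  rw [potential, prod_fin_eight, hT, hP', e3, e4, e5, theta_p_pow_four_mul hp0 hp hqae, thetaPair,
    e1, e2, h6, hε5', mul_div_assoc, mul_div_assoc]
  generalize theta p (a * e⁻¹) = x₁
  generalize theta p (q * a * e⁻¹) = x₂
  generalize theta p (q * a * e) = x₃
  generalize theta p (y ^ 2) = x₄
  generalize theta p (q * y ^ 2) = x₅
  generalize thetaProd₅ p (baseParams q ε c x) b = x₆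
  rw [ha, hb, he]
  field_simp

/-- The constant `ν` in terms of the base parameters, with the same prefactor as the potential. -/
theorem nu_eq (hp0 : p ≠ 0) (hq0 : q ≠ 0) (hp : ‖p‖ < 1) (hc : c ≠ 0)
    (hprod : ∏ k, ε k = p ^ 2 * q ^ 2) (h6 : ε 6 = ε 7 / q) (h5 : c ^ 2 = ε 5 * ε 7 / p ^ 4)
    {a b e : ℂ} (hx : x ≠ 0) (ha : a = c * x / q) (hb : b = c * x⁻¹ / q) (he : e = c / ε 7) :
    nu p q ε = -(p ^ 8 * q ^ 4 * (a * b * e) ^ 4)⁻¹ * (a * b) *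
      thetaProd₅ p (baseParams q ε c x) e * theta p (q * a * b) := by
  have hε := ne_zero_of_balancing hp0 hq0 hprod
  have hε5 := hε 5
  have hε7 := hε 7
  have e5 : ε 5 * ε 7 / q = p ^ 4 * (q * a * b) := by
    rw [ha, hb]
    field_simp at h5 ⊢
    linear_combination -h5
  have hT : ∏ k : Fin 5, theta p (ε (k.castLE (by norm_num)) * ε 7 / q) =
      -((∏ k : Fin 5, ε (k.castLE (by norm_num))) * (ε 7 / q) ^ 5) *
        thetaProd₅ p (baseParams q ε c x) e := by
    rw [prod_theta_eq hp fun k => div_ne_zero (mul_ne_zero (hε _) hε7) hq0]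
    simp only [mul_div_assoc]
    rw [Finset.prod_mul_distrib, thetaProd₅]
    congr 1
    · simp [div_pow]
    · refine Finset.prod_congr rfl fun k _ => congrArg (theta p) ?_
      have := hε (k.castLE (by norm_num))
      fin_cases k <;> simp [baseParams, he] at this ⊢ <;> field_simp
  have hP : (∏ k : Fin 5, ε (k.castLE (by norm_num))) * (ε 5 * ε 6 * ε 7) = p ^ 2 * q ^ 2 := by
    rw [← hprod, prod_fin_eight]
    ring
  have hP' : ∏ k : Fin 5, ε (k.castLE (by norm_num)) = p ^ 2 * q ^ 2 / (ε 5 * ε 6 * ε 7) :=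
    eq_div_of_mul_eq (mul_ne_zero (mul_ne_zero hε5 (hε 6)) hε7) hP
  have hε5' : ε 5 = c ^ 2 * p ^ 4 / ε 7 := by rw [h5]; field_simp
  have hqab : q * a * b ≠ 0 := by rw [ha, hb]; positivity
  have hsplit : nu p q ε = (∏ k : Fin 5, theta p (ε (k.castLE (by norm_num)) * ε 7 / q)) *
      theta p (ε 5 * ε 7 / q) := Fin.prod_univ_castSucc _
  rw [hsplit, hT, hP', e5, theta_p_pow_four_mul hp0 hp hqab, h6, hε5']
  generalize theta p (q * a * b) = x₁
  generalize thetaProd₅ p (baseParams q ε c x) e = x₂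
  rw [ha, hb, he]
  field_simp

/-- The functional equation of `1 / Γ(z; p, q)`, written multiplicatively. If `z = p^{j+1}`, then
`q z` is a zero of `Γ`, and the inverse of zero makes the equation fail; otherwise it holds. -/
theorem inv_ellGamma_eq_of_ne (hq0 : q ≠ 0) (hp : ‖p‖ < 1) (hq : ‖q‖ < 1) {z z' : ℂ} (hz : z ≠ 0)
    (hz' : z' = q * z) (h : ∀ a b : ℕ, z' ≠ p ^ (a + 1) * q ^ (b + 1)) :
    (ellGamma p q z)⁻¹ = theta p z * (ellGamma p q z')⁻¹ := by
  rw [hz']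
  refine inv_ellGamma_eq hp hq0 hq fun h0 => ?_
  obtain ⟨j, hj⟩ := (qPoch_eq_zero_iff hp).1 h0
  apply h j 0
  rw [hz']
  field_simp at hj
  rw [← hj]
  ring

/-- The three values of the solution, over a common factor `M`. -/
theorem exists_f₁_eq (hq0 : q ≠ 0) (hp : ‖p‖ < 1) (hq : ‖q‖ < 1) (hc : c ≠ 0)
    (hε7 : ε 7 ≠ 0) {a b e : ℂ} (hx : x ≠ 0) (ha : a = c * x / q) (hb : b = c * x⁻¹ / q)
    (he : e = c / ε 7) (h1 : RegularPoint p q ε c x) (h2 : RegularPoint p q ε c (q * x))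
    (h3 : RegularPoint p q ε c (q⁻¹ * x)) : ∃ M : ℂ,
      f₁ p q ε c x = M * (thetaPair p (q * a) e * thetaPair p (q * b) e) *
        V p q (solParams q ε c x) ∧
      f₁ p q ε c (q * x) = M * (thetaPair p (q * b) e * thetaPair p b e) *
        V p q (solParams q ε c (q * x)) ∧
      f₁ p q ε c (q⁻¹ * x) = M * (thetaPair p (q * a) e * thetaPair p a e) *
        V p q (solParams q ε c (q⁻¹ * x)) := by
  have ha0 : a ≠ 0 := by rw [ha]; positivity
  have hb0 : b ≠ 0 := by rw [hb]; positivity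
  have he0 : e ≠ 0 := by rw [he]; positivity
  have A0 : solGammaArgs ε c x = ![q * a * e, q * b * e, q * a * e⁻¹, q * b * e⁻¹] := by
    rw [solGammaArgs, ha, hb, he]
    funext i
    fin_cases i <;> simp <;> field_simp
  have A1 : solGammaArgs ε c (q * x) =
      ![q * (q * a * e), b * e, q * (q * a * e⁻¹), b * e⁻¹] := by
    rw [solGammaArgs, ha, hb, he]
    funext i
    fin_cases i <;> simp <;> field_simp
  have A2 : solGammaArgs ε c (q⁻¹ * x) =
      ![a * e, q * (q * b * e), a * e⁻¹, q * (q * b * e⁻¹)] := by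
    rw [solGammaArgs, ha, hb, he]
    funext i
    fin_cases i <;> simp <;> field_simp
  have R0 := h1.2
  have R1 := h2.2
  have R2 := h3.2
  rw [A0] at R0
  rw [A1] at R1
  rw [A2] at R2
  have g := fun {z z' : ℂ} => inv_ellGamma_eq_of_ne (p := p) hq0 hp hq (z := z) (z' := z')
  have he0' := inv_ne_zero he0
  have qa0 := mul_ne_zero hq0 ha0
  have qb0 := mul_ne_zero hq0 hb0
  have B0 := g (mul_ne_zero qa0 he0) rfl (R1 0)
  have B1 := g (mul_ne_zero qb0 he0) rfl (R2 1)
  have B2 := g (mul_ne_zero qa0 he0') rfl (R1 2)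
  have B3 := g (mul_ne_zero qb0 he0') rfl (R2 3)
  have C0 := g (mul_ne_zero ha0 he0) (mul_assoc _ _ _) (R0 0)
  have C1 := g (mul_ne_zero hb0 he0) (mul_assoc _ _ _) (R0 1)
  have C2 := g (mul_ne_zero ha0 he0') (mul_assoc _ _ _) (R0 2)
  have C3 := g (mul_ne_zero hb0 he0') (mul_assoc _ _ _) (R0 3)
  refine ⟨(ellGamma p q (q * (q * a * e)))⁻¹ * (ellGamma p q (q * (q * b * e)))⁻¹ *
    (ellGamma p q (q * (q * a * e⁻¹)))⁻¹ * (ellGamma p q (q * (q * b * e⁻¹)))⁻¹, ?_, ?_, ?_⟩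
  · rw [f₁, A0, Fin.prod_univ_four, div_eq_mul_inv]
    simp only [Matrix.cons_val, mul_inv, B0, B1, B2, B3, thetaPair]
    ring
  · rw [f₁, A1, Fin.prod_univ_four, div_eq_mul_inv]
    simp only [Matrix.cons_val, mul_inv, C1, C3, B1, B3, thetaPair]
    ring
  · rw [f₁, A2, Fin.prod_univ_four, div_eq_mul_inv]
    simp only [Matrix.cons_val, mul_inv, C0, C2, B0, B2, thetaPair]
    ring

theorem ellHypEq_f₁ (hp0 : p ≠ 0) (hq0 : q ≠ 0) (hp : ‖p‖ < 1) (hq : ‖q‖ < 1)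
    (hprod : ∏ k, ε k = p ^ 2 * q ^ 2) (h6 : ε 6 = ε 7 / q) (h5 : c ^ 2 = ε 5 * ε 7 / p ^ 4)
    (hx : x ≠ 0) (hm : ∀ m : ℤ, x ^ 2 ≠ p ^ m ∧ q * x ^ 2 ≠ p ^ m ∧ q * x⁻¹ ^ 2 ≠ p ^ m)
    (h1 : RegularPoint p q ε c x) (h2 : RegularPoint p q ε c (q * x))
    (h3 : RegularPoint p q ε c (q⁻¹ * x)) : EllHypEq p q ε (f₁ p q ε c) x := by
  have hε := ne_zero_of_balancing hp0 hq0 hprod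
  have hc : c ≠ 0 := by
    rw [← pow_ne_zero_iff two_ne_zero, h5]
    exact div_ne_zero (mul_ne_zero (hε 5) (hε 7)) (pow_ne_zero 4 hp0)
  have hw0 := baseParams_ne_zero hq0 hc hx hε
  have main := threeTerm_shift hp0 hq0 hp hq hw0 (prod_baseParams hp0 hq0 hc hx hprod h6 h5)
    (solParams_eq_shift hq0 ε c x ▸ h1.1) (solParams_mul_eq_shift hq0 ε c x ▸ h2.1)
    (solParams_inv_mul_eq_shift hq0 ε c x ▸ h3.1)
  rw [← solParams_eq_shift hq0, ← solParams_mul_eq_shift hq0, ← solParams_inv_mul_eq_shift hq0]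
    at main
  obtain ⟨a, ha⟩ : ∃ a, a = c * x / q := ⟨_, rfl⟩
  obtain ⟨b, hb⟩ : ∃ b, b = c * x⁻¹ / q := ⟨_, rfl⟩
  obtain ⟨e, he⟩ : ∃ e, e = c / ε 7 := ⟨_, rfl⟩
  have wa : baseParams q ε c x 5 = a := ha.symm
  have wb : baseParams q ε c x 6 = b := hb.symm
  have we : baseParams q ε c x 7 = e := he.symm
  rw [wa, wb, we] at main
  have ha0 : a ≠ 0 := wa ▸ hw0 5
  have hb0 : b ≠ 0 := wb ▸ hw0 6
  have he0 : e ≠ 0 := we ▸ hw0 7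
  obtain ⟨M, F0, F1, F2⟩ := exists_f₁_eq hq0 hp hq hc (hε 7) hx ha hb he h1 h2 h3
  have hA := potential_eq (x := x) hp0 hq0 hp hc hprod h6 h5 hx ha hb he
  have hA' := potential_eq (x := x) (y := x⁻¹) (a := b) (b := a) hp0 hq0 hp hc hprod h6 h5
    (inv_ne_zero hx) hb (by rw [inv_inv, ha]) he
  have e1 : a * b⁻¹ = x ^ 2 := by rw [ha, hb]; field_simp
  have e2 : q * b * a⁻¹ = q * x⁻¹ ^ 2 := by rw [ha, hb]; field_simp
  have n1 : theta p (a * b⁻¹) ≠ 0 := by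
    rw [e1, Ne, theta_eq_zero_iff hp0 hp (pow_ne_zero 2 hx)]
    exact fun ⟨m, h⟩ => (hm m).1 h
  have n2 : theta p (q * a * b⁻¹) ≠ 0 := by
    rw [mul_assoc, e1, Ne, theta_eq_zero_iff hp0 hp (mul_ne_zero hq0 (pow_ne_zero 2 hx))]
    exact fun ⟨m, h⟩ => (hm m).2.1 h
  have n3 : theta p (q * b * a⁻¹) ≠ 0 := by
    rw [e2, Ne, theta_eq_zero_iff hp0 hp (mul_ne_zero hq0 (pow_ne_zero 2 (inv_ne_zero hx)))]
    exact fun ⟨m, h⟩ => (hm m).2.2 h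
  rw [theta_div_comm hp hb0 ha0] at hA'
  rw [thetaPair_comm hp he0 ha0, thetaPair_comm hp he0 hb0,
    thetaPair_comm hp he0 (mul_ne_zero hq0 ha0), thetaPair_comm hp he0 (mul_ne_zero hq0 hb0)] at main
  rw [EllHypEq, hA, hA', nu_eq hp0 hq0 hp hc hprod h6 h5 hx ha hb he, F0, F1, F2]
  clear hA hA' F0 F1 F2 e1 e2 hw0 wa wb we h1 h2 h3 hm ha hb he
  generalize theta p (a * b⁻¹) = x₁ at *
  generalize theta p (q * a * b⁻¹) = x₂ at *
  generalize theta p (q * b * a⁻¹) = x₃ at *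
  generalize theta p (q * a * b) = x₄ at *
  generalize theta p (a * e⁻¹) = x₅ at *
  generalize theta p (b * e⁻¹) = x₆ at *
  generalize thetaPair p a e = y₁ at *
  generalize thetaPair p b e = y₂ at *
  generalize thetaPair p (q * a) e = y₃ at *
  generalize thetaPair p (q * b) e = y₄ at *
  generalize V p q (solParams q ε c x) = V₀ at *
  generalize V p q (solParams q ε c (q * x)) = V₁ at *
  generalize V p q (solParams q ε c (q⁻¹ * x)) = V₂ at *
  generalize thetaProd₅ p (baseParams q ε c x) a = z₁ at *
  generalize thetaProd₅ p (baseParams q ε c x) b = z₂ at *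
  generalize thetaProd₅ p (baseParams q ε c x) e = z₃ at *
  -- the equation is a multiple of the three-term relation
  refine Eq.trans ?_ (mul_eq_zero_of_right (-(p ^ 8 * q ^ 4 * (a * b * e) ^ 4)⁻¹ * a * b * M * y₃ *
    y₄ / (x₁ * x₂ * x₃)) main)
  field_simp
  ring

/-- The contiguous relation follows by dividing the eighth parameter by `q`. -/
theorem contiguous_relation (hp0 : p ≠ 0) (hq0 : q ≠ 0) (hp : ‖p‖ < 1) (hq : ‖q‖ < 1)
    {t : Fin 8 → ℂ} (hprod : ∏ j, t j = p ^ 2 * q ^ 2) (h : Unpinched p q t)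
    (h5 : Unpinched p q (contiguous q t 5 7)) (h6 : Unpinched p q (contiguous q t 6 7)) :
    t 6 * (theta p (t 7 * t 6 / q) * theta p (t 7 * (t 6)⁻¹ / q)) * V p q (contiguous q t 5 7) -
        t 5 * (theta p (t 7 * t 5 / q) * theta p (t 7 * (t 5)⁻¹ / q)) *
          V p q (contiguous q t 6 7) =
      t 6 * (theta p (t 5 * t 6) * theta p (t 5 * (t 6)⁻¹)) * V p q t := by
  have h0 := ne_zero_of_balancing hp0 hq0 hprod
  obtain ⟨s, hs⟩ : ∃ s, s = Function.update t 7 (q⁻¹ * t 7) := ⟨_, rfl⟩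
  have s7 : s 7 = q⁻¹ * t 7 := by rw [hs, Function.update_self]
  have sne : ∀ j, j ≠ 7 → s j = t j := fun j hj => by rw [hs, Function.update_of_ne hj]
  have c5 : shift q s 5 = contiguous q t 5 7 := by
    rw [shift, sne 5 (by decide), hs, contiguous, Function.update_comm (by decide)]
  have c6 : shift q s 6 = contiguous q t 6 7 := by
    rw [shift, sne 6 (by decide), hs, contiguous, Function.update_comm (by decide)]
  have c7 : shift q s 7 = t := by
    rw [shift, s7, hs, mul_inv_cancel_left₀ hq0, Function.update_idem, Function.update_eq_self]
  have hs0 : ∀ j, s j ≠ 0 := fun j => by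
    rcases eq_or_ne j 7 with rfl | hj
    · rw [s7]
      exact mul_ne_zero (inv_ne_zero hq0) (h0 7)
    · rw [sne j hj]
      exact h0 j
  have hsp : ∏ j, s j = p ^ 2 * q := by
    rw [Fin.prod_univ_eight] at hprod ⊢
    rw [s7, sne 0 (by decide), sne 1 (by decide), sne 2 (by decide), sne 3 (by decide),
      sne 4 (by decide), sne 5 (by decide), sne 6 (by decide)]
    field_simp
    linear_combination hprod
  have key := contiguous_shift hp0 hq0 hp hq hs0 hsp (c5 ▸ h5) (c6 ▸ h6) (c7.symm ▸ h)
  rw [c5, c6, c7, thetaPair, thetaPair, thetaPair, s7, sne 5 (by decide), sne 6 (by decide)] at key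
  simp only [div_eq_inv_mul, ← mul_assoc q⁻¹]
  exact key

end

end EllHyp

end

theorem mainTheorem8 (p q : ℂ) (hp0 : p ≠ 0) (hq0 : q ≠ 0) (hp : ‖p‖ < 1) (hq : ‖q‖ < 1) :
    (∀ t : Fin 8 → ℂ, ∏ j, t j = p ^ 2 * q ^ 2 →
      EllHyp.Unpinched p q t →
      EllHyp.Unpinched p q (EllHyp.contiguous q t 5 7) →
      EllHyp.Unpinched p q (EllHyp.contiguous q t 6 7) →
      t 6 * (EllHyp.theta p (t 7 * t 6 / q) * EllHyp.theta p (t 7 * (t 6)⁻¹ / q)) *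
            EllHyp.V p q (EllHyp.contiguous q t 5 7) -
          t 5 * (EllHyp.theta p (t 7 * t 5 / q) * EllHyp.theta p (t 7 * (t 5)⁻¹ / q)) *
            EllHyp.V p q (EllHyp.contiguous q t 6 7) =
        t 6 * (EllHyp.theta p (t 5 * t 6) * EllHyp.theta p (t 5 * (t 6)⁻¹)) *
          EllHyp.V p q t) ∧
    (∀ (ε : Fin 8 → ℂ) (c : ℂ), ∏ k, ε k = p ^ 2 * q ^ 2 → ε 6 = ε 7 / q →
      c ^ 2 = ε 5 * ε 7 / p ^ 4 →
      ∀ x : ℂ, x ≠ 0 →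
        (∀ m : ℤ, x ^ 2 ≠ p ^ m ∧ q * x ^ 2 ≠ p ^ m ∧ q * x⁻¹ ^ 2 ≠ p ^ m) →
        EllHyp.RegularPoint p q ε c x →
        EllHyp.RegularPoint p q ε c (q * x) →
        EllHyp.RegularPoint p q ε c (q⁻¹ * x) →
        EllHyp.EllHypEq p q ε (EllHyp.f₁ p q ε c) x) := ⟨fun _ hprod h h5 h6 => EllHyp.contiguous_relation hp0 hq0 hp hq hprod h h5 h6,
    fun _ _ hprod h6 h5 _ hx hm h1 h2 h3 =>
      EllHyp.ellHypEq_f₁ hp0 hq0 hp hq hprod h6 h5 hx hm h1 h2 h3⟩
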